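/- **Priority node-weighted Steiner tree (PNWST).** An instance consists of a connected undirected graph $G=(V,E)$ with $n=|V|$, a source $s\in V$, terminals $T\subseteq V\setminus\{s\}$, a priority $P(v)\ge 0$ of every terminal $v$, and vertex weights $w:V\times\mathbb R_{\ge 0}\to\mathbb R_{\ge 0}$. Let $k$ be the number of distinct priorities of the terminals. Put $P(v)=0$ for $v\notin T\cup\{s\}$, and let $P(s)$ be the largest priority of a terminal ($0$ if $T=\emptyset$). As usual, $w(v,r)=0$ for $0\le r\le P(v)$, and $w(v,r_1)\le w(v,r_2)$ for $0\le r_1\le r_2$, for all $v\in V$. A *PNWST* is a tree $\mathcal T\subseteq G$ containing $s$ and all terminals, with vertex rates $R(v)\ge 0$, such that for each $t\in T$ all vertices of the $s$–$t$ path in $\mathcal T$ (ends included) have rate at least $P(t)$. Its weight is $\sum_{v\in V(\mathcal T)}w(v,R(v))$, and $\mathrm{OPT}$ is the minimum weight of a PNWST. **Greedy algorithm.** Let $\sigma_b(u,v)$ be the minimum, over all $u$–$v$ paths in $G$, of the sum of $w(x,b)$ over the vertices $x\ne u,v$ of the path. The algorithm maintains rates $R$ and a collection $\mathcal F$ of trees,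 each represented by its root. Initially the roots are the elements of $T\cup\{s\}$, and $R=P$. While $|\mathcal F|>1$, choose the root $r$ of a tree of $\mathcal F$, a center $v\in V$, a real $b$ with $0\le b\le P(r)$, and a nonempty set $S$ of roots of other trees of $\mathcal F$ with $P(r')\le b$ for all $r'\in S$, such that $$\gamma=\frac{1}{|S|+1}\Big(\sigma_b(r,v)+w(v,b)+\sum_{r'\in S}\sigma_{P(r')}(v,r')\Big)$$ is minimum. Take an $r$–$v$ path attaining $\sigma_b(r,v)$ and, for each $r'\in S$, a $v$–$r'$ path attaining $\sigma_{P(r')}(v,r')$. Raise $R$ to at least $b$ on the first path (including $v$) and to at least $P(r')$ on the path to $r'$, for each $r'\in S$. Replace the $|S|+1$ chosen trees by one tree with root $r$. When $|\mathcal F|=1$, return $R$. All ties are broken arbitrarily. **Theorem.** 1. For every instance and every run of the greedy algorithm, there is a tree that together with the returned rates $R$ is a PNWST, and every such PNWST has weight at most $2\ln(|T|+1)\cdot\mathrm{OPT}$. 2. There are a constant $C$ and a single program for a real random access machine that on every instance halts and outputs a PNWST $(\mathcal T,R)$, where $R$ is the result of a run of the greedy algorithm. Hence its weight is at most $2\ln(|T|+1)\cdot\mathrm{OPT}$.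 If $T\neq\emptyset$, the program halts after at most $C\,n^4k\ln n$ steps. The machine takes unit time for the addition, truncated subtraction and comparison of natural numbers, the four operations and comparison of real numbers, the conversion of a natural number to a real number, access to a cell of an array, and queries to the input ($n$, $s$, membership in $T$, adjacency, $P(v)$, and $w(v,x)$ for a computed real $x$; a negative rate is read as $0$). Its only numerical constants are natural numbers; real numbers cannot be rounded or converted to natural numbers. -/

import Mathlib

open scoped NNReal

/-! ### The problem -/

/-- An instance of the priority node-weighted Steiner tree problem on the vertex set
`{0, …, n - 1}`: a connected undirected graph, a source `s`, terminals `T ⊆ V \ {s}`, priorities and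
weights `w v r` of a vertex `v` at rate `r`. Vertices other than the terminals and the source have
priority zero, and the source carries the largest priority of a terminal. Every vertex has weight
zero up to its own priority, and its weight does not decrease with the rate. -/
structure PriorityNWST where
  n : ℕ
  G : SimpleGraph (Fin n)
  connected : G.Connected
  s : Fin n
  T : Finset (Fin n)
  source_notMem : s ∉ T
  P : Fin n → ℝ≥0
  w : Fin n → ℝ≥0 → ℝ≥0
  prio_other : ∀ v, v ∉ T → v ≠ s → P v = 0
  prio_source : P s = T.sup P
  weight_zero : ∀ v r, r ≤ P v → w v r = 0
  weight_mono : ∀ v, Monotone (w v)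

namespace PriorityNWST

variable (I : PriorityNWST)

/-- The number `k` of distinct priorities of the terminals. -/
noncomputable def k : ℕ := (I.T.image I.P).card

/-- The subgraph `H` of `G` with the vertex rates `R` is a priority node-weighted Steiner tree:
`H` is a tree that contains `s`, and the path in `H` from `s` to a terminal `t` exists and uses only
vertices (its ends included) of rate at least `P t`. -/
def IsPNWST (H : I.G.Subgraph) (R : Fin I.n → ℝ≥0) : Prop :=
  H.coe.IsTree ∧ I.s ∈ H.verts ∧
    ∀ t ∈ I.T, ∃ p : I.G.Walk I.s t, p.IsPath ∧ p.toSubgraph ≤ H ∧ ∀ u ∈ p.support, I.P t ≤ R u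

open Classical in
/-- The weight of a tree `H` with vertex rates `R`: the sum of `w v (R v)` over its vertices. -/
noncomputable def weight (H : I.G.Subgraph) (R : Fin I.n → ℝ≥0) : ℝ≥0 :=
  ∑ v with v ∈ H.verts, I.w v (R v)

/-- The minimum weight of a priority node-weighted Steiner tree. -/
noncomputable def opt : ℝ≥0 :=
  sInf {c | ∃ (H : I.G.Subgraph) (R : Fin I.n → ℝ≥0), I.IsPNWST H R ∧ c = I.weight H R}

/-! ### The greedy algorithm -/

/-- The weight of a path at rate `b`, its two ends not included. -/
def pathWeight (b : ℝ≥0) {u v : Fin I.n} (p : I.G.Path u v) : ℝ≥0 :=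
  ∑ x ∈ p.1.support.toFinset \ {u, v}, I.w x b

/-- `σ_b(u, v)`: the minimum weight of a path from `u` to `v` at rate `b`, ends not included. -/
noncomputable def sigma (b : ℝ≥0) (u v : Fin I.n) : ℝ≥0 := ⨅ p : I.G.Path u v, I.pathWeight b p

/-- A choice made in one iteration: the root `r` of the root tree, the center `v`, the rate `b` and
the set `S` of the roots of the other trees that are merged. -/
structure Choice where
  r : Fin I.n
  v : Fin I.n
  b : ℝ≥0
  S : Finset (Fin I.n)

variable {I}

/-- The choices allowed when `M` is the set of the roots of the current rate trees. -/
def Choice.Valid (c : I.Choice) (M : Finset (Fin I.n)) : Prop :=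
  c.r ∈ M ∧ c.S ⊆ M ∧ c.S.Nonempty ∧ c.r ∉ c.S ∧ c.b ≤ I.P c.r ∧ ∀ r' ∈ c.S, I.P r' ≤ c.b

/-- The cost-to-connectivity ratio of a choice. -/
noncomputable def Choice.ratio (c : I.Choice) : ℝ≥0 :=
  (I.sigma c.b c.r c.v + I.w c.v c.b + ∑ r' ∈ c.S, I.sigma (I.P r') c.v r') / (c.S.card + 1)

/-- The upgraded rates: vertices on the path `p` from the root to the center (the center included)
are raised to at least `b`, and vertices on the path `q r'` from the center to a root `r'` in `S`
to at least `P r'`. -/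
noncomputable def Choice.upgrade (c : I.Choice) (p : I.G.Path c.r c.v)
    (q : ∀ r', I.G.Path c.v r') (R : Fin I.n → ℝ≥0) : Fin I.n → ℝ≥0 := fun u =>
  max (max (R u) (if u ∈ p.1.support then c.b else 0))
    (c.S.sup fun r' => if u ∈ (q r').1.support then I.P r' else 0)

variable (I)

/-- One iteration of the greedy algorithm. The state consists of the set of the roots of the
current rate trees (all that the algorithm uses of these trees) and of the current vertex rates.
An allowed choice of minimum ratio is made, with ties broken in any way, rates are upgraded
along arbitrary minimum weight paths, and the chosen trees are merged into one tree with
root `r`. -/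
def GreedyStep (x y : Finset (Fin I.n) × (Fin I.n → ℝ≥0)) : Prop :=
  1 < x.1.card ∧
  ∃ c : I.Choice, c.Valid x.1 ∧ (∀ c' : I.Choice, c'.Valid x.1 → c.ratio ≤ c'.ratio) ∧
  ∃ (p : I.G.Path c.r c.v) (q : ∀ r', I.G.Path c.v r'),
    I.pathWeight c.b p = I.sigma c.b c.r c.v ∧
    (∀ r' ∈ c.S, I.pathWeight (I.P r') (q r') = I.sigma (I.P r') c.v r') ∧
    y.1 = insert c.r (x.1 \ insert c.r c.S) ∧ y.2 = c.upgrade p q x.2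

/-- `R` is returned by some run of the greedy algorithm, which starts with the singleton trees at
the terminals and the source and with the rates `P`, and stops when one tree is left. -/
def GreedyOutput (R : Fin I.n → ℝ≥0) : Prop :=
  ∃ M : Finset (Fin I.n),
    Relation.ReflTransGen I.GreedyStep (insert I.s I.T, I.P) (M, R) ∧ M.card = 1

end PriorityNWST

/-! ### The machine model

A real random access machine, programmed in a small imperative language. The memory consists of
finitely many named arrays (those that occur in the program) of natural numbers and of real numbers,
with three indices each; a scalar is the cell `0, 0, 0` of an array. Each arithmetic operation,
comparison, memory access and query to the input takes one step. There is no multiplication or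
division of natural numbers, no rounding of real numbers, and no real constant but natural numbers.
The input is read through unit time queries. -/

namespace RealRAM

/-- The contents of the memory: `nat a i j l` is the cell `i, j, l` of array `a`. -/
structure State where
  nat : ℕ → ℕ → ℕ → ℕ → ℕ
  real : ℕ → ℕ → ℕ → ℕ → ℝ

/-- The initial memory: all cells hold zero. -/
def State.zero : State := ⟨fun _ _ _ _ => 0, fun _ _ _ _ => 0⟩

def State.setNat (σ : State) (a i j l x : ℕ) : State :=
  { σ with nat := fun a' i' j' l' =>
      if a' = a ∧ i' = i ∧ j' = j ∧ l' = l then x else σ.nat a' i' j' l' }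

noncomputable def State.setReal (σ : State) (a i j l : ℕ) (x : ℝ) : State :=
  { σ with real := fun a' i' j' l' =>
      if a' = a ∧ i' = i ∧ j' = j ∧ l' = l then x else σ.real a' i' j' l' }

/-- Expressions for natural numbers: literals, the number of vertices, the source, a memory cell,
the sum, and the truncated difference. -/
inductive NExp where
  | lit (c : ℕ)
  | numVerts
  | source
  | get (a : ℕ) (i j l : NExp)
  | add (e f : NExp)
  | sub (e f : NExp)

/-- Expressions for real numbers. `prio v` and `weight v x` ask the input for the priority of `v`
and for the weight of `v` at rate `x`. -/
inductive RExp where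
  | ofNat (e : NExp)
  | get (a : ℕ) (i j l : NExp)
  | add (e f : RExp)
  | sub (e f : RExp)
  | mul (e f : RExp)
  | div (e f : RExp)
  | prio (v : NExp)
  | weight (v : NExp) (x : RExp)

/-- Tests. `isTerm v` and `adj u v` ask the input whether `v` is a terminal and whether `uv` is
an edge. -/
inductive BExp where
  | leNat (e f : NExp)
  | leReal (e f : RExp)
  | isTerm (v : NExp)
  | adj (u v : NExp)
  | not (b : BExp)
  | and (b c : BExp)

/-- Programs: no operation, assignment to a cell of an array, composition, conditional, and
while loop. -/
inductive Cmd where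
  | skip
  | setNat (a : ℕ) (i j l e : NExp)
  | setReal (a : ℕ) (i j l : NExp) (e : RExp)
  | seq (c d : Cmd)
  | ite (b : BExp) (c d : Cmd)
  | loop (b : BExp) (c : Cmd)

/-- The number of steps that it takes to evaluate an expression: one for each node. -/
def NExp.cost : NExp → ℕ
  | lit _ => 1
  | numVerts => 1
  | source => 1
  | get _ i j l => i.cost + j.cost + l.cost + 1
  | add e f => e.cost + f.cost + 1
  | sub e f => e.cost + f.cost + 1

/-- The number of steps that it takes to evaluate an expression for a real number. -/
def RExp.cost : RExp → ℕ
  | ofNat e => e.cost + 1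
  | get _ i j l => i.cost + j.cost + l.cost + 1
  | add e f => e.cost + f.cost + 1
  | sub e f => e.cost + f.cost + 1
  | mul e f => e.cost + f.cost + 1
  | div e f => e.cost + f.cost + 1
  | prio v => v.cost + 1
  | weight v x => v.cost + x.cost + 1

/-- The number of steps that it takes to evaluate a test. -/
def BExp.cost : BExp → ℕ
  | leNat e f => e.cost + f.cost + 1
  | leReal e f => e.cost + f.cost + 1
  | isTerm v => v.cost + 1
  | adj u v => u.cost + v.cost + 1
  | not b => b.cost + 1
  | and b c => b.cost + c.cost + 1

variable (I : PriorityNWST)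

def NExp.val (σ : State) : NExp → ℕ
  | lit c => c
  | numVerts => I.n
  | source => I.s
  | get a i j l => σ.nat a (i.val σ) (j.val σ) (l.val σ)
  | add e f => e.val σ + f.val σ
  | sub e f => e.val σ - f.val σ

/-- The value of an expression. A query about a number that is not a vertex is answered by zero,
and a negative rate in a query is read as the rate zero. -/
noncomputable def RExp.val (σ : State) : RExp → ℝ
  | ofNat e => (e.val I σ : ℝ)
  | get a i j l => σ.real a (i.val I σ) (j.val I σ) (l.val I σ)
  | add e f => e.val σ + f.val σ
  | sub e f => e.val σ - f.val σ
  | mul e f => e.val σ * f.val σ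
  | div e f => e.val σ / f.val σ
  | prio v => if h : v.val I σ < I.n then (I.P ⟨v.val I σ, h⟩ : ℝ) else 0
  | weight v x => if h : v.val I σ < I.n then (I.w ⟨v.val I σ, h⟩ (x.val σ).toNNReal : ℝ) else 0

/-- The truth of a test. Numbers that are not vertices are neither terminals nor adjacent to
anything. -/
def BExp.Holds (σ : State) : BExp → Prop
  | leNat e f => e.val I σ ≤ f.val I σ
  | leReal e f => e.val I σ ≤ f.val I σ
  | isTerm v => ∃ h : v.val I σ < I.n, (⟨v.val I σ, h⟩ : Fin I.n) ∈ I.T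
  | adj u v => ∃ (hu : u.val I σ < I.n) (hv : v.val I σ < I.n),
      I.G.Adj ⟨u.val I σ, hu⟩ ⟨v.val I σ, hv⟩
  | not b => ¬ b.Holds σ
  | and b c => b.Holds σ ∧ c.Holds σ

/-- `Exec I c σ t τ`: on input `I`, the program `c` started with memory `σ` halts after exactly `t`
steps with memory `τ`. -/
inductive Exec : Cmd → State → ℕ → State → Prop where
  | skip (σ : State) : Exec .skip σ 1 σ
  | setNat (a : ℕ) (i j l e : NExp) (σ : State) :
      Exec (.setNat a i j l e) σ (i.cost + j.cost + l.cost + e.cost + 1)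
        (σ.setNat a (i.val I σ) (j.val I σ) (l.val I σ) (e.val I σ))
  | setReal (a : ℕ) (i j l : NExp) (e : RExp) (σ : State) :
      Exec (.setReal a i j l e) σ (i.cost + j.cost + l.cost + e.cost + 1)
        (σ.setReal a (i.val I σ) (j.val I σ) (l.val I σ) (e.val I σ))
  | seq {c d : Cmd} {σ τ ρ : State} {t u : ℕ} :
      Exec c σ t τ → Exec d τ u ρ → Exec (.seq c d) σ (t + u) ρ
  | ite_true {b : BExp} {c d : Cmd} {σ τ : State} {t : ℕ} :
      b.Holds I σ → Exec c σ t τ → Exec (.ite b c d) σ (b.cost + t) τ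
  | ite_false {b : BExp} {c d : Cmd} {σ τ : State} {t : ℕ} :
      ¬ b.Holds I σ → Exec d σ t τ → Exec (.ite b c d) σ (b.cost + t) τ
  | loop_true {b : BExp} {c : Cmd} {σ τ ρ : State} {t u : ℕ} :
      b.Holds I σ → Exec c σ t τ → Exec (.loop b c) τ u ρ → Exec (.loop b c) σ (b.cost + t + u) ρ
  | loop_false {b : BExp} {c : Cmd} {σ : State} :
      ¬ b.Holds I σ → Exec (.loop b c) σ b.cost σ

variable {I}

/-- The final memory and the number of steps are determined by the program, the input and the
initial memory. -/
theorem Exec.deterministic {c : Cmd} {σ τ τ' : State} {t t' : ℕ}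
    (h : Exec I c σ t τ) (h' : Exec I c σ t' τ') : t = t' ∧ τ = τ' := by
  induction h generalizing t' τ' with
  | skip => cases h'; exact ⟨rfl, rfl⟩
  | setNat => cases h'; exact ⟨rfl, rfl⟩
  | setReal => cases h'; exact ⟨rfl, rfl⟩
  | seq _ _ ih₁ ih₂ =>
    cases h' with
    | seq h₁ h₂ =>
      obtain ⟨rfl, rfl⟩ := ih₁ h₁
      obtain ⟨rfl, rfl⟩ := ih₂ h₂
      exact ⟨rfl, rfl⟩
  | ite_true hb _ ih =>
    cases h' with
    | ite_true _ h₁ => obtain ⟨rfl, rfl⟩ := ih h₁; exact ⟨rfl, rfl⟩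
    | ite_false hn _ => exact absurd hb hn
  | ite_false hb _ ih =>
    cases h' with
    | ite_true hn _ => exact absurd hn hb
    | ite_false _ h₁ => obtain ⟨rfl, rfl⟩ := ih h₁; exact ⟨rfl, rfl⟩
  | loop_true hb _ _ ih₁ ih₂ =>
    cases h' with
    | loop_true _ h₁ h₂ =>
      obtain ⟨rfl, rfl⟩ := ih₁ h₁
      obtain ⟨rfl, rfl⟩ := ih₂ h₂
      exact ⟨rfl, rfl⟩
    | loop_false hn => exact absurd hb hn
  | loop_false hb =>
    cases h' with
    | loop_true hn _ _ => exact absurd hn hb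
    | loop_false _ => exact ⟨rfl, rfl⟩

/-- The memory `σ` holds the tree `H` with the rates `R`: natural array `0` marks the vertices of
`H`, natural array `1` is the adjacency matrix of `H`, and real array `0` holds the rates. -/
def State.Holds (σ : State) (H : I.G.Subgraph) (R : Fin I.n → ℝ≥0) : Prop :=
  (∀ v : Fin I.n, σ.nat 0 v 0 0 ≠ 0 ↔ v ∈ H.verts) ∧
  (∀ u v : Fin I.n, σ.nat 1 u v 0 ≠ 0 ↔ H.Adj u v) ∧
  ∀ v : Fin I.n, σ.real 0 v 0 0 = R v

end RealRAM

/-! ### Memory updates -/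

namespace RealRAM

variable {I : PriorityNWST}

/-! Approximation. Let h be the current number of roots and γ the smallest ratio. The key estimate
is that γh is at most the weight of every PNWST (`IsPNWST.ratio_mul_card_le`). Root its tree at a
current root ρ with P(ρ) ≥ P(s); then all vertices between ρ and a current root m have rate at least
P(m). Take a deepest vertex x with at least two current roots below it (x itself included). The
paths from these q roots up to x meet only in x, so they form a spider, that is, a valid choice with
center x, and γq is at most the weight of the subtree of x. Cut this subtree off and repeat. If a
single root remains after a cut, it is ρ, and the last spider is extended by the path from x to ρ
(`RootedTree.weight_ge`).

A step that leaves m = h - |S| roots costs γ(|S| + 1) ≤ (h - m + 1)/h · OPT ≤ 2(ln h - ln m) · OPT,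
and this telescopes from |T| + 1 roots down to one (`log_step`, `GreedyInv.step`). The potential is
the sum of w(v, R(v)) over all vertices. It grows by at most the cost of the choice, because path
ends at roots are free at the rates used (`Choice.totalWeight_upgrade_le`), and it dominates the
weight of any tree that carries the rates R.

Every terminal stays joined to a root of at least its priority, at its own rate, so in the end it is
joined to s (`GreedyOutput.feasible`). A tree of widest paths from s is then a PNWST for R
(`PartialTree.parentTree_isPNWST`).

Running time. The minimum ranges over a real b and exponentially many sets S, but few candidates
suffice (`Choice.Valid.exists_item`). Lowering b to the largest priority in S does not raise the
cost, and for fixed r, v, b some best S is an initial segment of the admissible roots ordered by the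
cost of their legs. A candidate is thus given by v, a priority, the last element of the segment, and
r. The sums over segments are shared by all r, so a search takes O(n³k) steps without any sorting,
and there are n searches. The tables of σ come from a cubic Dijkstra search for each of n sources
and k priorities. The total is O(n⁴k); the factor ln n in the bound is slack.

Real numbers cannot index arrays, so a priority is represented by the terminal of largest number
that has it. One search routine, parametrized by how an edge extends a length, yields both the
minimum weight paths and the widest paths. Programs are verified by Hoare style triples with a step
budget (`Run`); the arrays that a program does not write to are preserved automatically
(`Exec.frame`). -/

@[simp] theorem State.setNat_nat_of_ne (σ : State) {a a' : ℕ} (i j l x : ℕ) (h : a' ≠ a) :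
    (σ.setNat a i j l x).nat a' = σ.nat a' := by
  funext i' j' l'; simp [State.setNat, h]

@[simp] theorem State.setNat_nat_self (σ : State) (a i j l x i' j' l' : ℕ) :
    (σ.setNat a i j l x).nat a i' j' l' =
      if i' = i ∧ j' = j ∧ l' = l then x else σ.nat a i' j' l' := by
  simp [State.setNat]

@[simp] theorem State.setNat_real (σ : State) (a i j l x : ℕ) :
    (σ.setNat a i j l x).real = σ.real := rfl

@[simp] theorem State.setReal_real_of_ne (σ : State) {a a' : ℕ} (i j l : ℕ) (x : ℝ) (h : a' ≠ a) :
    (σ.setReal a i j l x).real a' = σ.real a' := by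
  funext i' j' l'; simp [State.setReal, h]

@[simp] theorem State.setReal_real_self (σ : State) (a i j l : ℕ) (x : ℝ) (i' j' l' : ℕ) :
    (σ.setReal a i j l x).real a i' j' l' =
      if i' = i ∧ j' = j ∧ l' = l then x else σ.real a i' j' l' := by
  simp [State.setReal]

@[simp] theorem State.setReal_nat (σ : State) (a i j l : ℕ) (x : ℝ) :
    (σ.setReal a i j l x).nat = σ.nat := rfl

/-! ### Programs with a time bound -/

/-- The arrays of natural numbers that a program may write to. -/
def Cmd.natWrites : Cmd → List ℕ
  | skip => []
  | setNat a _ _ _ _ => [a]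
  | setReal _ _ _ _ _ => []
  | seq c d => c.natWrites ++ d.natWrites
  | ite _ c d => c.natWrites ++ d.natWrites
  | loop _ c => c.natWrites

/-- The arrays of real numbers that a program may write to. -/
def Cmd.realWrites : Cmd → List ℕ
  | skip => []
  | setNat _ _ _ _ _ => []
  | setReal a _ _ _ _ => [a]
  | seq c d => c.realWrites ++ d.realWrites
  | ite _ c d => c.realWrites ++ d.realWrites
  | loop _ c => c.realWrites

/-- The memories `σ` and `τ` agree on all arrays that `c` does not write to. -/
structure Cmd.Frame (c : Cmd) (σ τ : State) : Prop where
  nat : ∀ a, a ∉ c.natWrites → τ.nat a = σ.nat a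
  real : ∀ a, a ∉ c.realWrites → τ.real a = σ.real a

theorem Cmd.Frame.trans {c : Cmd} {σ τ ρ : State} (h : c.Frame σ τ) (h' : c.Frame τ ρ) :
    c.Frame σ ρ :=
  ⟨fun a ha => (h'.nat a ha).trans (h.nat a ha), fun a ha => (h'.real a ha).trans (h.real a ha)⟩

theorem Cmd.Frame.mono {c d : Cmd} {σ τ : State} (h : c.Frame σ τ)
    (hn : c.natWrites ⊆ d.natWrites) (hr : c.realWrites ⊆ d.realWrites) : d.Frame σ τ :=
  ⟨fun a ha => h.nat a fun h => ha (hn h), fun a ha => h.real a fun h => ha (hr h)⟩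

/-- The arrays written are read off the syntax, so a specification needs to mention only what its
program changes. -/
theorem Exec.frame {c : Cmd} {σ τ : State} {t : ℕ} (h : Exec I c σ t τ) : c.Frame σ τ := by
  induction h with
  | skip => exact ⟨fun _ _ => rfl, fun _ _ => rfl⟩
  | setNat => exact ⟨fun a ha => by simp_all [Cmd.natWrites], fun _ _ => rfl⟩
  | setReal => exact ⟨fun _ _ => rfl, fun a ha => by simp_all [Cmd.realWrites]⟩
  | seq _ _ ih₁ ih₂ =>
    constructor <;> intro a ha <;> simp only [Cmd.natWrites, Cmd.realWrites, List.mem_append,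
      not_or] at ha
    · rw [ih₂.nat a ha.2, ih₁.nat a ha.1]
    · rw [ih₂.real a ha.2, ih₁.real a ha.1]
  | ite_true _ _ ih =>
    constructor <;> intro a ha <;> simp only [Cmd.natWrites, Cmd.realWrites, List.mem_append,
      not_or] at ha
    · exact ih.nat a ha.1
    · exact ih.real a ha.1
  | ite_false _ _ ih =>
    constructor <;> intro a ha <;> simp only [Cmd.natWrites, Cmd.realWrites, List.mem_append,
      not_or] at ha
    · exact ih.nat a ha.2
    · exact ih.real a ha.2
  | loop_true _ _ _ ih₁ ih₂ =>
    exact ⟨fun a ha => by rw [ih₂.nat a ha, ih₁.nat a ha],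
      fun a ha => by rw [ih₂.real a ha, ih₁.real a ha]⟩
  | loop_false => exact ⟨fun _ _ => rfl, fun _ _ => rfl⟩

variable (I) in
/-- Started with memory `σ`, the program `c` halts after at most `B` steps with a memory that
satisfies `Q`. -/
def Run (c : Cmd) (σ : State) (B : ℕ) (Q : State → Prop) : Prop :=
  ∃ t τ, Exec I c σ t τ ∧ t ≤ B ∧ Q τ

namespace Run

variable {c d : Cmd} {σ : State} {B B' : ℕ} {Q Q' : State → Prop}

theorem mono (h : Run I c σ B Q) (hB : B ≤ B') (hQ : ∀ τ, c.Frame σ τ → Q τ → Q' τ) :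
    Run I c σ B' Q' := by
  obtain ⟨t, τ, he, ht, hq⟩ := h
  exact ⟨t, τ, he, ht.trans hB, hQ τ he.frame hq⟩

theorem bound (h : Run I c σ B Q) (hB : B ≤ B') : Run I c σ B' Q := h.mono hB fun _ _ hq => hq

theorem seq (h : Run I c σ B fun τ => Run I d τ B' Q) : Run I (.seq c d) σ (B + B') Q := by
  obtain ⟨t, τ, he, ht, t', ρ, he', ht', hq⟩ := h
  exact ⟨t + t', ρ, .seq he he', Nat.add_le_add ht ht', hq⟩

theorem ite {b : BExp} (h : b.Holds I σ → Run I c σ B Q) (h' : ¬ b.Holds I σ → Run I d σ B Q) :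
    Run I (.ite b c d) σ (b.cost + B) Q := by
  by_cases hb : b.Holds I σ
  · obtain ⟨t, τ, he, ht, hq⟩ := h hb
    exact ⟨_, τ, .ite_true hb he, Nat.add_le_add_left ht _, hq⟩
  · obtain ⟨t, τ, he, ht, hq⟩ := h' hb
    exact ⟨_, τ, .ite_false hb he, Nat.add_le_add_left ht _, hq⟩

end Run

/-- Programs without loops. -/
def Cmd.LoopFree : Cmd → Prop
  | skip => True
  | setNat _ _ _ _ _ => True
  | setReal _ _ _ _ _ => True
  | seq c d => c.LoopFree ∧ d.LoopFree
  | ite _ c d => c.LoopFree ∧ d.LoopFree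
  | loop _ _ => False

/-- The largest number of steps of a program without loops. -/
def Cmd.cost : Cmd → ℕ
  | skip => 1
  | setNat _ i j l e => i.cost + j.cost + l.cost + e.cost + 1
  | setReal _ i j l e => i.cost + j.cost + l.cost + e.cost + 1
  | seq c d => c.cost + d.cost
  | ite b c d => b.cost + (c.cost + d.cost)
  | loop _ _ => 0

open Classical in
variable (I) in
/-- The final memory of a program without loops. -/
noncomputable def Cmd.result : Cmd → State → State
  | skip, σ => σ
  | setNat a i j l e, σ => σ.setNat a (i.val I σ) (j.val I σ) (l.val I σ) (e.val I σ)
  | setReal a i j l e, σ => σ.setReal a (i.val I σ) (j.val I σ) (l.val I σ) (e.val I σ)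
  | seq c d, σ => d.result (c.result σ)
  | ite b c d, σ => if b.Holds I σ then c.result σ else d.result σ
  | loop _ _, σ => σ

theorem Cmd.result_seq (c d : Cmd) (σ : State) :
    (Cmd.seq c d).result I σ = d.result I (c.result I σ) := rfl

theorem Cmd.result_ite_pos {b : BExp} {c d : Cmd} {σ : State} (h : b.Holds I σ) :
    (Cmd.ite b c d).result I σ = c.result I σ := if_pos h

theorem Cmd.result_ite_neg {b : BExp} {c d : Cmd} {σ : State} (h : ¬ b.Holds I σ) :
    (Cmd.ite b c d).result I σ = d.result I σ := if_neg h

/-- Code without loops is verified by symbolic evaluation: the goal becomes a statement about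
`Cmd.result`, which `simp` computes. -/
theorem Run.loopFree {c : Cmd} (hc : c.LoopFree) {σ : State} {Q : State → Prop}
    (h : Q (c.result I σ)) : Run I c σ c.cost Q := by
  induction c generalizing σ Q with
  | skip => exact ⟨_, _, .skip σ, le_rfl, h⟩
  | setNat => exact ⟨_, _, .setNat .., le_rfl, h⟩
  | setReal => exact ⟨_, _, .setReal .., le_rfl, h⟩
  | seq c d ihc ihd => exact Run.seq (ihc hc.1 (ihd hc.2 h))
  | ite b c d ihc ihd =>
    refine Run.ite (fun hb => (ihc hc.1 ?_).bound (Nat.le_add_right _ _))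
      fun hb => (ihd hc.2 ?_).bound (Nat.le_add_left _ _)
    · rwa [Cmd.result, if_pos hb] at h
    · rwa [Cmd.result, if_neg hb] at h
  | loop => exact hc.elim

/-! ### Scalars and counting loops -/

/-- The scalar stored in array `a`. -/
abbrev NExp.var (a : ℕ) : NExp := .get a (.lit 0) (.lit 0) (.lit 0)

/-- The real scalar stored in array `a`. -/
abbrev RExp.var (a : ℕ) : RExp := .get a (.lit 0) (.lit 0) (.lit 0)

/-- Assignment to a scalar. -/
abbrev Cmd.assign (a : ℕ) (e : NExp) : Cmd := .setNat a (.lit 0) (.lit 0) (.lit 0) e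

/-- Assignment to a real scalar. -/
abbrev Cmd.assignReal (a : ℕ) (e : RExp) : Cmd := .setReal a (.lit 0) (.lit 0) (.lit 0) e

/-- Repeats `c` with the scalar `a` running through all vertices. -/
def Cmd.forVerts (a : ℕ) (c : Cmd) : Cmd :=
  .seq (.assign a (.lit 0))
    (.loop (.not (.leNat .numVerts (.var a)))
      (.seq c (.assign a (.add (.var a) (.lit 1)))))

theorem _root_.PriorityNWST.n_pos (I : PriorityNWST) : 1 ≤ I.n := I.s.pos

/-- The budget counts, for each round, 7 steps for the test and 10 for the increment, and once 5 for
the initialization and 7 for the failing test. The invariant has to survive arbitrary writes to the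
counter (`hset`), since the counter also moves between two rounds. -/
theorem Run.forVerts {a : ℕ} {c : Cmd} {σ : State} (ha : a ∉ c.natWrites)
    (Inv : ℕ → State → Prop) (B : ℕ → ℕ)
    (h0 : Inv 0 σ)
    (hset : ∀ m τ x, Inv m τ → Inv m (τ.setNat a 0 0 0 x))
    (hstep : ∀ m, m < I.n → ∀ τ, (Cmd.forVerts a c).Frame σ τ → τ.nat a 0 0 0 = m → Inv m τ →
      Run I c τ (B m) (Inv (m + 1))) :
    Run I (.forVerts a c) σ ((∑ m ∈ Finset.range I.n, (B m + 17)) + 12) (Inv I.n) := by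
  have key : ∀ m, m ≤ I.n → ∀ τ, (Cmd.forVerts a c).Frame σ τ → τ.nat a 0 0 0 = m → Inv m τ →
      Run I (.loop (.not (.leNat .numVerts (.var a)))
        (.seq c (.assign a (.add (.var a) (.lit 1))))) τ
        ((∑ m ∈ Finset.Ico m I.n, (B m + 17)) + 7) (Inv I.n) := by
    intro m hm
    induction hm using Nat.decreasingInduction with
    | self =>
      intro τ _ hτ hI
      exact ⟨_, τ, .loop_false (by simp [BExp.Holds, NExp.val, hτ]),
        by simp [BExp.cost, NExp.cost], hI⟩
    | of_succ m hm ih =>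
      intro τ hf hτ hI
      obtain ⟨t, ρ, he, ht, hq⟩ := hstep m hm τ hf hτ hI
      have hρ : ρ.nat a 0 0 0 = m := by rw [he.frame.nat a ha, hτ]
      have hf' : (Cmd.forVerts a c).Frame σ (ρ.setNat a 0 0 0 (m + 1)) := by
        refine ⟨fun a' ha' => ?_, fun a' ha' => ?_⟩
        · have h1 : a' ≠ a ∧ a' ∉ c.natWrites := by
            simp only [Cmd.forVerts, Cmd.natWrites, List.mem_append, List.mem_singleton] at ha'
            tauto
          rw [State.setNat_nat_of_ne _ _ _ _ _ h1.1, he.frame.nat a' h1.2, hf.nat a' ha']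
        · have h1 : a' ∉ c.realWrites := by
            simpa [Cmd.forVerts, Cmd.realWrites] using ha'
          rw [State.setNat_real, he.frame.real a' h1, hf.real a' ha']
      obtain ⟨t', ρ', he', ht', hq'⟩ := ih (ρ.setNat a 0 0 0 (m + 1)) hf' (by simp)
        (hset _ _ _ hq)
      have hass : Exec I (.assign a (.add (.var a) (.lit 1))) ρ 10 (ρ.setNat a 0 0 0 (m + 1)) := by
        have := Exec.setNat (I := I) a (.lit 0) (.lit 0) (.lit 0) (.add (.var a) (.lit 1)) ρ
        simpa [NExp.val, NExp.cost, hρ] using this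
      refine ⟨_, ρ', .loop_true ?_ (.seq he hass) he', ?_, hq'⟩
      · simp [BExp.Holds, NExp.val, hτ, hm]
      · rw [Finset.sum_eq_sum_Ico_succ_bot hm]
        simp only [BExp.cost, NExp.cost]
        omega
  refine (Run.seq (c := .assign a (.lit 0)) (B := 5)
    (B' := (∑ m ∈ Finset.range I.n, (B m + 17)) + 7)
    ⟨5, σ.setNat a 0 0 0 0, ?_, le_rfl, ?_⟩).bound (by omega)
  · exact Exec.setNat (I := I) a (.lit 0) (.lit 0) (.lit 0) (.lit 0) σ
  · have hf : (Cmd.forVerts a c).Frame σ (σ.setNat a 0 0 0 0) := by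
      refine ⟨fun a' ha' => ?_, fun a' ha' => rfl⟩
      have h1 : a' ≠ a ∧ a' ∉ c.natWrites := by
        simp only [Cmd.forVerts, Cmd.natWrites, List.mem_append, List.mem_singleton] at ha'; tauto
      exact State.setNat_nat_of_ne _ _ _ _ _ h1.1
    rw [Finset.range_eq_Ico]
    exact key 0 (Nat.zero_le _) _ hf (by simp)
      (hset _ _ _ h0)

theorem Run.forVerts_const {a : ℕ} {c : Cmd} {σ : State} (ha : a ∉ c.natWrites)
    (Inv : ℕ → State → Prop) {B : ℕ} (hB : 1 ≤ B)
    (h0 : Inv 0 σ)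
    (hset : ∀ m τ x, Inv m τ → Inv m (τ.setNat a 0 0 0 x))
    (hstep : ∀ m, m < I.n → ∀ τ, (Cmd.forVerts a c).Frame σ τ → τ.nat a 0 0 0 = m → Inv m τ →
      Run I c τ B (Inv (m + 1))) :
    Run I (.forVerts a c) σ (30 * (I.n * B)) (Inv I.n) := by
  refine (Run.forVerts ha Inv (fun _ => B) h0 hset hstep).bound ?_
  have := I.n_pos
  simp only [Finset.sum_const, Finset.card_range, smul_eq_mul]
  nlinarith

/-- A counting loop that accumulates a set of processed items. -/
theorem Run.forVerts_union {α : Type*} {a : ℕ} {c : Cmd} {σ : State} (ha : a ∉ c.natWrites)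
    (Inv : Set α → State → Prop) (E : ℕ → Set α) (B : ℕ → ℕ) (X : Set α)
    (h0 : Inv X σ)
    (hset : ∀ Y τ x, Inv Y τ → Inv Y (τ.setNat a 0 0 0 x))
    (hstep : ∀ m, m < I.n → ∀ Y τ, (Cmd.forVerts a c).Frame σ τ → τ.nat a 0 0 0 = m → Inv Y τ →
      Run I c τ (B m) (Inv (Y ∪ E m))) :
    Run I (.forVerts a c) σ ((∑ m ∈ Finset.range I.n, (B m + 17)) + 12)
      (Inv (X ∪ ⋃ m < I.n, E m)) := by
  have := Run.forVerts (I := I) (σ := σ) ha (fun m => Inv (X ∪ ⋃ i < m, E i)) B ?_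
    (fun m τ x h => hset _ _ _ h) ?_
  · exact this
  · simpa using h0
  · intro m hm τ hf hτ hI
    refine (hstep m hm _ τ hf hτ hI).mono le_rfl fun τ' _ h => ?_
    convert h using 1
    rw [Set.union_assoc, Set.biUnion_lt_succ]

theorem Run.forVerts_union_const {α : Type*} {a : ℕ} {c : Cmd} {σ : State}
    (ha : a ∉ c.natWrites) (Inv : Set α → State → Prop) (E : ℕ → Set α) {B : ℕ} (hB : 1 ≤ B)
    (X : Set α) (h0 : Inv X σ)
    (hset : ∀ Y τ x, Inv Y τ → Inv Y (τ.setNat a 0 0 0 x))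
    (hstep : ∀ m, m < I.n → ∀ Y τ, (Cmd.forVerts a c).Frame σ τ → τ.nat a 0 0 0 = m → Inv Y τ →
      Run I c τ B (Inv (Y ∪ E m))) :
    Run I (.forVerts a c) σ (30 * (I.n * B)) (Inv (X ∪ ⋃ m < I.n, E m)) := by
  refine (Run.forVerts_union ha Inv E (fun _ => B) X h0 hset hstep).bound ?_
  have := I.n_pos
  simp only [Finset.sum_const, Finset.card_range, smul_eq_mul]
  nlinarith

end RealRAM

/-! ### Decomposition of a tree into spiders -/

namespace PriorityNWST

variable {I : PriorityNWST}

/-- Shortening a walk to a path only drops vertices, so walks are good enough for upper bounds on σ.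
-/
theorem sigma_le_of_walk {b : ℝ≥0} {u v : Fin I.n} (p : I.G.Walk u v) (Z : Finset (Fin I.n))
    (g : Fin I.n → ℝ≥0) (h : ∀ z ∈ p.support, z ≠ u → z ≠ v → z ∈ Z ∧ I.w z b ≤ g z) :
    I.sigma b u v ≤ ∑ z ∈ Z, g z := by
  have key : ∀ z ∈ p.toPath.1.support.toFinset \ {u, v}, z ∈ Z ∧ I.w z b ≤ g z := by
    intro z hz
    simp only [Finset.mem_sdiff, List.mem_toFinset, Finset.mem_insert, Finset.mem_singleton,
      not_or] at hz
    exact h z (p.support_toPath_subset_support hz.1) hz.2.1 hz.2.2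
  calc I.sigma b u v ≤ I.pathWeight b p.toPath := ciInf_le (OrderBot.bddBelow _) _
    _ ≤ ∑ x ∈ p.toPath.1.support.toFinset \ {u, v}, g x :=
      Finset.sum_le_sum fun z hz => (key z hz).2
    _ ≤ ∑ z ∈ Z, g z := Finset.sum_le_sum_of_subset fun z hz => (key z hz).1

theorem pathWeight_reverse (b : ℝ≥0) {u v : Fin I.n} (p : I.G.Path u v) :
    I.pathWeight b p.reverse = I.pathWeight b p := by
  simp [pathWeight, Finset.pair_comm]

theorem sigma_comm (b : ℝ≥0) (u v : Fin I.n) : I.sigma b u v = I.sigma b v u := by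
  have : ∀ u v : Fin I.n, I.sigma b u v ≤ I.sigma b v u := by
    intro u v
    obtain ⟨p⟩ := I.connected.preconnected v u
    have : Nonempty (I.G.Path v u) := ⟨p.toPath⟩
    refine le_ciInf fun q => ?_
    rw [← pathWeight_reverse]
    exact ciInf_le (OrderBot.bddBelow _) _
  exact le_antisymm (this u v) (this v u)

/-- The cost of a choice, that is, the numerator of its ratio. -/
noncomputable def Choice.cost (c : I.Choice) : ℝ≥0 :=
  I.sigma c.b c.r c.v + I.w c.v c.b + ∑ r' ∈ c.S, I.sigma (I.P r') c.v r'

theorem Choice.ratio_mul (c : I.Choice) : c.ratio * (c.S.card + 1) = c.cost :=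
  div_mul_cancel₀ _ (by positivity)

/-- The vertices of a rooted tree with root `ρ`, given by the sets `Anc z` of the ancestors of `z`,
where `z` itself is counted as one of its ancestors. -/
structure RootedTree (I : PriorityNWST) (U : Finset (Fin I.n)) (ρ : Fin I.n)
    (Anc : Fin I.n → Finset (Fin I.n)) (depth : Fin I.n → ℕ) : Prop where
  self : ∀ z ∈ U, z ∈ Anc z
  root : ∀ z ∈ U, ρ ∈ Anc z
  subset : ∀ z ∈ U, Anc z ⊆ U
  trans : ∀ z ∈ U, ∀ x ∈ Anc z, Anc x ⊆ Anc z
  depth_lt : ∀ z ∈ U, ∀ x ∈ Anc z, x ≠ z → depth x < depth z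
  walk : ∀ z ∈ U, ∀ x ∈ Anc z, ∃ p : I.G.Walk z x, ∀ y ∈ p.support, y ∈ Anc z ∧ x ∈ Anc y

namespace RootedTree

variable {U : Finset (Fin I.n)} {ρ : Fin I.n} {Anc : Fin I.n → Finset (Fin I.n)}
  {depth : Fin I.n → ℕ} {M : Finset (Fin I.n)} {R : Fin I.n → ℝ≥0}

/-- This bounds the leg of a spider from the foot m up to the center x. The sum also counts m
itself, which σ omits. -/
theorem sigma_le (hU : I.RootedTree U ρ Anc depth) {m x : Fin I.n} (hm : m ∈ U)
    (hx : x ∈ Anc m) {b : ℝ≥0} (hb : ∀ z ∈ Anc m, b ≤ R z) :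
    I.sigma b m x ≤ ∑ z ∈ Anc m with x ∈ Anc z ∧ z ≠ x, I.w z (R z) := by
  obtain ⟨p, hp⟩ := hU.walk m hm x hx
  refine sigma_le_of_walk p _ _ fun z hz _ hzx => ⟨?_, I.weight_mono z (hb z (hp z hz).1)⟩
  simpa using ⟨(hp z hz).1, (hp z hz).2, hzx⟩

variable {γ : ℝ≥0}

/-- The foot of largest priority serves as the root of the choice and b is the largest priority
among the other feet. Then all rates needed on the legs and at the center are available in the tree.
-/
theorem spider (hU : I.RootedTree U ρ Anc depth) (hMU : M ⊆ U)
    (hR : ∀ m ∈ M, ∀ z ∈ Anc m, I.P m ≤ R z)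
    (hγ : ∀ c : I.Choice, c.Valid M → γ * (c.S.card + 1) ≤ c.cost) {Q : Finset (Fin I.n)}
    (hQ : Q ⊆ M) (hQ2 : 2 ≤ Q.card) {x : Fin I.n} (hx : ∀ m ∈ Q, x ∈ Anc m) :
    γ * Q.card ≤ I.w x (R x) +
      ∑ m ∈ Q, ∑ z ∈ Anc m with x ∈ Anc z ∧ z ≠ x, I.w z (R z) := by
  obtain ⟨r, hr, hmax⟩ := Q.exists_max_image I.P (Finset.card_pos.1 (by omega))
  have hcard : (Q.erase r).card + 1 = Q.card := Finset.card_erase_add_one hr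
  have hpos : 0 < (Q.erase r).card := by omega
  have hb : (Q.erase r).sup I.P ≤ I.P r :=
    Finset.sup_le fun m hm => hmax m (Finset.mem_of_mem_erase hm)
  have h := hγ ⟨r, x, (Q.erase r).sup I.P, Q.erase r⟩
    ⟨hQ hr, (Finset.erase_subset _ _).trans hQ, Finset.card_pos.1 hpos,
      Finset.notMem_erase _ _, hb, fun m hm => Finset.le_sup hm⟩
  have hc : γ * Q.card = γ * ((Q.erase r).card + 1) := by rw [← hcard]; push_cast; rfl
  rw [hc]
  refine h.trans ?_
  simp only [Choice.cost]
  rw [← Finset.add_sum_erase _ _ hr, ← add_assoc, add_comm (I.w x _)]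
  gcongr with m hm
  · exact hU.sigma_le (hMU (hQ hr)) (hx r hr) fun z hz => hb.trans (hR r (hQ hr) z hz)
  · refine I.weight_mono x (Finset.sup_le fun m hm => ?_)
    have hm := Finset.mem_of_mem_erase hm
    exact hR m (hQ hm) x (hx m hm)
  · have hm := Finset.mem_of_mem_erase hm
    rw [sigma_comm]
    exact hU.sigma_le (hMU (hQ hm)) (hx m hm) (hR m (hQ hm))

/-- This is the spider that also contains ρ: the path between ρ and x serves as the path to the
center, and ρ may be the root of the choice because its priority is largest. It handles the case
that cutting off the subtree of x would leave ρ alone. -/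
theorem spider_root (hU : I.RootedTree U ρ Anc depth) (hMU : M ⊆ U) (hρ : ρ ∈ M)
    (hmax : ∀ m ∈ M, I.P m ≤ I.P ρ) (hR : ∀ m ∈ M, ∀ z ∈ Anc m, I.P m ≤ R z)
    (hγ : ∀ c : I.Choice, c.Valid M → γ * (c.S.card + 1) ≤ c.cost) {Q : Finset (Fin I.n)}
    (hQ : Q ⊆ M) (hQ1 : Q.Nonempty) (hρQ : ρ ∉ Q) {x : Fin I.n} (hx : ∀ m ∈ Q, x ∈ Anc m) :
    γ * (Q.card + 1) ≤ (∑ z ∈ Anc x with z ≠ x, I.w z (R z)) + I.w x (R x) +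
      ∑ m ∈ Q, ∑ z ∈ Anc m with x ∈ Anc z ∧ z ≠ x, I.w z (R z) := by
  refine (hγ ⟨ρ, x, Q.sup I.P, Q⟩ ⟨hρ, hQ, hQ1, hρQ, Finset.sup_le fun m hm => hmax m (hQ hm),
    fun m hm => Finset.le_sup hm⟩).trans ?_
  simp only [Choice.cost]
  obtain ⟨m₀, hm₀⟩ := hQ1
  have hxU : x ∈ U := hU.subset m₀ (hMU (hQ hm₀)) (hx m₀ hm₀)
  have hb : ∀ z ∈ Anc x, Q.sup I.P ≤ R z := fun z hz => Finset.sup_le fun m hm =>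
    hR m (hQ hm) z (hU.trans m (hMU (hQ hm)) x (hx m hm) hz)
  gcongr with m hm
  · rw [sigma_comm]
    obtain ⟨p, hp⟩ := hU.walk x hxU ρ (hU.root x hxU)
    refine sigma_le_of_walk p _ _ fun z hz hzx _ =>
      ⟨by simpa using ⟨(hp z hz).1, hzx⟩, I.weight_mono z (hb z (hp z hz).1)⟩
  · exact I.weight_mono x (hb x (hU.self x hxU))
  · rw [sigma_comm]
    exact hU.sigma_le (hMU (hQ hm)) (hx m hm) (hR m (hQ hm))

/-- Induction on the size of an ancestor-closed set W: the spider at a deepest branching vertex x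
pays for the roots below x, and W without the descendants of x is again ancestor-closed. -/
theorem weight_ge (hU : I.RootedTree U ρ Anc depth) (hMU : M ⊆ U) (hρ : ρ ∈ M)
    (hmax : ∀ m ∈ M, I.P m ≤ I.P ρ) (hR : ∀ m ∈ M, ∀ z ∈ Anc m, I.P m ≤ R z)
    (hγ : ∀ c : I.Choice, c.Valid M → γ * (c.S.card + 1) ≤ c.cost) :
    ∀ (N : ℕ) (W : Finset (Fin I.n)), W.card ≤ N → W ⊆ U → (∀ z ∈ W, Anc z ⊆ W) →
      2 ≤ (M ∩ W).card → γ * (M ∩ W).card ≤ ∑ z ∈ W, I.w z (R z) := by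
  intro N
  induction N with
  | zero =>
    intro W hW _ _ h2
    have := Finset.card_le_card (Finset.inter_subset_right (s₁ := M) (s₂ := W))
    omega
  | succ N ih =>
    intro W hW hWU hcl h2
    have hρW : ρ ∈ W := by
      obtain ⟨m, hm⟩ := Finset.card_pos.1 (by omega : 0 < (M ∩ W).card)
      have hm := (Finset.mem_inter.1 hm).2
      exact hcl m hm (hU.root m (hWU hm))
    obtain ⟨x, hx, hdeep⟩ := Finset.exists_max_image
      (W.filter fun x => 2 ≤ ((M ∩ W).filter fun m => x ∈ Anc m).card) depth
      ⟨ρ, by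
        rw [Finset.mem_filter, Finset.filter_true_of_mem]
        · exact ⟨hρW, h2⟩
        · exact fun m hm => hU.root m (hMU (Finset.mem_inter.1 hm).1)⟩
    rw [Finset.mem_filter] at hx
    obtain ⟨hxW, hQ2⟩ := hx
    set Q := (M ∩ W).filter fun m => x ∈ Anc m with hQdef
    have hQM : Q ⊆ M := fun m hm => (Finset.mem_inter.1 (Finset.mem_filter.1 hm).1).1
    have hQW : ∀ m ∈ Q, m ∈ W := fun m hm => (Finset.mem_inter.1 (Finset.mem_filter.1 hm).1).2
    have hQx : ∀ m ∈ Q, x ∈ Anc m := fun m hm => (Finset.mem_filter.1 hm).2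
    set Dx := W.filter fun z => x ∈ Anc z with hDdef
    set W' := W.filter fun z => ¬ x ∈ Anc z with hW'def
    have hsplit : ∑ z ∈ W, I.w z (R z) = ∑ z ∈ Dx, I.w z (R z) + ∑ z ∈ W', I.w z (R z) :=
      (Finset.sum_filter_add_sum_filter_not _ _ _).symm
    have hlegs : I.w x (R x) + ∑ m ∈ Q, ∑ z ∈ Anc m with x ∈ Anc z ∧ z ≠ x, I.w z (R z) ≤
        ∑ z ∈ Dx, I.w z (R z) := by
      have hxD : x ∈ Dx := Finset.mem_filter.2 ⟨hxW, hU.self x (hWU hxW)⟩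
      rw [← Finset.add_sum_erase _ _ hxD, ← Finset.sum_biUnion]
      · gcongr
        intro z hz
        simp only [Finset.mem_biUnion, Finset.mem_filter] at hz
        obtain ⟨m, hm, hz, hxz, hne⟩ := hz
        exact Finset.mem_erase.2 ⟨hne, Finset.mem_filter.2 ⟨hcl m (hQW m hm) hz, hxz⟩⟩
      -- A vertex z ≠ x on two legs would have two roots below it and lie deeper than x.
      · intro m hm m' hm' hne
        refine Finset.disjoint_left.2 fun z hz hz' => ?_
        rw [Finset.mem_filter] at hz hz'
        have hzW : z ∈ W := hcl m (hQW m hm) hz.1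
        have h1 : depth x < depth z := hU.depth_lt z (hWU hzW) x hz.2.1 hz.2.2.symm
        have h2 := hdeep z (Finset.mem_filter.2 ⟨hzW, ?_⟩)
        · omega
        · have : ({m, m'} : Finset _) ⊆ (M ∩ W).filter fun m => z ∈ Anc m := by
            intro y hy
            rcases Finset.mem_insert.1 hy with rfl | hy
            · exact Finset.mem_filter.2 ⟨(Finset.mem_filter.1 hm).1, hz.1⟩
            · rw [Finset.mem_singleton] at hy
              subst hy
              exact Finset.mem_filter.2 ⟨(Finset.mem_filter.1 hm').1, hz'.1⟩
          calc 2 = ({m, m'} : Finset _).card := (Finset.card_pair hne).symm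
            _ ≤ _ := Finset.card_le_card this
    have hcard : (M ∩ W).card = Q.card + (M ∩ W').card := by
      rw [hQdef, ← Finset.card_filter_add_card_filter_not (s := M ∩ W) (fun m => x ∈ Anc m)]
      congr 2
      ext z
      simp only [Finset.mem_filter, Finset.mem_inter, hW'def]
      tauto
    have hcl' : ∀ z ∈ W', Anc z ⊆ W' := by
      intro z hz y hy
      rw [hW'def, Finset.mem_filter] at hz ⊢
      exact ⟨hcl z hz.1 hy, fun hxy => hz.2 (hU.trans z (hWU hz.1) y hy hxy)⟩
    have hW'W : W' ⊆ W := Finset.filter_subset _ _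
    have hsp := hU.spider hMU hR hγ hQM hQ2 hQx
    rcases Nat.lt_or_ge (M ∩ W').card 2 with hlt | hge
    · rcases Nat.eq_zero_or_pos (M ∩ W').card with h0 | hpos
      · rw [hcard, h0, add_zero, hsplit]
        exact (hsp.trans hlegs).trans le_self_add
      -- Exactly one root is left, and it is ρ, since the rest is ancestor-closed. The induction
      -- hypothesis needs two roots, so ρ joins the current spider; the extra vertices are proper
      -- ancestors of x and hence lie outside the subtree of x.
      · obtain ⟨m, hm⟩ := Finset.card_pos.1 hpos
        rw [Finset.mem_inter] at hm
        have hρW' : ρ ∈ W' := hcl' m hm.2 (hU.root m (hMU hm.1))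
        have hρx : x ∉ Anc ρ := (Finset.mem_filter.1 hρW').2
        have h1 : (M ∩ W').card = 1 := by omega
        have := hU.spider_root hMU hρ hmax hR hγ hQM (Finset.card_pos.1 (by omega))
          (fun h => hρx (hQx ρ h)) hQx
        rw [hcard, h1, hsplit, Nat.cast_add, Nat.cast_one]
        refine this.trans ?_
        rw [add_assoc, add_comm]
        gcongr
        intro z hz
        rw [Finset.mem_filter] at hz
        refine Finset.mem_filter.2 ⟨hcl x hxW hz.1, fun hxz => ?_⟩
        have h3 := hU.depth_lt x (hWU hxW) z hz.1 hz.2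
        have h4 := hU.depth_lt z (hWU (hcl x hxW hz.1)) x hxz hz.2.symm
        omega
    · have hlt : W'.card < W.card := Finset.card_lt_card
        (Finset.filter_ssubset.2 ⟨x, hxW, not_not.2 (hU.self x (hWU hxW))⟩)
      have := ih W' (by omega) (hW'W.trans hWU) hcl' hge
      rw [hcard, hsplit, Nat.cast_add, mul_add]
      exact add_le_add (hsp.trans hlegs) this

end RootedTree

end PriorityNWST

/-! ### From a tree subgraph to a lower bound on the optimum -/

namespace PriorityNWST

variable {I : PriorityNWST}

theorem exists_coe_walk {H : I.G.Subgraph} {u v : Fin I.n} (p : I.G.Walk u v)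
    (hp : p.toSubgraph ≤ H) (hu : u ∈ H.verts) (hv : v ∈ H.verts) :
    ∃ q : H.coe.Walk ⟨u, hu⟩ ⟨v, hv⟩, ∀ y ∈ q.support, (y : Fin I.n) ∈ p.support := by
  induction p with
  | nil => exact ⟨.nil, by simp⟩
  | @cons u w v h p ih =>
    rw [SimpleGraph.Walk.toSubgraph, sup_le_iff] at hp
    have hadj : H.Adj u w := hp.1.2 (by simp)
    obtain ⟨q, hq⟩ := ih hp.2 hadj.snd_mem hv
    refine ⟨.cons (v := ⟨w, hadj.snd_mem⟩) (by simpa using hadj) q, fun y hy => ?_⟩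
    rw [SimpleGraph.Walk.support_cons, List.mem_cons] at hy ⊢
    rcases hy with rfl | hy
    · exact Or.inl rfl
    · exact Or.inr (hq y hy)

open Classical in
-- The ancestors of z are the vertices of the unique path from ρ to z, and the depth is its length.
-- All axioms follow from uniqueness, as initial parts of such paths are such paths. The last clause
-- holds because any walk in H shortens to that path.
theorem exists_rootedTree {H : I.G.Subgraph} (hH : H.coe.IsTree) {ρ : Fin I.n}
    (hρ : ρ ∈ H.verts) :
    ∃ Anc depth, I.RootedTree (Finset.univ.filter (· ∈ H.verts)) ρ Anc depth ∧
      ∀ z ∈ H.verts, ∀ p : I.G.Walk ρ z, p.toSubgraph ≤ H → ∀ y ∈ Anc z, y ∈ p.support := by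
  have huniq : ∀ {u v : H.verts} {p q : H.coe.Walk u v}, p.IsPath → q.IsPath → p = q := by
    intro u v p q hp hq
    exact congrArg Subtype.val ((hH.isAcyclic.subsingleton_path u v).elim ⟨p, hp⟩ ⟨q, hq⟩)
  have hex : ∀ z : Fin I.n, ∃ (A : Finset (Fin I.n)) (d : ℕ), ∀ h : z ∈ H.verts,
      ∃ p : H.coe.Walk ⟨ρ, hρ⟩ ⟨z, h⟩, p.IsPath ∧ p.length = d ∧
        ∀ y, y ∈ A ↔ ∃ hy : y ∈ H.verts, ⟨y, hy⟩ ∈ p.support := by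
    intro z
    by_cases h : z ∈ H.verts
    · obtain ⟨p⟩ := hH.connected.preconnected ⟨ρ, hρ⟩ ⟨z, h⟩
      exact ⟨Finset.univ.filter fun y => ∃ hy : y ∈ H.verts, ⟨y, hy⟩ ∈ p.bypass.support,
        p.bypass.length, fun _ => ⟨p.bypass, p.bypass_isPath, rfl, by simp⟩⟩
    · exact ⟨∅, 0, fun h' => absurd h' h⟩
  choose Anc depth hA using hex
  refine ⟨Anc, depth, ⟨?_, ?_, ?_, ?_, ?_, ?_⟩, ?_⟩
  all_goals try simp only [Finset.mem_filter, Finset.mem_univ, true_and]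
  · intro z hz
    obtain ⟨p, _, _, h⟩ := hA z hz
    exact (h z).2 ⟨hz, p.end_mem_support⟩
  · intro z hz
    obtain ⟨p, _, _, h⟩ := hA z hz
    exact (h ρ).2 ⟨hρ, p.start_mem_support⟩
  · intro z hz y hy
    obtain ⟨p, _, _, h⟩ := hA z hz
    simpa using ((h y).1 hy).1
  · intro z hz x hx y hy
    obtain ⟨p, hp, _, h⟩ := hA z hz
    obtain ⟨hxH, hxp⟩ := (h x).1 hx
    obtain ⟨q, hq, _, h'⟩ := hA x hxH
    obtain ⟨hyH, hyq⟩ := (h' y).1 hy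
    rw [huniq hq (hp.takeUntil hxp)] at hyq
    exact (h y).2 ⟨hyH, p.support_takeUntil_subset_support hxp hyq⟩
  · intro z hz x hx hne
    obtain ⟨p, hp, hd, h⟩ := hA z hz
    obtain ⟨hxH, hxp⟩ := (h x).1 hx
    obtain ⟨q, hq, hd', h'⟩ := hA x hxH
    rw [← hd, ← hd', huniq hq (hp.takeUntil hxp)]
    exact p.length_takeUntil_lt_length hxp (by simpa using hne)
  · intro z hz x hx
    obtain ⟨p, hp, _, h⟩ := hA z hz
    obtain ⟨hxH, hxp⟩ := (h x).1 hx
    refine ⟨((p.dropUntil _ hxp).map H.hom).reverse, fun y hy => ?_⟩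
    replace hy : y ∈ ((p.dropUntil _ hxp).map H.hom).reverse.support := hy
    rw [SimpleGraph.Walk.support_reverse, List.mem_reverse, SimpleGraph.Walk.support_map,
      List.mem_map] at hy
    obtain ⟨⟨y', hyH⟩, hyp, hyy⟩ := hy
    obtain rfl : y' = y := hyy
    refine ⟨(h y').2 ⟨hyH, p.support_dropUntil_subset_support hxp hyp⟩, ?_⟩
    obtain ⟨q, hq, _, h'⟩ := hA y' hyH
    have hpath : ((p.takeUntil _ hxp).append ((p.dropUntil _ hxp).takeUntil _ hyp)).IsPath := by
      have h1 := hp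
      rw [← p.take_spec hxp, ← (p.dropUntil _ hxp).take_spec hyp,
        SimpleGraph.Walk.append_assoc] at h1
      exact h1.of_append_left
    refine (h' x).2 ⟨hxH, ?_⟩
    rw [huniq hq hpath, SimpleGraph.Walk.mem_support_append_iff]
    exact Or.inl (SimpleGraph.Walk.end_mem_support _)
  · intro z hz w hw y hy
    obtain ⟨p, hp, _, h⟩ := hA z hz
    obtain ⟨hyH, hyp⟩ := (h y).1 hy
    obtain ⟨q, hq⟩ := exists_coe_walk w hw hρ hz
    rw [huniq hp q.bypass_isPath] at hyp
    exact hq _ (q.support_bypass_subset_support hyp)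

theorem prio_le_source (I : PriorityNWST) {t : Fin I.n} (ht : t ∈ insert I.s I.T) :
    I.P t ≤ I.P I.s := by
  rcases Finset.mem_insert.1 ht with rfl | ht
  · exact le_rfl
  · rw [I.prio_source]
    exact Finset.le_sup ht

theorem IsPNWST.exists_walk {H : I.G.Subgraph} {R : Fin I.n → ℝ≥0} (h : I.IsPNWST H R)
    {m : Fin I.n} (hm : m ∈ insert I.s I.T) :
    ∃ p : I.G.Walk I.s m, p.toSubgraph ≤ H ∧ ∀ u ∈ p.support, I.P m ≤ R u := by
  rcases Finset.mem_insert.1 hm with rfl | hm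
  · refine ⟨.nil, ?_, ?_⟩
    · simpa using h.2.1
    · intro u hu
      rw [SimpleGraph.Walk.support_nil, List.mem_singleton] at hu
      rw [hu, I.prio_source]
      refine Finset.sup_le fun t ht => ?_
      obtain ⟨p, _, _, hp⟩ := h.2.2 t ht
      exact hp _ p.start_mem_support
  · obtain ⟨p, _, hp⟩ := h.2.2 m hm
    exact ⟨p, hp⟩

theorem IsPNWST.mem_verts {H : I.G.Subgraph} {R : Fin I.n → ℝ≥0} (h : I.IsPNWST H R)
    {m : Fin I.n} (hm : m ∈ insert I.s I.T) : m ∈ H.verts := by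
  obtain ⟨p, hp, _⟩ := h.exists_walk hm
  exact hp.1 (p.mem_verts_toSubgraph.2 p.end_mem_support)

/-- The smallest ratio of a choice is at most the optimum divided by the number of roots. -/
theorem IsPNWST.ratio_mul_card_le {H : I.G.Subgraph} {R : Fin I.n → ℝ≥0} (h : I.IsPNWST H R)
    {M : Finset (Fin I.n)} (hM : M ⊆ insert I.s I.T) (hM2 : 2 ≤ M.card) {ρ : Fin I.n}
    (hρ : ρ ∈ M) (hρs : I.P I.s ≤ I.P ρ) {γ : ℝ≥0}
    (hγ : ∀ c : I.Choice, c.Valid M → γ ≤ c.ratio) : γ * M.card ≤ I.weight H R := by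
  classical
  obtain ⟨Anc, depth, hU, hanc⟩ := exists_rootedTree h.1 (h.mem_verts (hM hρ))
  have hMU : M ⊆ Finset.univ.filter (· ∈ H.verts) := fun m hm => by
    simpa using h.mem_verts (hM hm)
  have hmax : ∀ m ∈ M, I.P m ≤ I.P ρ := fun m hm => (I.prio_le_source (hM hm)).trans hρs
  -- The path between ρ and m is covered by the paths from s to ρ and to m. On the former the rate
  -- is at least P(ρ), which is at least P(m).
  have hR : ∀ m ∈ M, ∀ z ∈ Anc m, I.P m ≤ R z := by
    intro m hm z hz
    obtain ⟨p, hp, hpR⟩ := h.exists_walk (hM hρ)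
    obtain ⟨q, hq, hqR⟩ := h.exists_walk (hM hm)
    have := hanc m (h.mem_verts (hM hm)) (p.reverse.append q)
      (by simpa [SimpleGraph.Walk.toSubgraph_append] using ⟨hp, hq⟩) z hz
    rw [SimpleGraph.Walk.mem_support_append_iff, SimpleGraph.Walk.support_reverse,
      List.mem_reverse] at this
    rcases this with hz | hz
    · exact (hmax m hm).trans (hpR z hz)
    · exact hqR z hz
  have := hU.weight_ge hMU hρ hmax hR (γ := γ)
    (fun c hc => by rw [← c.ratio_mul]; gcongr; exact hγ c hc) _ _ le_rfl subset_rfl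
    (fun z hz => hU.subset z hz) (by rwa [Finset.inter_eq_left.2 hMU])
  rw [Finset.inter_eq_left.2 hMU] at this
  refine this.trans (le_of_eq ?_)
  unfold weight
  congr

/-! ### The invariant of the greedy algorithm -/

/-- The sum of the weights of all vertices. -/
noncomputable def totalWeight (R : Fin I.n → ℝ≥0) : ℝ≥0 := ∑ u, I.w u (R u)

theorem weight_le_totalWeight (H : I.G.Subgraph) (R : Fin I.n → ℝ≥0) :
    I.weight H R ≤ totalWeight R := by
  classical
  unfold weight totalWeight
  exact Finset.sum_le_sum_of_subset (Finset.filter_subset _ _)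

theorem w_max (u : Fin I.n) (a b : ℝ≥0) : I.w u (max a b) = max (I.w u a) (I.w u b) :=
  (I.weight_mono u).map_max

/-- The end a is free because x does not exceed its priority. The end b, the center in the
application, is split off so that it can be charged once for all paths through it. -/
theorem w_ite_le {u a b : Fin I.n} {x : ℝ≥0} (p : I.G.Path a b) (ha : x ≤ I.P a) :
    I.w u (if u ∈ p.1.support then x else 0) ≤
      (if u ∈ p.1.support.toFinset \ {a, b} then I.w u x else 0) +
        if u = b then I.w u x else 0 := by
  by_cases hu : u ∈ p.1.support
  · by_cases hub : u = b
    · simp [hub]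
    · by_cases hua : u = a
      · rw [if_pos hu, hua, I.weight_zero a x ha]; exact zero_le
      · simp [hu, hua, hub]
  · rw [if_neg hu, I.weight_zero u 0 zero_le]; exact zero_le

/-- The weight at a maximum of rates is the maximum of the weights, hence at most their sum. The
center is charged only once, at rate b, because the legs raise it to at most b. -/
theorem Choice.totalWeight_upgrade_le (c : I.Choice) {M : Finset (Fin I.n)} (hc : c.Valid M)
    (p : I.G.Path c.r c.v) (q : ∀ r', I.G.Path c.v r') (R : Fin I.n → ℝ≥0)
    (hp : I.pathWeight c.b p = I.sigma c.b c.r c.v)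
    (hq : ∀ r' ∈ c.S, I.pathWeight (I.P r') (q r') = I.sigma (I.P r') c.v r') :
    totalWeight (c.upgrade p q R) ≤ totalWeight R + c.cost := by
  have hpt : ∀ u, I.w u (c.upgrade p q R u) ≤ I.w u (R u) +
      (((if u ∈ p.1.support.toFinset \ {c.r, c.v} then I.w u c.b else 0) +
        if u = c.v then I.w u c.b else 0) +
      ∑ r' ∈ c.S, if u ∈ (q r').1.support.toFinset \ {c.v, r'} then I.w u (I.P r') else 0) := by
    intro u
    have hsup : I.w u (c.S.sup fun r' => if u ∈ (q r').1.support then I.P r' else 0) ≤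
        (if u = c.v then I.w u c.b else 0) +
        ∑ r' ∈ c.S, if u ∈ (q r').1.support.toFinset \ {c.v, r'} then I.w u (I.P r') else 0 := by
      rw [Finset.apply_sup_eq_sup_comp (I.w u) (w_max u) (I.weight_zero u _ zero_le)]
      refine Finset.sup_le fun r' hr' => ?_
      -- The leg is reversed so that its free end r' takes the place of a.
      have h1 := w_ite_le (u := u) (q r').reverse (x := I.P r') le_rfl
      simp only [SimpleGraph.Path.reverse_coe, SimpleGraph.Walk.support_reverse, List.mem_reverse,
        List.toFinset_reverse, Finset.pair_comm r' c.v] at h1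
      refine h1.trans ?_
      rw [add_comm]
      refine add_le_add ?_ (Finset.single_le_sum (f := fun r' => if u ∈ (q r').1.support.toFinset \
        {c.v, r'} then I.w u (I.P r') else 0) (fun _ _ => zero_le) hr')
      split_ifs
      · exact I.weight_mono u (hc.2.2.2.2.2 r' hr')
      · exact le_rfl
    unfold Choice.upgrade
    rw [w_max, w_max]
    have h1 := w_ite_le (u := u) p (x := c.b) hc.2.2.2.2.1
    refine max_le (max_le le_self_add ?_) ?_
    · exact (h1.trans le_self_add).trans le_add_self
    · refine hsup.trans (le_trans ?_ le_add_self)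
      rw [add_assoc]
      exact le_add_self
  refine (Finset.sum_le_sum fun u _ => hpt u).trans (le_of_eq ?_)
  rw [Finset.sum_add_distrib, Finset.sum_add_distrib, Finset.sum_add_distrib, Finset.sum_comm]
  simp only [← Finset.sum_filter, Finset.filter_mem_eq_inter, Finset.univ_inter,
    Finset.filter_eq', Finset.mem_univ, if_true, Finset.sum_singleton]
  unfold Choice.cost totalWeight
  rw [← hp]
  congr 2
  exact Finset.sum_congr rfl hq

/-- The terminals and the source are connected to roots of at least the same priority. -/
structure GreedyInv (M : Finset (Fin I.n)) (R : Fin I.n → ℝ≥0) : Prop where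
  subset : M ⊆ insert I.s I.T
  prio_le : ∀ u, I.P u ≤ R u
  root : ∀ t ∈ insert I.s I.T, ∃ r ∈ M, I.P t ≤ I.P r ∧
    ∃ p : I.G.Walk t r, ∀ u ∈ p.support, I.P t ≤ R u
  bound : ∀ (H : I.G.Subgraph) (R' : Fin I.n → ℝ≥0), I.IsPNWST H R' →
    (totalWeight R : ℝ) ≤ 2 * (Real.log (I.T.card + 1) - Real.log M.card) * I.weight H R'

theorem greedyInv_init : I.GreedyInv (insert I.s I.T) I.P where
  subset := subset_rfl
  prio_le _ := le_rfl
  root t ht := ⟨t, ht, le_rfl, .nil, by simp⟩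
  bound H R' _ := by
    have : totalWeight I.P = 0 := Finset.sum_eq_zero fun u _ => I.weight_zero u _ le_rfl
    rw [this, Finset.card_insert_of_notMem I.source_notMem]
    simp

theorem Choice.Valid.card_merge {c : I.Choice} {M : Finset (Fin I.n)} (hc : c.Valid M) :
    (insert c.r (M \ insert c.r c.S)).card + c.S.card = M.card := by
  have h1 : insert c.r (M \ insert c.r c.S) = M \ c.S := by
    ext x
    simp only [Finset.mem_insert, Finset.mem_sdiff, not_or]
    constructor
    · rintro (rfl | h)
      · exact ⟨hc.1, hc.2.2.2.1⟩
      · exact ⟨h.1, h.2.2⟩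
    · intro h
      by_cases hx : x = c.r
      · exact Or.inl hx
      · exact Or.inr ⟨h.1, hx, h.2⟩
  rw [h1, Finset.card_sdiff_of_subset hc.2.1]
  have := Finset.card_le_card hc.2.1
  omega

/-- From h - m ≥ 1 one gets h - m + 1 ≤ 2(h - m), which is where the factor 2 arises; then ln(m/h) ≤
m/h - 1. -/
theorem log_step {h m : ℕ} (hm : 1 ≤ m) (hmh : m < h) :
    ((h - m : ℝ) + 1) / h ≤ 2 * (Real.log h - Real.log m) := by
  have hm' : (1 : ℝ) ≤ m := by exact_mod_cast hm
  have hmh' : (m : ℝ) + 1 ≤ h := by exact_mod_cast hmh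
  have h0 : (0 : ℝ) < h := by linarith
  have h1 := Real.log_le_sub_one_of_pos (show (0 : ℝ) < m / h by positivity)
  rw [Real.log_div (by positivity) (by positivity)] at h1
  have h2 : ((h - m : ℝ) + 1) / h ≤ 2 * (1 - m / h) := by
    rw [div_le_iff₀ h0]
    field_simp
    linarith
  linarith

/-- A terminal whose root is absorbed continues along its leg and the path to the new root. The
rates there are at least the priority of the absorbed root and b, and both are at least the priority
of the terminal. -/
theorem GreedyInv.step {M M' : Finset (Fin I.n)} {R R' : Fin I.n → ℝ≥0} (h : I.GreedyInv M R)
    (hs : I.GreedyStep (M, R) (M', R')) : I.GreedyInv M' R' := by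
  obtain ⟨hM2, c, hc, hmin, p, q, hp, hq, hM', hR'⟩ := hs
  dsimp only at hM2 hc hmin hM' hR'
  subst hM' hR'
  have hRle : ∀ u, R u ≤ c.upgrade p q R u := fun u => le_max_of_le_left (le_max_left _ _)
  have hpb : ∀ u ∈ p.1.support, c.b ≤ c.upgrade p q R u := fun u hu => by
    refine le_max_of_le_left (le_max_of_le_right ?_)
    rw [if_pos hu]
  have hqb : ∀ r' ∈ c.S, ∀ u ∈ (q r').1.support, I.P r' ≤ c.upgrade p q R u := fun r' hr' u hu => by
    refine le_max_of_le_right (le_trans ?_ (Finset.le_sup hr'))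
    rw [if_pos hu]
  have hcard := hc.card_merge
  refine ⟨?_, fun u => (h.prio_le u).trans (hRle u), ?_, ?_⟩
  · intro x hx
    rw [Finset.mem_insert, Finset.mem_sdiff] at hx
    rcases hx with rfl | hx
    · exact h.subset hc.1
    · exact h.subset hx.1
  · intro t ht
    obtain ⟨r, hr, htr, w, hw⟩ := h.root t ht
    by_cases hrS : r ∈ c.S
    · have htb : I.P t ≤ c.b := htr.trans (hc.2.2.2.2.2 r hrS)
      refine ⟨c.r, Finset.mem_insert_self _ _, htb.trans hc.2.2.2.2.1,
        (w.append (q r).1.reverse).append p.1.reverse, fun u hu => ?_⟩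
      simp only [SimpleGraph.Walk.mem_support_append_iff, SimpleGraph.Walk.support_reverse,
        List.mem_reverse] at hu
      rcases hu with (hu | hu) | hu
      · exact (hw u hu).trans (hRle u)
      · exact htr.trans (hqb r hrS u hu)
      · exact htb.trans (hpb u hu)
    · refine ⟨r, ?_, htr, w, fun u hu => (hw u hu).trans (hRle u)⟩
      simp only [Finset.mem_insert, Finset.mem_sdiff, not_or]
      tauto
  · intro H R' hH
    -- The root to which the source is attached has the largest possible priority and serves as the
    -- root of the competing tree.
    obtain ⟨ρ, hρ, hρs, _⟩ := h.root I.s (Finset.mem_insert_self _ _)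
    have h1 := hH.ratio_mul_card_le h.subset hM2 hρ hρs hmin
    have h2 := c.totalWeight_upgrade_le hc p q R hp hq
    have h3 := h.bound H R' hH
    have hSpos := hc.2.2.1.card_pos
    have hMpos : 0 < (insert c.r (M \ insert c.r c.S)).card :=
      (Finset.insert_nonempty _ _).card_pos
    have h4 := log_step (h := M.card) hMpos (by omega)
    rw [← c.ratio_mul] at h2
    have h1' : (c.ratio : ℝ) * M.card ≤ I.weight H R' := by exact_mod_cast h1
    have h2' : (totalWeight (c.upgrade p q R) : ℝ) ≤
        totalWeight R + c.ratio * (c.S.card + 1) := by exact_mod_cast h2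
    have hMc : (0 : ℝ) < M.card := by exact_mod_cast (by omega : 0 < M.card)
    have hSc : (c.S.card : ℝ) = M.card - (insert c.r (M \ insert c.r c.S)).card := by
      rw [← hcard]; push_cast; ring
    have h5 : (c.ratio : ℝ) ≤ I.weight H R' / M.card := by rwa [le_div_iff₀ hMc]
    have h6 : (c.ratio : ℝ) * (c.S.card + 1) ≤
        2 * (Real.log M.card - Real.log (insert c.r (M \ insert c.r c.S)).card) *
          I.weight H R' := by
      calc (c.ratio : ℝ) * (c.S.card + 1) ≤ I.weight H R' / M.card * (c.S.card + 1) := by gcongr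
        _ = (c.S.card + 1 : ℝ) / M.card * I.weight H R' := by ring
        _ ≤ _ := by rw [hSc]; gcongr
    linarith

theorem GreedyInv.of_reachable {x : Finset (Fin I.n) × (Fin I.n → ℝ≥0)}
    (h : Relation.ReflTransGen I.GreedyStep (insert I.s I.T, I.P) x) : I.GreedyInv x.1 x.2 := by
  induction h with
  | refl => exact greedyInv_init
  | tail _ hs ih => exact ih.step hs

/-- Every terminal is connected to the source at the rate of its priority. -/
def Feasible (R : Fin I.n → ℝ≥0) : Prop :=
  (∀ u, I.P u ≤ R u) ∧ ∀ t ∈ I.T, ∃ p : I.G.Walk I.s t, ∀ u ∈ p.support, I.P t ≤ R u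

/-- With a single root left, the walks from s and from t end at the same vertex and can be joined;
the one from s has rate at least P(s) ≥ P(t). -/
theorem GreedyOutput.feasible {R : Fin I.n → ℝ≥0} (h : I.GreedyOutput R) : I.Feasible R := by
  obtain ⟨M, hM, hcard⟩ := h
  have hinv := GreedyInv.of_reachable hM
  obtain ⟨r, rfl⟩ := Finset.card_eq_one.1 hcard
  refine ⟨hinv.prio_le, fun t ht => ?_⟩
  obtain ⟨r₁, hr₁, h₁, p, hp⟩ := hinv.root t (Finset.mem_insert_of_mem ht)
  obtain ⟨r₂, hr₂, h₂, q, hq⟩ := hinv.root I.s (Finset.mem_insert_self _ _)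
  rw [Finset.mem_singleton] at hr₁ hr₂
  subst hr₁ hr₂
  refine ⟨q.append p.reverse, fun u hu => ?_⟩
  simp only [SimpleGraph.Walk.mem_support_append_iff, SimpleGraph.Walk.support_reverse,
    List.mem_reverse] at hu
  rcases hu with hu | hu
  · exact (I.prio_le_source (Finset.mem_insert_of_mem ht)).trans (hq u hu)
  · exact hp u hu

theorem GreedyOutput.weight_le {R : Fin I.n → ℝ≥0} (h : I.GreedyOutput R) {H : I.G.Subgraph}
    (hH : I.IsPNWST H R) : (I.weight H R : ℝ) ≤ 2 * Real.log (I.T.card + 1) * I.opt := by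
  obtain ⟨M, hM, hcard⟩ := h
  have hinv := GreedyInv.of_reachable hM
  have hlog : 0 ≤ Real.log (I.T.card + 1) := Real.log_nonneg (by simp)
  have key : ∀ (H' : I.G.Subgraph) (R' : Fin I.n → ℝ≥0), I.IsPNWST H' R' →
      (I.weight H R : ℝ) ≤ 2 * Real.log (I.T.card + 1) * I.weight H' R' := by
    intro H' R' h'
    have h1 := hinv.bound H' R' h'
    dsimp only at h1
    rw [hcard] at h1
    simp only [Nat.cast_one, Real.log_one, sub_zero] at h1
    exact (NNReal.coe_le_coe.2 (weight_le_totalWeight H R)).trans h1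
  have hne : {c | ∃ (H : I.G.Subgraph) (R : Fin I.n → ℝ≥0), I.IsPNWST H R ∧
    c = I.weight H R}.Nonempty := ⟨_, H, R, hH, rfl⟩
  -- A zero factor cannot be divided out; in that case comparing the output with itself already
  -- shows that its weight is zero.
  rcases hlog.eq_or_lt with h0 | hpos
  · have := key H R hH
    rw [← h0] at this ⊢
    simpa using this
  · rw [← div_le_iff₀' (by positivity)]
    have : ((I.weight H R : ℝ) / (2 * Real.log (I.T.card + 1))).toNNReal ≤ I.opt := by
      refine le_csInf hne ?_
      rintro _ ⟨H', R', h', rfl⟩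
      rw [Real.toNNReal_le_iff_le_coe, div_le_iff₀' (by positivity)]
      exact key H' R' h'
    exact Real.toNNReal_le_iff_le_coe.1 this

end PriorityNWST

namespace PriorityNWST

variable {I : PriorityNWST}

/-! ### Optimal path trees -/

/-- The state of Dijkstra's algorithm: `A` is the set of the vertices reached from `src`, with
distances `d` and parents `pa`. The edge from `u` to `x` extends a path of length `d u` to a path
of length `f (d u) u x`. -/
structure PartialTree (I : PriorityNWST) (f : ℝ → ℕ → ℕ → ℝ) (src : Fin I.n) (d₀ : ℝ)
    (A : Finset (Fin I.n)) (d : ℕ → ℝ) (pa : ℕ → ℕ) : Prop where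
  src_mem : src ∈ A
  par_src : pa src = src
  dist_src : d src = d₀
  tree : ∃ rank : Fin I.n → ℕ, (∀ x ∈ A, rank x < A.card) ∧ ∀ x ∈ A, x ≠ src →
    ∃ u ∈ A, pa x = u ∧ I.G.Adj u x ∧ rank u < rank x ∧ d x = f (d u) u x
  relaxed : ∀ u ∈ A, ∀ x ∈ A, I.G.Adj u x → d x ≤ f (d u) u x
  boundary : ∀ u ∈ A, ∀ x ∈ A, ∀ y, y ∉ A → I.G.Adj u y → d x ≤ f (d u) u y

/-- The extension of paths in the computation of minimum weight paths at rate `b`. -/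
noncomputable def sigmaStep (I : PriorityNWST) (b : ℝ≥0) (d : ℝ) (u _ : ℕ) : ℝ :=
  max (d + if h : u < I.n then (I.w ⟨u, h⟩ b : ℝ) else 0) 0

namespace PartialTree

variable {f : ℝ → ℕ → ℕ → ℝ} {src : Fin I.n} {d₀ : ℝ} {A : Finset (Fin I.n)} {d : ℕ → ℝ}
  {pa : ℕ → ℕ}

/-- The step of Dijkstra's algorithm for abstract lengths. All that is needed is that extending a
path does not shorten it; optimality is not part of the invariant and is derived later from
`relaxed`. -/
theorem extend (h : I.PartialTree f src d₀ A d pa) (hf : ∀ e u x, e ≤ f e u x) {u₀ x₀ : Fin I.n}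
    (hu₀ : u₀ ∈ A) (hx₀ : x₀ ∉ A) (hadj : I.G.Adj u₀ x₀)
    (hmin : ∀ u ∈ A, ∀ x, x ∉ A → I.G.Adj u x → f (d u₀) u₀ x₀ ≤ f (d u) u x) {d' : ℕ → ℝ}
    {pa' : ℕ → ℕ} (hd : d' x₀ = f (d u₀) u₀ x₀) (hp : pa' x₀ = u₀)
    (hd' : ∀ x : Fin I.n, x ≠ x₀ → d' x = d x) (hp' : ∀ x : Fin I.n, x ≠ x₀ → pa' x = pa x) :
    I.PartialTree f src d₀ (insert x₀ A) d' pa' := by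
  have hne : ∀ x ∈ A, x ≠ x₀ := fun x hx hxx => hx₀ (hxx ▸ hx)
  refine ⟨Finset.mem_insert_of_mem h.src_mem, ?_, ?_, ?_, ?_, ?_⟩
  · rw [hp' _ (hne _ h.src_mem), h.par_src]
  · rw [hd' _ (hne _ h.src_mem), h.dist_src]
  · obtain ⟨rank, hr, ht⟩ := h.tree
    -- The rank is the order of arrival. The length could not replace it, since it may stay constant
    -- along an edge.
    refine ⟨fun x => if x = x₀ then A.card else rank x, ?_, ?_⟩
    · intro x hx
      rw [Finset.card_insert_of_notMem hx₀]
      dsimp only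
      split_ifs with hxx
      · exact Nat.lt_succ_self _
      · exact (hr x ((Finset.mem_insert.1 hx).resolve_left hxx)).trans (Nat.lt_succ_self _)
    · intro x hx hxs
      rcases Finset.mem_insert.1 hx with rfl | hx
      · refine ⟨u₀, Finset.mem_insert_of_mem hu₀, hp, hadj, ?_, ?_⟩
        · dsimp only
          rw [if_pos rfl, if_neg (hne _ hu₀)]
          exact hr _ hu₀
        · rw [hd, hd' _ (hne _ hu₀)]
      · obtain ⟨u, hu, h1, h2, h3, h4⟩ := ht x hx hxs
        refine ⟨u, Finset.mem_insert_of_mem hu, ?_, h2, ?_, ?_⟩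
        · rw [hp' _ (hne _ hx), h1]
        · dsimp only
          rwa [if_neg (hne _ hu), if_neg (hne _ hx)]
        · rw [hd' _ (hne _ hx), hd' _ (hne _ hu), h4]
  · intro u hu x hx hux
    rcases Finset.mem_insert.1 hu with rfl | hu' <;> rcases Finset.mem_insert.1 hx with rfl | hx'
    · exact (hux.ne rfl).elim
    · rw [hd' _ (hne _ hx'), hd]
      exact (h.boundary u₀ hu₀ x hx' _ hx₀ hadj).trans (hf _ _ _)
    · rw [hd, hd' _ (hne _ hu')]
      exact hmin u hu' _ hx₀ hux
    · rw [hd' _ (hne _ hx'), hd' _ (hne _ hu')]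
      exact h.relaxed u hu' x hx' hux
  · intro u hu x hx y hy hux
    rw [Finset.mem_insert, not_or] at hy
    have hle : ∀ x ∈ A, d x ≤ f (d u₀) u₀ x₀ := fun x hx => h.boundary u₀ hu₀ x hx _ hx₀ hadj
    rcases Finset.mem_insert.1 hu with rfl | hu' <;> rcases Finset.mem_insert.1 hx with rfl | hx'
    · exact hf _ _ _
    · rw [hd' _ (hne _ hx'), hd]
      exact (hle x hx').trans (hf _ _ _)
    · rw [hd, hd' _ (hne _ hu')]
      exact hmin u hu' y hy.2 hux
    · rw [hd' _ (hne _ hx'), hd' _ (hne _ hu')]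
      exact h.boundary u hu' x hx' y hy.2 hux

theorem exists_boundary (hA : A ≠ Finset.univ) (h : src ∈ A) :
    ∃ u ∈ A, ∃ x, x ∉ A ∧ I.G.Adj u x := by
  obtain ⟨y, hy⟩ : ∃ y, y ∉ A := by
    by_contra! hcon
    exact hA (Finset.eq_univ_iff_forall.2 hcon)
  obtain ⟨p⟩ := I.connected.preconnected src y
  obtain ⟨e, _, h1, h2⟩ := p.exists_boundary_dart (A : Set (Fin I.n)) h hy
  exact ⟨e.fst, h1, e.snd, h2, e.adj⟩

/-- The paths from the source in a complete tree. -/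
theorem exists_path (h : I.PartialTree f src d₀ Finset.univ d pa)
    {motive : ∀ x : Fin I.n, I.G.Walk src x → Prop} (nil : motive src .nil)
    (concat : ∀ (u x : Fin I.n) (p : I.G.Walk src u) (hux : I.G.Adj u x), pa x = u →
      d x = f (d u) u x → motive u p → motive x (p.concat hux))
    (x : Fin I.n) :
    ∃ p : I.G.Walk src x, p.IsPath ∧ (∀ y ∈ p.support, ∃ i ≤ p.length, pa^[i] x = y) ∧
      (∀ i, ∃ y ∈ p.support, pa^[i] x = y) ∧ motive x p := by
  obtain ⟨rank, _, ht⟩ := h.tree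
  suffices H : ∀ N (x : Fin I.n), rank x ≤ N → ∃ p : I.G.Walk src x, p.IsPath ∧
      (∀ y ∈ p.support, rank y ≤ rank x) ∧
      (∀ y ∈ p.support, ∃ i ≤ p.length, pa^[i] x = y) ∧
      (∀ i, ∃ y ∈ p.support, pa^[i] x = y) ∧ motive x p by
    obtain ⟨p, h1, _, h2⟩ := H _ x le_rfl
    exact ⟨p, h1, h2⟩
  have hsrc : ∃ p : I.G.Walk src src, p.IsPath ∧ (∀ y ∈ p.support, rank y ≤ rank src) ∧
      (∀ y ∈ p.support, ∃ i ≤ p.length, pa^[i] src = y) ∧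
      (∀ i, ∃ y ∈ p.support, pa^[i] src = y) ∧ motive src p := by
    refine ⟨.nil, .nil, by simp, by simp, fun i => ⟨src, by simp, ?_⟩, nil⟩
    -- The source is its own parent, so following parents too often does no harm.
    exact Function.iterate_fixed h.par_src i
  intro N
  induction N with
  | zero =>
    intro x hx
    by_cases hxs : x = src
    · subst hxs; exact hsrc
    · obtain ⟨u, _, _, _, h3, _⟩ := ht x (Finset.mem_univ _) hxs
      omega
  | succ N ih =>
    intro x hx
    by_cases hxs : x = src
    · subst hxs; exact hsrc
    · obtain ⟨u, _, h1, h2, h3, h4⟩ := ht x (Finset.mem_univ _) hxs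
      obtain ⟨p, hp, hpr, hpi, hpi', hpm⟩ := ih u (by omega)
      have hxp : x ∉ p.support := fun hx => absurd (hpr x hx) (by omega)
      refine ⟨p.concat h2, hp.concat hxp h2, ?_, ?_, ?_,
        concat u x p h2 h1 h4 hpm⟩
      · intro y hy
        rw [SimpleGraph.Walk.support_concat, List.mem_append, List.mem_singleton] at hy
        rcases hy with hy | rfl
        · exact (hpr y hy).trans h3.le
        · exact le_rfl
      · intro y hy
        rw [SimpleGraph.Walk.support_concat, List.mem_append, List.mem_singleton] at hy
        rw [SimpleGraph.Walk.length_concat]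
        rcases hy with hy | rfl
        · obtain ⟨i, hi, hiy⟩ := hpi y hy
          exact ⟨i + 1, by omega, by rw [Function.iterate_succ_apply, h1, hiy]⟩
        · exact ⟨0, by omega, rfl⟩
      · intro i
        simp only [SimpleGraph.Walk.support_concat, List.mem_append, List.mem_singleton]
        cases i with
        | zero => exact ⟨x, Or.inr rfl, rfl⟩
        | succ i =>
          obtain ⟨y, hy, hiy⟩ := hpi' i
          exact ⟨y, Or.inl hy, by rw [Function.iterate_succ_apply, h1, hiy]⟩

/-! ### Minimum weight paths -/

variable {b : ℝ≥0}

/-- The program adds the weight of a vertex when it leaves it, so the end is not counted. The start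
is counted, but its weight is zero. -/
theorem sum_dropLast_support {u v : Fin I.n} (p : I.G.Path u v) (hu : I.w u b = 0) :
    (p.1.support.dropLast.map fun z => (I.w z b : ℝ)).sum = I.pathWeight b p := by
  obtain ⟨p, hp⟩ := p
  have hsup : p.support = p.support.dropLast ++ [v] := by
    conv_lhs => rw [← List.dropLast_append_getLast p.support_ne_nil]
    rw [p.getLast_support]
  have hnd := hp.support_nodup
  rw [hsup, List.nodup_append] at hnd
  have hv : v ∉ p.support.dropLast := fun h => hnd.2.2 v h v (by simp) rfl
  have h1 : p.support.toFinset \ {u, v} = p.support.dropLast.toFinset.erase u := by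
    conv_lhs => rw [hsup]
    ext z
    simp only [List.toFinset_append, Finset.mem_sdiff, Finset.mem_union, List.mem_toFinset,
      Finset.mem_insert, Finset.mem_singleton, not_or, List.mem_singleton, Finset.mem_erase]
    constructor
    · rintro ⟨h1 | h1, h2, h3⟩
      · exact ⟨h2, h1⟩
      · exact absurd h1 h3
    · rintro ⟨h1, h2⟩
      exact ⟨Or.inl h2, h1, fun h => hv (h ▸ h2)⟩
  rw [pathWeight, h1, Finset.sum_erase _ (by exact hu), ← List.sum_toFinset _ hnd.1]
  push_cast
  rfl

theorem dist_nonneg (h : I.PartialTree (I.sigmaStep b) src 0 Finset.univ d pa) (x : Fin I.n) :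
    0 ≤ d x := by
  by_cases hx : x = src
  · rw [hx, h.dist_src]
  · obtain ⟨_, _, ht⟩ := h.tree
    obtain ⟨u, _, _, _, _, h4⟩ := ht x (Finset.mem_univ _) hx
    rw [h4]
    exact le_max_right _ _

/-- Summation of the inequalities `relaxed` along the walk. The maximum with 0 in `sigmaStep` has no
effect because distances are nonnegative. -/
theorem dist_le_walk (h : I.PartialTree (I.sigmaStep b) src 0 Finset.univ d pa) {u x : Fin I.n}
    (p : I.G.Walk u x) : d x ≤ d u + (p.support.dropLast.map fun z => (I.w z b : ℝ)).sum := by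
  induction p with
  | nil => simp
  | @cons u v w huv p ih =>
    have h1 := h.relaxed u (Finset.mem_univ _) v (Finset.mem_univ _) huv
    have h2 : I.sigmaStep b (d u) u v = d u + I.w u b := by
      simp only [sigmaStep, Fin.is_lt, dite_true, Fin.eta]
      exact max_eq_left (add_nonneg (h.dist_nonneg u) (NNReal.coe_nonneg _))
    rw [SimpleGraph.Walk.support_cons, List.dropLast_cons_of_ne_nil p.support_ne_nil,
      List.map_cons, List.sum_cons]
    linarith

/-- The distances are the weights of minimum weight paths, and the path in the tree attains the
minimum. -/
theorem sigma_spec (h : I.PartialTree (I.sigmaStep b) src 0 Finset.univ d pa)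
    (hsrc : I.w src b = 0) (x : Fin I.n) : d x = I.sigma b src x ∧ ∃ p : I.G.Path src x,
      I.pathWeight b p = I.sigma b src x ∧
      ∀ y : Fin I.n, y ∈ p.1.support ↔ ∃ i < I.n, pa^[i] x = y := by
  obtain ⟨p, hp, h1, h2, h3⟩ := h.exists_path
    (motive := fun x p => d x = (p.support.dropLast.map fun z => (I.w z b : ℝ)).sum)
    (by simpa using h.dist_src)
    (by
      intro u x p hux _ hdx hdu
      have hsup : p.support = p.support.dropLast ++ [u] := by
        conv_lhs => rw [← List.dropLast_append_getLast p.support_ne_nil]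
        rw [p.getLast_support]
      rw [hdx, SimpleGraph.Walk.support_concat, List.dropLast_concat]
      conv_rhs => rw [hsup]
      rw [List.map_append, List.sum_append, ← hdu]
      simp only [sigmaStep, Fin.is_lt, dite_true, Fin.eta, List.map_cons, List.map_nil,
        List.sum_cons, List.sum_nil, add_zero]
      exact max_eq_left (add_nonneg (h.dist_nonneg u) (NNReal.coe_nonneg _))) x
  rw [sum_dropLast_support ⟨p, hp⟩ hsrc] at h3
  have hle : ∀ q : I.G.Path src x, I.pathWeight b ⟨p, hp⟩ ≤ I.pathWeight b q := by
    intro q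
    have h4 := h.dist_le_walk q.1
    rw [sum_dropLast_support q hsrc, h.dist_src, h3, zero_add] at h4
    exact_mod_cast h4
  have : Nonempty (I.G.Path src x) := ⟨⟨p, hp⟩⟩
  have heq : I.pathWeight b ⟨p, hp⟩ = I.sigma b src x :=
    le_antisymm (le_ciInf hle) (ciInf_le (OrderBot.bddBelow _) _)
  refine ⟨by rw [h3, heq], ⟨p, hp⟩, heq, fun y => ⟨fun hy => ?_, ?_⟩⟩
  · obtain ⟨i, hi, hiy⟩ := h1 y hy
    have := hp.length_lt
    rw [Fintype.card_fin] at this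
    exact ⟨i, by omega, hiy⟩
  · rintro ⟨i, _, hiy⟩
    obtain ⟨y', hy', h5⟩ := h2 i
    rw [h5] at hiy
    rwa [← Fin.ext hiy]

end PartialTree

end PriorityNWST

namespace RealRAM

variable {I : PriorityNWST}

/-! ### Searching for a minimum -/

/-- `best` is the smallest value of a valid item of `X`, attained at `e`, if `found = 1`, and there
is no valid item in `X` if `found = 0`. -/
def ArgMin {α : Type*} (valid : α → Prop) (val : α → ℝ) (X : Set α) (found : ℕ) (best : ℝ)
    (e : α) : Prop :=
  (found = 0 ∧ ∀ x ∈ X, ¬ valid x) ∨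
    (found = 1 ∧ valid e ∧ val e = best ∧ ∀ x ∈ X, valid x → best ≤ val x)

namespace ArgMin

variable {α : Type*} {valid : α → Prop} {val : α → ℝ} {X : Set α} {found : ℕ} {best : ℝ} {e x : α}

theorem union_of_not_valid (h : ArgMin valid val X found best e) {Y : Set α}
    (hx : ∀ x ∈ Y, ¬ valid x) : ArgMin valid val (X ∪ Y) found best e := by
  rcases h with ⟨h1, h2⟩ | ⟨h1, h2, h3, h4⟩
  · exact Or.inl ⟨h1, fun y hy => hy.elim (h2 y) (hx y)⟩
  · exact Or.inr ⟨h1, h2, h3, fun y hy hv => hy.elim (fun hy => h4 y hy hv)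
      fun hy => absurd hv (hx y hy)⟩

theorem union_of_le (h : ArgMin valid val X found best e) (hf : 1 ≤ found)
    (hx : best ≤ val x) : ArgMin valid val (X ∪ {x}) found best e := by
  rcases h with ⟨h1, h2⟩ | ⟨h1, h2, h3, h4⟩
  · omega
  · exact Or.inr ⟨h1, h2, h3, fun y hy hv => hy.elim (fun hy => h4 y hy hv) fun hy => hy ▸ hx⟩

theorem union_of_lt (h : ArgMin valid val X found best e) (hv : valid x)
    (hx : ¬ (1 ≤ found ∧ best ≤ val x)) : ArgMin valid val (X ∪ {x}) 1 (val x) x := by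
  refine Or.inr ⟨rfl, hv, rfl, fun y hy hvy => ?_⟩
  rcases h with ⟨h1, h2⟩ | ⟨h1, h2, h3, h4⟩
  · rcases hy with hy | hy
    · exact absurd hvy (h2 y hy)
    · rw [hy]
  · have : val x ≤ best := by
      by_contra hcon
      exact hx ⟨h1.ge, (not_le.1 hcon).le⟩
    rcases hy with hy | hy
    · exact this.trans (h4 y hy hvy)
    · rw [hy]

end ArgMin

/-! ### The arrays of the program -/

notation "vertsArr" => (0 : ℕ)
notation "adjArr" => (1 : ℕ)
notation "aliveArr" => (2 : ℕ)
notation "repArr" => (3 : ℕ)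
notation "parArr" => (4 : ℕ)
notation "doneArr" => (5 : ℕ)
notation "slotVar" => (6 : ℕ)
notation "srcVar" => (7 : ℕ)
notation "roundVar" => (8 : ℕ)
notation "uVar" => (9 : ℕ)
notation "xVar" => (10 : ℕ)
notation "foundVar" => (11 : ℕ)
notation "bestU" => (12 : ℕ)
notation "bestX" => (13 : ℕ)
notation "rateArr" => (0 : ℕ)
notation "distArr" => (1 : ℕ)
notation "keyReal" => (2 : ℕ)
notation "bestReal" => (3 : ℕ)

/-- The cell `e` of a one-dimensional array. -/
abbrev NExp.cell (a : ℕ) (e : NExp) : NExp := .get a e (.lit 0) (.lit 0)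

/-- Assignment to the cell `i` of a one-dimensional array. -/
abbrev Cmd.setCell (a : ℕ) (i e : NExp) : Cmd := .setNat a i (.lit 0) (.lit 0) e

/-- Considers the edge between the current vertices `u` and `x`. -/
def growScan (e₁ e₂ : RExp) : Cmd :=
  .ite (.and (.and (.leNat (.lit 1) (.cell doneArr (.var uVar)))
      (.not (.leNat (.lit 1) (.cell doneArr (.var xVar))))) (.adj (.var uVar) (.var xVar)))
    (.seq (.assignReal keyReal e₁)
      (.seq (.ite (.leReal e₂ (.var keyReal)) .skip (.assignReal keyReal e₂))
        (.ite (.and (.leNat (.lit 1) (.var foundVar)) (.leReal (.var bestReal) (.var keyReal)))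
          .skip
          (.seq (.assign foundVar (.lit 1)) (.seq (.assignReal bestReal (.var keyReal))
            (.seq (.assign bestU (.var uVar)) (.assign bestX (.var xVar))))))))
    .skip

/-- Adds the best edge to the tree. -/
def growExtend : Cmd :=
  .ite (.leNat (.lit 1) (.var foundVar))
    (.seq (.setReal distArr (.var slotVar) (.var srcVar) (.var bestX) (.var bestReal))
      (.seq (.setNat parArr (.var slotVar) (.var srcVar) (.var bestX) (.var bestU))
        (.setCell doneArr (.var bestX) (.lit 1))))
    .skip

def growSearch (e₁ e₂ : RExp) : Cmd := .forVerts uVar (.forVerts xVar (growScan e₁ e₂))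

def growRound (e₁ e₂ : RExp) : Cmd :=
  .seq (.assign foundVar (.lit 0)) (.seq (growSearch e₁ e₂) growExtend)

def growInit : Cmd :=
  .seq (.forVerts xVar (.setCell doneArr (.var xVar) (.lit 0)))
    (.seq (.setCell doneArr (.var srcVar) (.lit 1))
      (.setNat parArr (.var slotVar) (.var srcVar) (.var srcVar) (.var srcVar)))

/-- Dijkstra's algorithm from the source `srcVar`, with the maximum of `e₁` and `e₂` as the distance
of `x` via `u`. The result is stored in the part `slotVar, srcVar` of the arrays. -/
def grow (e₁ e₂ : RExp) : Cmd := .seq growInit (.forVerts roundVar (growRound e₁ e₂))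

/-- The edges that leave `A`. -/
def Crossing (A : Finset (Fin I.n)) (p : ℕ × ℕ) : Prop :=
  ∃ (hu : p.1 < I.n) (hx : p.2 < I.n), (⟨p.1, hu⟩ : Fin I.n) ∈ A ∧
    (⟨p.2, hx⟩ : Fin I.n) ∉ A ∧ I.G.Adj ⟨p.1, hu⟩ ⟨p.2, hx⟩

/-- The memory holds the best edge among the edges of `Y` that leave `A`. -/
def GrowBest (A : Finset (Fin I.n)) (val : ℕ × ℕ → ℝ) (Y : Set (ℕ × ℕ)) (τ : State) : Prop :=
  ArgMin (Crossing A) val Y (τ.nat foundVar 0 0 0) (τ.real bestReal 0 0 0)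
    (τ.nat bestU 0 0 0, τ.nat bestX 0 0 0)

/-- The maximum of `e₁` and `e₂` is the distance `f d u x` of the current vertex `x` via `u`. -/
structure IsKey (I : PriorityNWST) (e₁ e₂ : RExp) (f : ℝ → ℕ → ℕ → ℝ) (j src : ℕ) (σ : State) :
    Prop where
  eq : ∀ τ : State, τ.nat slotVar = σ.nat slotVar → τ.nat srcVar = σ.nat srcVar →
      τ.real rateArr = σ.real rateArr → max (e₁.val I τ) (e₂.val I τ) =
        f (τ.real distArr j src (τ.nat uVar 0 0 0)) (τ.nat uVar 0 0 0) (τ.nat xVar 0 0 0)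
  eq_set : ∀ (τ : State) (y : ℝ), e₂.val I (τ.setReal keyReal 0 0 0 y) = e₂.val I τ

theorem growScan_run {e₁ e₂ : RExp} {σ τ : State} {f : ℝ → ℕ → ℕ → ℝ} {j src : ℕ}
    {A : Finset (Fin I.n)} (hA : ∀ x : Fin I.n, 1 ≤ σ.nat doneArr x 0 0 ↔ x ∈ A)
    (he : IsKey I e₁ e₂ f j src σ) {u x : ℕ} (hu : u < I.n) (hx : x < I.n) {Y : Set (ℕ × ℕ)}
    (hτ : (growSearch e₁ e₂).Frame σ τ) (hτu : τ.nat uVar 0 0 0 = u) (hτx : τ.nat xVar 0 0 0 = x)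
    (hI : GrowBest A (fun p => f (σ.real distArr j src p.1) p.1 p.2) Y τ) :
    Run I (growScan e₁ e₂) τ (e₁.cost + 2 * e₂.cost + 200)
      (GrowBest A (fun p => f (σ.real distArr j src p.1) p.1 p.2) (Y ∪ {(u, x)})) := by
  refine (Run.loopFree (by simp [growScan, Cmd.LoopFree]) ?_).bound
    (B := (growScan e₁ e₂).cost) ?_
  · have h5 : τ.nat doneArr = σ.nat doneArr := hτ.nat _ (by
      simp [growSearch, growScan, Cmd.forVerts, Cmd.natWrites])
    have h6 : τ.nat slotVar = σ.nat slotVar := hτ.nat _ (by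
      simp [growSearch, growScan, Cmd.forVerts, Cmd.natWrites])
    have h7 : τ.nat srcVar = σ.nat srcVar := hτ.nat _ (by
      simp [growSearch, growScan, Cmd.forVerts, Cmd.natWrites])
    have hr0 : τ.real rateArr = σ.real rateArr := hτ.real _ (by
      simp [growSearch, growScan, Cmd.forVerts, Cmd.realWrites])
    have hr1 : τ.real distArr = σ.real distArr := hτ.real _ (by
      simp [growSearch, growScan, Cmd.forVerts, Cmd.realWrites])
    have hkey := he.eq τ h6 h7 hr0
    rw [hr1, hτu, hτx] at hkey
    have hvalid : BExp.Holds I τ (.and (.and (.leNat (.lit 1) (.cell doneArr (.var uVar)))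
        (.not (.leNat (.lit 1) (.cell doneArr (.var xVar))))) (.adj (.var uVar) (.var xVar))) ↔
        Crossing A (u, x) := by
      simp only [BExp.Holds, NExp.val, hτu, hτx, h5, Crossing, ← hA, hu, hx, exists_true_left,
        and_assoc]
    unfold growScan
    by_cases hv : Crossing A (u, x)
    · rw [Cmd.result_ite_pos (hvalid.2 hv), Cmd.result_seq, Cmd.result_seq]
      obtain ⟨ρ, hρ⟩ : ∃ ρ, ρ = Cmd.result I
          (.ite (.leReal e₂ (.var keyReal)) .skip (.assignReal keyReal e₂))
          (Cmd.result I (.assignReal keyReal e₁) τ) := ⟨_, rfl⟩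
      have hρ' : ρ.nat = τ.nat ∧ ρ.real bestReal = τ.real bestReal ∧
          ρ.real keyReal 0 0 0 = f (σ.real distArr j src u) u x := by
        rw [hρ, ← hkey]
        by_cases h : e₂.val I τ ≤ e₁.val I τ
        · rw [Cmd.result_ite_pos (by
            simpa [BExp.Holds, Cmd.result, RExp.val, NExp.val, he.eq_set] using h)]
          simp [Cmd.result, NExp.val, h]
        · rw [Cmd.result_ite_neg (by
            simpa [BExp.Holds, Cmd.result, RExp.val, NExp.val, he.eq_set] using h)]
          simp [Cmd.result, NExp.val, he.eq_set, (not_le.1 h).le]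
      obtain ⟨hρn, hρ3, hρ2⟩ := hρ'
      rw [← hρ]
      have hbest : BExp.Holds I ρ (.and (.leNat (.lit 1) (.var foundVar))
          (.leReal (.var bestReal) (.var keyReal))) ↔ (1 ≤ τ.nat foundVar 0 0 0 ∧
            τ.real bestReal 0 0 0 ≤ f (σ.real distArr j src u) u x) := by
        simp only [BExp.Holds, NExp.val, RExp.val, hρn, hρ3, hρ2]
      by_cases hb : 1 ≤ τ.nat foundVar 0 0 0 ∧
          τ.real bestReal 0 0 0 ≤ f (σ.real distArr j src u) u x
      · rw [Cmd.result_ite_pos (hbest.2 hb)]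
        simp only [Cmd.result, GrowBest, hρn, hρ3]
        exact hI.union_of_le (x := (u, x)) hb.1 hb.2
      · rw [Cmd.result_ite_neg (hbest.not.2 hb)]
        have := hI.union_of_lt (x := (u, x)) hv hb
        simpa [GrowBest, Cmd.result, NExp.val, RExp.val, hρn, hρ2, hτu, hτx] using this
    · rw [Cmd.result_ite_neg (hvalid.not.2 hv)]
      refine hI.union_of_not_valid ?_
      rintro _ rfl
      exact hv
  · simp only [growScan, Cmd.cost, BExp.cost, NExp.cost, RExp.cost]
    omega

theorem growSearch_run {e₁ e₂ : RExp} {σ : State} {f : ℝ → ℕ → ℕ → ℝ} {j src : ℕ}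
    {A : Finset (Fin I.n)} (hA : ∀ x : Fin I.n, 1 ≤ σ.nat doneArr x 0 0 ↔ x ∈ A)
    (he : IsKey I e₁ e₂ f j src σ) (h0 : σ.nat foundVar 0 0 0 = 0) :
    Run I (growSearch e₁ e₂) σ (900 * (I.n * (I.n * (e₁.cost + 2 * e₂.cost + 200))))
      (GrowBest A (fun p => f (σ.real distArr j src p.1) p.1 p.2)
        (⋃ u < I.n, ⋃ x < I.n, {(u, x)})) := by
  have hset : ∀ (a : ℕ), a = uVar ∨ a = xVar → ∀ (Y : Set (ℕ × ℕ)) (τ : State) (x : ℕ),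
      GrowBest A (fun p => f (σ.real distArr j src p.1) p.1 p.2) Y τ →
      GrowBest A (fun p => f (σ.real distArr j src p.1) p.1 p.2) Y (τ.setNat a 0 0 0 x) := by
    rintro a (rfl | rfl) Y τ x h <;> simpa [GrowBest] using h
  have := Run.forVerts_union_const (I := I) (a := uVar) (c := .forVerts xVar (growScan e₁ e₂))
    (σ := σ) (by simp [growScan, Cmd.forVerts, Cmd.natWrites])
    (GrowBest A (fun p => f (σ.real distArr j src p.1) p.1 p.2))
    (fun u => ⋃ x < I.n, {(u, x)}) (B := 30 * (I.n * (e₁.cost + 2 * e₂.cost + 200))) ?_ ∅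
    (Or.inl ⟨h0, by simp⟩) (hset _ (Or.inl rfl)) ?_
  · refine this.mono (le_of_eq (by ring)) fun τ _ h => ?_
    rwa [Set.empty_union] at h
  · have := I.n_pos
    nlinarith
  · intro u hu Y τ hτ hτu hI
    refine Run.forVerts_union_const (I := I) (a := xVar)
      (by simp [growScan, Cmd.natWrites])
      (GrowBest A (fun p => f (σ.real distArr j src p.1) p.1 p.2)) (fun x => {(u, x)})
      (by omega) Y hI (hset _ (Or.inr rfl)) ?_
    intro x hx Y τ' hτ' hτx hI
    refine growScan_run hA he hu hx (hτ.trans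
      (hτ'.mono (by simp [growScan, Cmd.forVerts, Cmd.natWrites])
        (by simp [growScan, Cmd.forVerts, Cmd.realWrites]))) ?_ hτx hI
    rw [hτ'.nat _ (by simp [growScan, Cmd.forVerts, Cmd.natWrites]), hτu]

theorem IsKey.congr {e₁ e₂ : RExp} {f : ℝ → ℕ → ℕ → ℝ} {j src : ℕ} {σ σ' : State}
    (h : IsKey I e₁ e₂ f j src σ) (h6 : σ'.nat slotVar = σ.nat slotVar)
    (h7 : σ'.nat srcVar = σ.nat srcVar) (h0 : σ'.real rateArr = σ.real rateArr) :
    IsKey I e₁ e₂ f j src σ' :=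
  ⟨fun τ h1 h2 h3 => h.eq τ (h1.trans h6) (h2.trans h7) (h3.trans h0), h.eq_set⟩

/-- The memory `τ` after `m` rounds of Dijkstra's algorithm, started with memory `σ`. -/
def GrowState (f : ℝ → ℕ → ℕ → ℝ) (j : ℕ) (src : Fin I.n) (d₀ : ℝ) (σ : State) (m : ℕ)
    (τ : State) : Prop :=
  ∃ A : Finset (Fin I.n), (∀ x : Fin I.n, 1 ≤ τ.nat doneArr x 0 0 ↔ x ∈ A) ∧
    I.PartialTree f src d₀ A (τ.real distArr j src) (τ.nat parArr j src) ∧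
    (m < A.card ∨ A = Finset.univ) ∧
    (∀ a b : ℕ, (a ≠ j ∨ b ≠ src) → τ.real distArr a b = σ.real distArr a b) ∧
    ∀ a b : ℕ, (a ≠ j ∨ b ≠ src) → τ.nat parArr a b = σ.nat parArr a b

/-- If no leaving edge is found, connectivity shows that all vertices are reached. Otherwise the
edge found is of minimum length, and `PartialTree.extend` applies. -/
theorem growRound_run {e₁ e₂ : RExp} {σ τ : State} {f : ℝ → ℕ → ℕ → ℝ} {j : ℕ} {src : Fin I.n}
    {d₀ : ℝ} {m : ℕ} (hf : ∀ e u x, e ≤ f e u x) (hj : τ.nat slotVar 0 0 0 = j)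
    (hsrc : τ.nat srcVar 0 0 0 = src) (he : IsKey I e₁ e₂ f j src τ)
    (h : GrowState f j src d₀ σ m τ) :
    Run I (growRound e₁ e₂) τ (1000 * (I.n * (I.n * (e₁.cost + 2 * e₂.cost + 200))))
      (GrowState f j src d₀ σ (m + 1)) := by
  obtain ⟨A, hA, hT, hm, hd, hp⟩ := h
  have hB : 5 + (900 * (I.n * (I.n * (e₁.cost + 2 * e₂.cost + 200))) + growExtend.cost) ≤
      1000 * (I.n * (I.n * (e₁.cost + 2 * e₂.cost + 200))) := by
    have h1 := I.n_pos
    have h2 : growExtend.cost ≤ 80 := by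
      simp [growExtend, Cmd.cost, BExp.cost, RExp.cost, NExp.cost]
    have h3 : e₁.cost + 2 * e₂.cost + 200 ≤ I.n * (I.n * (e₁.cost + 2 * e₂.cost + 200)) := by
      nlinarith [Nat.mul_le_mul h1 h1]
    omega
  refine (Run.seq ((Run.loopFree (c := .assign foundVar (.lit 0)) trivial ?_).bound
    (B' := 5) le_rfl)).bound hB
  refine Run.seq ((growSearch_run (A := A) (f := f) (j := j) (src := src) ?_ ?_ ?_).mono le_rfl
    fun ρ hρ hbest => ?_)
  · simpa [Cmd.result, NExp.val] using hA
  · exact he.congr (by simp [Cmd.result]) (by simp [Cmd.result]) (by simp [Cmd.result])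
  · simp [Cmd.result, NExp.val]
  have h5 : ρ.nat doneArr = τ.nat doneArr := by
    rw [hρ.nat _ (by simp [growSearch, growScan, Cmd.forVerts, Cmd.natWrites])]
    simp [Cmd.result]
  have h4 : ρ.nat parArr = τ.nat parArr := by
    rw [hρ.nat _ (by simp [growSearch, growScan, Cmd.forVerts, Cmd.natWrites])]
    simp [Cmd.result]
  have h6 : ρ.nat slotVar = τ.nat slotVar := by
    rw [hρ.nat _ (by simp [growSearch, growScan, Cmd.forVerts, Cmd.natWrites])]
    simp [Cmd.result]
  have h7 : ρ.nat srcVar = τ.nat srcVar := by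
    rw [hρ.nat _ (by simp [growSearch, growScan, Cmd.forVerts, Cmd.natWrites])]
    simp [Cmd.result]
  have hr1 : ρ.real distArr = τ.real distArr := by
    rw [hρ.real _ (by simp [growSearch, growScan, Cmd.forVerts, Cmd.realWrites])]
    simp [Cmd.result]
  refine Run.loopFree (by simp [growExtend, Cmd.LoopFree]) ?_
  unfold growExtend
  rcases hbest with ⟨hfound, hno⟩ | ⟨hfound, hcr, hval, hmin⟩
  · rw [Cmd.result_ite_neg (by simp [BExp.Holds, NExp.val, hfound])]
    refine ⟨A, by simpa [Cmd.result, h5] using hA, by simpa [Cmd.result, h4, hr1] using hT,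
      Or.inr ?_, by simpa [Cmd.result, hr1] using hd, by simpa [Cmd.result, h4] using hp⟩
    by_contra hne
    obtain ⟨u, hu, x, hx, hux⟩ := PriorityNWST.PartialTree.exists_boundary hne hT.src_mem
    exact hno (u, x) (by simp) ⟨u.2, x.2, hu, hx, hux⟩
  · rw [Cmd.result_ite_pos (by simp [BExp.Holds, NExp.val, hfound])]
    obtain ⟨hu, hx, huA, hxA, hux⟩ := hcr
    dsimp only at hu hx huA hxA hux hval
    obtain ⟨u, hu'⟩ : ∃ u : Fin I.n, u = ⟨ρ.nat bestU 0 0 0, hu⟩ := ⟨_, rfl⟩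
    obtain ⟨x, hx'⟩ : ∃ x : Fin I.n, x = ⟨ρ.nat bestX 0 0 0, hx⟩ := ⟨_, rfl⟩
    rw [← hu'] at huA hux
    rw [← hx'] at hxA hux
    have hu12 : ρ.nat bestU 0 0 0 = u := by rw [hu']
    have hx13 : ρ.nat bestX 0 0 0 = x := by rw [hx']
    rw [hu12, hx13] at hval
    simp only [Cmd.result, NExp.val, RExp.val, State.setReal_nat, h6, h7, hj, hsrc, hx13,
      State.setNat_nat_of_ne, ne_eq, Nat.reduceEqDiff, not_false_eq_true, hu12, ← hval]
    refine ⟨insert x A, ?_, ?_, ?_, ?_, ?_⟩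
    · intro y
      rw [Finset.mem_insert, ← hA y]
      by_cases hyx : y = x
      · simp [hyx]
      · simp [hyx, h5, Fin.val_inj]
    · refine hT.extend hf huA hxA hux ?_ ?_ ?_ ?_ ?_
      · intro v hv y hy hvy
        have := hmin (v, y) (by simp) ⟨v.2, y.2, hv, hy, hvy⟩
        rw [← hval] at this
        simpa [Cmd.result] using this
      · simp
      · simp
      · intro y hy
        simp [Fin.val_inj, hy, hr1]
      · intro y hy
        simp [Fin.val_inj, hy, h4]
    · rcases hm with hm | hm
      · left
        rw [Finset.card_insert_of_notMem hxA]
        omega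
      · exact absurd (hm ▸ Finset.mem_univ x) hxA
    · intro a b hab
      rw [← hd a b hab]
      funext l
      have : ¬ (a = j ∧ b = src ∧ l = x) := by tauto
      simp [this, hr1]
    · intro a b hab
      rw [← hp a b hab]
      funext l
      have : ¬ (a = j ∧ b = src ∧ l = x) := by tauto
      simp [this, h4]

/-- After m rounds more than m vertices are reached unless all are, so n rounds suffice. The other
parts of the tables are left intact, which allows them to be filled one after the other. -/
theorem grow_run {e₁ e₂ : RExp} {σ : State} {f : ℝ → ℕ → ℕ → ℝ} {j : ℕ} {src : Fin I.n}
    (hf : ∀ e u x, e ≤ f e u x) (hj : σ.nat slotVar 0 0 0 = j)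
    (hsrc : σ.nat srcVar 0 0 0 = src) (he : IsKey I e₁ e₂ f j src σ) :
    Run I (grow e₁ e₂) σ (40000 * (I.n * (I.n * (I.n * (e₁.cost + 2 * e₂.cost + 200))))) fun τ =>
      I.PartialTree f src (σ.real distArr j src src) Finset.univ (τ.real distArr j src)
        (τ.nat parArr j src) ∧
      (∀ a b : ℕ, (a ≠ j ∨ b ≠ src) → τ.real distArr a b = σ.real distArr a b) ∧
      ∀ a b : ℕ, (a ≠ j ∨ b ≠ src) → τ.nat parArr a b = σ.nat parArr a b := by
  have h1 := I.n_pos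
  set K := e₁.cost + 2 * e₂.cost + 200 with hK
  have hinit : Run I growInit σ (1000 * I.n)
      fun τ => GrowState f j src (σ.real distArr j src src) σ 0 τ := by
    unfold growInit
    refine (Run.seq (B := 30 * (I.n * 20)) (B' := 100) ((Run.forVerts_const (I := I)
      (c := .setCell doneArr (.var xVar) (.lit 0)) (by simp [Cmd.natWrites])
      (fun m τ => ∀ x, x < m → τ.nat doneArr x 0 0 = 0) (by omega)
      (by simp) (by intro m τ x h; simpa using h) ?_).mono le_rfl fun τ hτ hI =>
        (Run.loopFree (by simp [Cmd.LoopFree]) ?_).bound ?_)).bound (by omega)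
    · intro m _ τ _ hτm hI
      refine (Run.loopFree (by simp [Cmd.LoopFree]) ?_).bound (by simp [Cmd.cost, NExp.cost])
      intro x hx
      by_cases hxm : x = m
      · simp [Cmd.result, NExp.val, hτm, hxm]
      · simpa [Cmd.result, NExp.val, hτm, hxm] using hI x (by omega)
    · have h6 : τ.nat slotVar = σ.nat slotVar := hτ.nat _ (by simp [Cmd.forVerts, Cmd.natWrites])
      have h7 : τ.nat srcVar = σ.nat srcVar := hτ.nat _ (by simp [Cmd.forVerts, Cmd.natWrites])
      have h4 : τ.nat parArr = σ.nat parArr := hτ.nat _ (by simp [Cmd.forVerts, Cmd.natWrites])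
      have hr1 : τ.real distArr = σ.real distArr :=
        hτ.real _ (by simp [Cmd.forVerts, Cmd.realWrites])
      simp only [Cmd.result, NExp.val, h7, hsrc, h6, hj, State.setNat_nat_of_ne, ne_eq,
        Nat.reduceEqDiff, not_false_eq_true]
      refine ⟨{src}, ?_, ⟨by simp, by simp, by simp [hr1], ⟨fun _ => 0, by simp, ?_⟩, ?_, ?_⟩,
        by simp, by simp [hr1], ?_⟩
      · intro x
        by_cases hx : x = src
        · simp [hx]
        · simp [hx, Fin.val_inj, hI x x.2]
      · intro x hx hne
        exact absurd (Finset.mem_singleton.1 hx) hne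
      · intro u hu x hx hux
        rw [Finset.mem_singleton] at hu hx
        exact absurd (hu.trans hx.symm) hux.ne
      · intro u hu x hx y _ _
        rw [Finset.mem_singleton] at hu hx
        rw [hu, hx]
        exact hf _ _ _
      · intro a b hab
        funext l
        have : ¬ (a = j ∧ b = src ∧ l = src) := by tauto
        rw [State.setNat_nat_self, if_neg this, State.setNat_nat_of_ne _ _ _ _ _ (by simp), h4]
    · simp [Cmd.cost, NExp.cost]
  unfold grow
  have hB : 1000 * I.n + 30 * (I.n * (1000 * (I.n * (I.n * K)))) ≤
      40000 * (I.n * (I.n * (I.n * K))) := by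
    have h2 : 200 ≤ I.n * (I.n * K) := by nlinarith [Nat.mul_le_mul h1 h1]
    nlinarith
  refine (Run.seq (hinit.mono le_rfl fun τ hτ hI => ?_)).bound hB
  have h6 : τ.nat slotVar = σ.nat slotVar :=
    hτ.nat _ (by simp [growInit, Cmd.forVerts, Cmd.natWrites])
  have h7 : τ.nat srcVar = σ.nat srcVar :=
    hτ.nat _ (by simp [growInit, Cmd.forVerts, Cmd.natWrites])
  have h0 : τ.real rateArr = σ.real rateArr :=
    hτ.real _ (by simp [growInit, Cmd.forVerts, Cmd.realWrites])
  refine (Run.forVerts_const (I := I) (c := growRound e₁ e₂)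
    (by simp [growRound, growSearch, growScan, growExtend, Cmd.forVerts, Cmd.natWrites])
    (GrowState f j src (σ.real distArr j src src) σ) (by nlinarith) hI ?_ ?_).mono le_rfl
    fun ρ _ hρ => ?_
  · rintro m ρ x ⟨A, h⟩
    exact ⟨A, by simpa using h⟩
  · intro m _ ρ hρ _ hI
    have h6' : ρ.nat slotVar = τ.nat slotVar := hρ.nat _ (by
      simp [growRound, growSearch, growScan, growExtend, Cmd.forVerts, Cmd.natWrites])
    have h7' : ρ.nat srcVar = τ.nat srcVar := hρ.nat _ (by
      simp [growRound, growSearch, growScan, growExtend, Cmd.forVerts, Cmd.natWrites])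
    have h0' : ρ.real rateArr = τ.real rateArr := hρ.real _ (by
      simp [growRound, growSearch, growScan, growExtend, Cmd.forVerts, Cmd.realWrites])
    exact growRound_run hf (by rw [h6', h6, hj]) (by rw [h7', h7, hsrc])
      (he.congr (h6'.trans h6) (h7'.trans h7) (h0'.trans h0)) hI
  · obtain ⟨A, _, hT, hcard, hd, hp⟩ := hρ
    have hA : A = Finset.univ := by
      rcases hcard with h | h
      · have := Finset.card_le_univ A
        rw [Fintype.card_fin] at this
        omega
      · exact h
    subst hA
    exact ⟨hT, hd, hp⟩

end RealRAM

namespace PriorityNWST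

variable {I : PriorityNWST}

/-! ### The tree of widest paths -/

/-- The extension of paths in the computation of paths of largest minimum rate: the length of a path
is the negative of the minimum rate. -/
def wideStep (r : ℕ → ℝ) (d : ℝ) (_ x : ℕ) : ℝ := max d (0 - r x)

/-- The tree with the parents `pa`. -/
def parentTree {f : ℝ → ℕ → ℕ → ℝ} {src : Fin I.n} {d₀ : ℝ} {d : ℕ → ℝ} {pa : ℕ → ℕ}
    (h : I.PartialTree f src d₀ Finset.univ d pa) : I.G.Subgraph where
  verts := Set.univ
  Adj u v := u ≠ v ∧ (pa v = u ∨ pa u = v)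
  adj_sub := by
    obtain ⟨_, _, ht⟩ := h.tree
    have key : ∀ {u v : Fin I.n}, u ≠ v → pa v = u → I.G.Adj u v := by
      intro u v hne huv
      have hv : v ≠ src := by
        rintro rfl
        exact hne (Fin.ext (huv.symm.trans h.par_src))
      obtain ⟨w, _, hw, hadj, _⟩ := ht v (Finset.mem_univ _) hv
      obtain rfl : u = w := Fin.ext (huv.symm.trans hw)
      exact hadj
    rintro u v ⟨hne, huv | huv⟩
    · exact key hne huv
    · exact (key hne.symm huv).symm
  edge_vert _ := Set.mem_univ _
  symm := ⟨fun _ _ h => ⟨h.1.symm, h.2.symm⟩⟩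

namespace PartialTree

variable {f : ℝ → ℕ → ℕ → ℝ} {src : Fin I.n} {d₀ : ℝ} {d : ℕ → ℝ} {pa : ℕ → ℕ}

/-- The graph is connected by the paths of parents, and it has at most n - 1 edges because every
edge joins a vertex other than the source to its parent. -/
theorem parentTree_isTree (h : I.PartialTree f src d₀ Finset.univ d pa) :
    (parentTree h).coe.IsTree := by
  have hconn : (parentTree h).coe.Connected := by
    have key : ∀ x : Fin I.n, (parentTree h).coe.Reachable ⟨src, Set.mem_univ _⟩
        ⟨x, Set.mem_univ _⟩ := by
      intro x
      obtain ⟨_, _, _, _, hx⟩ := h.exists_path (motive := fun x _ =>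
        (parentTree h).coe.Reachable ⟨src, Set.mem_univ _⟩ ⟨x, Set.mem_univ _⟩)
        (SimpleGraph.Reachable.refl _)
        (by
          intro u x _ hux hp _ hu
          refine hu.trans (SimpleGraph.Adj.reachable ?_)
          exact ⟨hux.ne, Or.inl hp⟩) x
      exact hx
    have : Nonempty (parentTree h).verts := ⟨⟨src, Set.mem_univ _⟩⟩
    exact ⟨fun x y => (key x).symm.trans (key y)⟩
  refine SimpleGraph.isTree_iff_connected_and_card.2 ⟨hconn, le_antisymm ?_
    hconn.card_vert_le_card_edgeSet_add_one⟩
  obtain ⟨_, _, ht⟩ := h.tree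
  choose! p _ hp hadj _ _ using fun x => ht x (Finset.mem_univ x)
  have hsurj : Function.Surjective (fun x : {x : Fin I.n // x ≠ src} =>
      (⟨s(⟨x, Set.mem_univ _⟩, ⟨p x, Set.mem_univ _⟩),
        ⟨(hadj x x.2).ne.symm, Or.inr (hp x x.2)⟩⟩ : (parentTree h).coe.edgeSet)) := by
    have key : ∀ u v : Fin I.n, u ≠ v → pa v = u → v ≠ src ∧ p v = u := by
      intro u v hne huv
      have hv : v ≠ src := by
        rintro rfl
        exact hne (Fin.ext (huv.symm.trans h.par_src))
      exact ⟨hv, Fin.ext ((hp v hv).symm.trans huv)⟩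
    rintro ⟨e, he⟩
    induction e with
    | h u v =>
      obtain ⟨hne, huv | huv⟩ := he
      · obtain ⟨h1, h2⟩ := key u v hne huv
        refine ⟨⟨v, h1⟩, Subtype.ext ?_⟩
        simp only [h2]
        exact Sym2.eq_swap
      · obtain ⟨h1, h2⟩ := key v u (Ne.symm hne) huv
        refine ⟨⟨u, h1⟩, Subtype.ext ?_⟩
        simp only [h2]
  have h1 : Nat.card (parentTree h).coe.edgeSet ≤ Nat.card {x : Fin I.n // x ≠ src} :=
    Nat.card_le_card_of_surjective _ hsurj
  have h2 : Nat.card {x : Fin I.n // x ≠ src} = I.n - 1 := by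
    simp [Nat.card_eq_fintype_card]
  have h3 : Nat.card (parentTree h).verts = I.n := by
    change Nat.card (Set.univ : Set (Fin I.n)) = I.n
    simp
  have := I.s.pos
  omega

/-- A walk from s to t whose rates are at least P(t) forces d(t) ≤ -P(t) by relaxation. The length
of the tree path to t is the largest of -P(s) and the negated rates after s, so every rate on it is
at least P(t). -/
theorem parentTree_isPNWST {R : Fin I.n → ℝ≥0} {r : ℕ → ℝ} (hr : ∀ x : Fin I.n, r x = R x)
    (hR : I.Feasible R)
    (h : I.PartialTree (wideStep r) I.s (0 - (I.P I.s : ℝ)) Finset.univ d pa) :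
    I.IsPNWST (parentTree h) R := by
  refine ⟨h.parentTree_isTree, Set.mem_univ _, fun t ht => ?_⟩
  have hle : ∀ (u x : Fin I.n) (p : I.G.Walk u x), (∀ y ∈ p.support, I.P t ≤ R y) →
      d u ≤ 0 - (I.P t : ℝ) → d x ≤ 0 - (I.P t : ℝ) := by
    intro u x p
    induction p with
    | nil => exact fun _ h => h
    | @cons u v w huv p ih =>
      intro hy hu
      refine ih (fun y hy' => hy y (by simp [hy'])) ?_
      refine (h.relaxed u (Finset.mem_univ _) v (Finset.mem_univ _) huv).trans (max_le hu ?_)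
      rw [hr]
      have : (I.P t : ℝ) ≤ R v := by exact_mod_cast hy v (by simp)
      linarith
  have hts : (I.P t : ℝ) ≤ I.P I.s := by
    exact_mod_cast I.prio_le_source (Finset.mem_insert_of_mem ht)
  obtain ⟨q, hq⟩ := hR.2 t ht
  have hdt := hle _ _ q hq (by rw [h.dist_src]; linarith)
  obtain ⟨p, hp, _, _, h1, h2⟩ := h.exists_path (motive := fun x p =>
    p.toSubgraph ≤ parentTree h ∧ (d x ≤ 0 - (I.P t : ℝ) → ∀ y ∈ p.support, I.P t ≤ R y))
    ⟨by simp [parentTree], fun _ y hy => by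
      rw [SimpleGraph.Walk.support_nil, List.mem_singleton] at hy
      rw [hy]
      exact (I.prio_le_source (Finset.mem_insert_of_mem ht)).trans (hR.1 _)⟩
    (by
      rintro u x p hux hpa hdx ⟨ih1, ih2⟩
      constructor
      · rw [SimpleGraph.Walk.concat_eq_append, SimpleGraph.Walk.toSubgraph_append]
        refine sup_le ih1 ?_
        have hadj : (parentTree h).Adj u x := ⟨hux.ne, Or.inl hpa⟩
        exact sup_le (SimpleGraph.subgraphOfAdj_le_of_adj _ hadj) (by simp [parentTree])
      · intro hle y hy
        rw [hdx, wideStep, max_le_iff, hr] at hle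
        rw [SimpleGraph.Walk.support_concat, List.mem_append, List.mem_singleton] at hy
        rcases hy with hy | rfl
        · exact ih2 hle.1 y hy
        · have := hle.2
          have : (I.P t : ℝ) ≤ R y := by linarith
          exact_mod_cast this) t
  exact ⟨p, hp, h1, h2 hdt⟩

end PartialTree

end PriorityNWST

namespace RealRAM

variable {I : PriorityNWST}

/-! ### The output -/

/-- Equality of natural numbers. -/
abbrev BExp.eqNat (e f : NExp) : BExp := .and (.leNat e f) (.leNat f e)

/-- Writes the vertices and the edges of the tree in the part `slotVar, srcVar` of `parArr`. -/
def outputRow : Cmd :=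
  .seq (.setCell vertsArr (.var uVar) (.lit 1))
    (.forVerts xVar
      (.ite (.and (.not (.eqNat (.var uVar) (.var xVar)))
          (.not (.and
            (.not (.eqNat (.get parArr (.var slotVar) (.var srcVar) (.var xVar)) (.var uVar)))
            (.not (.eqNat (.get parArr (.var slotVar) (.var srcVar) (.var uVar)) (.var xVar))))))
        (.setNat adjArr (.var uVar) (.var xVar) (.lit 0) (.lit 1))
        (.setNat adjArr (.var uVar) (.var xVar) (.lit 0) (.lit 0))))

def outputTree : Cmd := .forVerts uVar outputRow

theorem outputTree_run {σ : State} {pa : ℕ → ℕ}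
    (hpa : σ.nat parArr (σ.nat slotVar 0 0 0) (σ.nat srcVar 0 0 0) = pa) :
    Run I outputTree σ (200000 * (I.n * I.n)) fun τ => ∀ u < I.n, τ.nat vertsArr u 0 0 = 1 ∧
      ∀ x < I.n, τ.nat adjArr u x 0 ≠ 0 ↔ u ≠ x ∧ (pa x = u ∨ pa u = x) := by
  have hn := I.n_pos
  have hB : 30 * (I.n * (10 + 30 * (I.n * 200))) ≤ 200000 * (I.n * I.n) := by nlinarith
  refine (Run.forVerts_const (c := outputRow)
    (by simp [outputRow, Cmd.forVerts, Cmd.natWrites])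
    (fun m τ => ∀ u < m, τ.nat vertsArr u 0 0 = 1 ∧
      ∀ x < I.n, τ.nat adjArr u x 0 ≠ 0 ↔ u ≠ x ∧ (pa x = u ∨ pa u = x))
    (by nlinarith) (by simp) (by intro m τ x h; simpa using h) ?_).bound hB
  intro m hm τ hτ hτm hI
  unfold outputRow
  refine Run.seq ((Run.loopFree (c := .setCell vertsArr (.var uVar) (.lit 1))
    (by simp [Cmd.LoopFree]) ?_).bound (B' := 10) ?_)
  swap
  · simp [Cmd.cost, NExp.cost]
  have hpaτ : τ.nat parArr (τ.nat slotVar 0 0 0) (τ.nat srcVar 0 0 0) = pa := by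
    rw [← hpa, hτ.nat parArr (by simp [outputRow, Cmd.forVerts, Cmd.natWrites]),
      hτ.nat slotVar (by simp [outputRow, Cmd.forVerts, Cmd.natWrites]),
      hτ.nat srcVar (by simp [outputRow, Cmd.forVerts, Cmd.natWrites])]
  set τ₁ := Cmd.result I (.setCell vertsArr (.var uVar) (.lit 1)) τ with hτ₁
  refine (Run.forVerts_const (σ := τ₁) (B := 200) (by simp [Cmd.natWrites])
    (fun l ρ => (∀ u < m, ∀ x < I.n, ρ.nat adjArr u x 0 ≠ 0 ↔ u ≠ x ∧ (pa x = u ∨ pa u = x)) ∧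
      ∀ x < l, ρ.nat adjArr m x 0 ≠ 0 ↔ m ≠ x ∧ (pa x = m ∨ pa m = x)) (by omega) ?_
      (by intro l ρ x h; simpa using h) ?_).mono le_rfl ?_
  · refine ⟨fun u hu x hx => ?_, by simp⟩
    rw [← (hI u hu).2 x hx]
    simp [hτ₁, Cmd.result]
  · intro x hx ρ hρ hρx hI'
    refine (Run.loopFree (by simp [Cmd.LoopFree]) ?_).bound
      (by simp [Cmd.cost, NExp.cost, BExp.cost])
    have h9 : ρ.nat uVar 0 0 0 = m := by
      rw [hρ.nat _ (by simp [Cmd.forVerts, Cmd.natWrites]), ← hτm]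
      simp [hτ₁, Cmd.result]
    have hpaρ : ρ.nat parArr (ρ.nat slotVar 0 0 0) (ρ.nat srcVar 0 0 0) = pa := by
      rw [← hpaτ, hρ.nat parArr (by simp [Cmd.forVerts, Cmd.natWrites]),
        hρ.nat slotVar (by simp [Cmd.forVerts, Cmd.natWrites]),
        hρ.nat srcVar (by simp [Cmd.forVerts, Cmd.natWrites])]
      simp [hτ₁, Cmd.result]
    -- Tests have no disjunction; the program expresses it by De Morgan's law.
    have hcond : BExp.Holds I ρ (.and (.not (.eqNat (.var uVar) (.var xVar)))
          (.not (.and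
            (.not (.eqNat (.get parArr (.var slotVar) (.var srcVar) (.var xVar)) (.var uVar)))
            (.not (.eqNat (.get parArr (.var slotVar) (.var srcVar) (.var uVar)) (.var xVar)))))) ↔
        m ≠ x ∧ (pa x = m ∨ pa m = x) := by
      simp only [BExp.Holds, NExp.val, h9, hρx, hpaρ, ← le_antisymm_iff]
      tauto
    by_cases hc : m ≠ x ∧ (pa x = m ∨ pa m = x)
    · rw [Cmd.result_ite_pos (hcond.2 hc)]
      refine ⟨fun u hu y hy => ?_, fun y hy => ?_⟩
      · rw [← hI'.1 u hu y hy]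
        simp [Cmd.result, NExp.val, h9, hu.ne]
      · by_cases hyx : y = x
        · subst hyx
          simpa [Cmd.result, NExp.val, h9, hρx] using hc
        · rw [← hI'.2 y (by omega)]
          simp [Cmd.result, NExp.val, hρx, hyx]
    · rw [Cmd.result_ite_neg (hcond.not.2 hc)]
      refine ⟨fun u hu y hy => ?_, fun y hy => ?_⟩
      · rw [← hI'.1 u hu y hy]
        simp [Cmd.result, NExp.val, h9, hu.ne]
      · by_cases hyx : y = x
        · subst hyx
          simpa [Cmd.result, NExp.val, h9, hρx] using hc
        · rw [← hI'.2 y (by omega)]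
          simp [Cmd.result, NExp.val, hρx, hyx]
  · rintro ρ hρ ⟨h1, h2⟩ u hu
    have h0 : ρ.nat vertsArr = τ₁.nat vertsArr :=
      hρ.nat _ (by simp [Cmd.forVerts, Cmd.natWrites])
    rcases Nat.lt_succ_iff_lt_or_eq.1 hu with hu | rfl
    · refine ⟨?_, h1 u hu⟩
      rw [h0]
      simpa [hτ₁, Cmd.result, NExp.val, hτm, hu.ne] using (hI u hu).1
    · refine ⟨?_, h2⟩
      rw [h0]
      simp [hτ₁, Cmd.result, NExp.val, hτm]

/-- Builds the tree of widest paths for the current rates and writes it to the output. -/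
def finish : Cmd :=
  .seq (.seq (.assign slotVar .numVerts) (.seq (.assign srcVar .source)
      (.setReal distArr (.var slotVar) (.var srcVar) (.var srcVar)
        (.sub (.ofNat (.lit 0)) (.prio .source)))))
    (.seq (grow (.get distArr (.var slotVar) (.var srcVar) (.var uVar))
      (.sub (.ofNat (.lit 0)) (.get rateArr (.var xVar) (.lit 0) (.lit 0)))) outputTree)

theorem finish_run {σ : State} {R : Fin I.n → ℝ≥0}
    (hσ : ∀ v : Fin I.n, σ.real rateArr v 0 0 = R v) (hR : I.Feasible R) :
    Run I finish σ (10000000 * (I.n * (I.n * I.n)))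
      fun τ => ∃ H : I.G.Subgraph, τ.Holds H R ∧ I.IsPNWST H R := by
  have hn := I.n_pos
  -- The number 233 is 13 + 2 · 10 + 200, from the costs of the two length expressions.
  have hB : 100 + (40000 * (I.n * (I.n * (I.n * 233))) + 200000 * (I.n * I.n)) ≤
      10000000 * (I.n * (I.n * I.n)) := by
    have h1 : I.n * I.n ≤ I.n * (I.n * I.n) := Nat.le_mul_of_pos_left _ hn
    have h2 : 1 ≤ I.n * (I.n * I.n) := Nat.mul_pos hn (Nat.mul_pos hn hn)
    have h3 : I.n * (I.n * (I.n * 233)) = 233 * (I.n * (I.n * I.n)) := by ring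
    rw [h3]
    omega
  refine (Run.seq (B := 100) ((Run.loopFree (by simp [Cmd.LoopFree]) ?_).bound
    (by simp [Cmd.cost, NExp.cost, RExp.cost]))).bound hB
  set τ := Cmd.result I (.seq (.assign slotVar .numVerts) (.seq (.assign srcVar .source)
      (.setReal distArr (.var slotVar) (.var srcVar) (.var srcVar)
        (.sub (.ofNat (.lit 0)) (.prio .source))))) σ with hτ
  have h6 : τ.nat slotVar 0 0 0 = I.n := by simp [hτ, Cmd.result, NExp.val]
  have h7 : τ.nat srcVar 0 0 0 = I.s := by simp [hτ, Cmd.result, NExp.val]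
  have h0 : τ.real rateArr = σ.real rateArr := by simp [hτ, Cmd.result]
  have hd : τ.real distArr I.n I.s I.s = 0 - (I.P I.s : ℝ) := by
    simp [hτ, Cmd.result, NExp.val, RExp.val]
  refine Run.seq ((grow_run (f := PriorityNWST.wideStep fun x => σ.real rateArr x 0 0)
    (fun e u x => le_max_left _ _) h6 h7 ⟨?_, ?_⟩).mono le_rfl ?_)
  · intro ρ h1 h2 h3
    simp only [RExp.val, NExp.val, PriorityNWST.wideStep, h1, h2, h3, h6, h7, h0, Nat.cast_zero]
  · intro ρ y
    simp [RExp.val, NExp.val]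
  · rintro ρ hρ ⟨hT, _, _⟩
    rw [hd] at hT
    have h6' : ρ.nat slotVar = τ.nat slotVar := hρ.nat _ (by
      simp [grow, growInit, growRound, growSearch, growScan, growExtend, Cmd.forVerts,
        Cmd.natWrites])
    have h7' : ρ.nat srcVar = τ.nat srcVar := hρ.nat _ (by
      simp [grow, growInit, growRound, growSearch, growScan, growExtend, Cmd.forVerts,
        Cmd.natWrites])
    have h0' : ρ.real rateArr = τ.real rateArr := hρ.real _ (by
      simp [grow, growInit, growRound, growSearch, growScan, growExtend, Cmd.forVerts,
        Cmd.realWrites])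
    refine (outputTree_run (pa := ρ.nat parArr I.n I.s) (by rw [h6', h7', h6, h7])).mono le_rfl
      fun ρ' hρ' h => ⟨PriorityNWST.parentTree hT, ⟨fun v => ?_, fun u v => ?_, fun v => ?_⟩,
        hT.parentTree_isPNWST hσ hR⟩
    · simp [(h v v.2).1, PriorityNWST.parentTree]
    · rw [(h u u.2).2 v v.2]
      simp [PriorityNWST.parentTree, Fin.val_inj]
    · rw [hρ'.real _ (by simp [outputTree, outputRow, Cmd.forVerts, Cmd.realWrites]), h0', h0, hσ]

end RealRAM

/-! ### Existence of a tree for feasible rates -/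

namespace PriorityNWST

/-- The verified program proves this purely combinatorial fact: `finish` is run on a memory that
already holds the rates. -/
theorem Feasible.exists_isPNWST {I : PriorityNWST} {R : Fin I.n → ℝ≥0} (h : I.Feasible R) :
    ∃ H : I.G.Subgraph, I.IsPNWST H R := by
  obtain ⟨_, _, _, _, H, _, hH⟩ := RealRAM.finish_run
    (σ := ⟨fun _ _ _ _ => 0, fun _ v _ _ => if h : v < I.n then (R ⟨v, h⟩ : ℝ) else 0⟩)
    (by simp) h
  exact ⟨H, hH⟩

end PriorityNWST

/-! ### Representatives of the priorities -/

namespace PriorityNWST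

variable {I : PriorityNWST}

/-- `rep` chooses a common terminal for the vertices of the same priority: the terminal with the
largest number. -/
def IsRepMap (I : PriorityNWST) (rep : ℕ → ℕ) : Prop :=
  ∀ x : Fin I.n, ∀ u ∈ I.T, I.P u = I.P x → ∃ ρ ∈ I.T, rep x = ρ ∧ I.P ρ = I.P x ∧ u ≤ ρ

/-- `m` is a terminal that represents its priority. -/
def IsRep (I : PriorityNWST) (rep : ℕ → ℕ) (m : ℕ) : Prop :=
  (∃ h : m < I.n, (⟨m, h⟩ : Fin I.n) ∈ I.T) ∧ rep m = m

/-- The source is included because its priority is attained by a terminal. The representative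
represents itself, since taking the largest number makes it depend on the priority only. -/
theorem IsRepMap.rep_spec {rep : ℕ → ℕ} (h : I.IsRepMap rep) {x : Fin I.n}
    (hx : x ∈ insert I.s I.T) (hT : I.T.Nonempty) :
    ∃ ρ : Fin I.n, rep x = ρ ∧ I.P ρ = I.P x ∧ I.IsRep rep ρ := by
  obtain ⟨u, hu, hux⟩ : ∃ u ∈ I.T, I.P u = I.P x := by
    rcases Finset.mem_insert.1 hx with rfl | hx
    · obtain ⟨u, hu, h⟩ := Finset.exists_mem_eq_sup I.T hT I.P
      exact ⟨u, hu, by rw [I.prio_source, h]⟩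
    · exact ⟨x, hx, rfl⟩
  obtain ⟨ρ, hρ, h1, h2, _⟩ := h x u hu hux
  refine ⟨ρ, h1, h2, ⟨ρ.2, hρ⟩, ?_⟩
  obtain ⟨ρ', hρ', h3, h4, h5⟩ := h ρ ρ hρ rfl
  obtain ⟨ρ'', hρ'', h6, _, h7⟩ := h x ρ' hρ' (h4.trans h2)
  rw [h1] at h6
  rw [h3]
  have : ρ = ρ'' := Fin.ext h6
  subst this
  exact congrArg _ (le_antisymm h7 h5)

open Classical in
-- Distinct representatives have distinct priorities. Hence loops over representatives run their
-- bodies at most k times.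
theorem IsRepMap.card_le {rep : ℕ → ℕ} (h : I.IsRepMap rep) :
    ((Finset.range I.n).filter (I.IsRep rep)).card ≤ I.k := by
  refine Finset.card_le_card_of_injOn (fun m => if h : m < I.n then I.P ⟨m, h⟩ else 0) ?_ ?_
  · intro m hm
    obtain ⟨⟨hm, hmT⟩, _⟩ := (Finset.mem_filter.1 hm).2
    simp only [hm, dite_true]
    exact Finset.mem_coe.2 (Finset.mem_image_of_mem _ hmT)
  · have key : ∀ m m', I.IsRep rep m → I.IsRep rep m' → ∀ (hm : m < I.n) (hm' : m' < I.n),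
        I.P ⟨m, hm⟩ = I.P ⟨m', hm'⟩ → m' ≤ m := by
      rintro m m' ⟨⟨_, hmT⟩, hr⟩ ⟨⟨_, hmT'⟩, _⟩ hm hm' heq
      obtain ⟨ρ, _, h1, _, h2⟩ := h ⟨m, hm⟩ ⟨m', hm'⟩ hmT' heq.symm
      calc m' ≤ ρ := h2
        _ = rep m := h1.symm
        _ = m := hr
    intro m hm m' hm' heq
    have h1 := (Finset.mem_filter.1 hm).2
    have h2 := (Finset.mem_filter.1 hm').2
    obtain ⟨hmn, _⟩ := h1.1
    obtain ⟨hmn', _⟩ := h2.1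
    simp only [hmn, hmn', dite_true] at heq
    exact le_antisymm (key m' m h2 h1 hmn' hmn heq.symm) (key m m' h1 h2 hmn hmn' heq)

end PriorityNWST

namespace RealRAM

variable {I : PriorityNWST}

/-- Repeats `c` with the scalar `a` running through the representatives of the priorities. -/
def Cmd.forReps (a : ℕ) (c : Cmd) : Cmd :=
  .forVerts a (.ite (.and (.isTerm (.var a)) (.eqNat (.cell repArr (.var a)) (.var a))) c .skip)

theorem Cmd.natWrites_forReps (a : ℕ) (c : Cmd) :
    (Cmd.forReps a c).natWrites = a :: (c.natWrites ++ [a]) := by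
  simp [Cmd.forReps, Cmd.forVerts, Cmd.natWrites]

theorem Cmd.realWrites_forReps (a : ℕ) (c : Cmd) :
    (Cmd.forReps a c).realWrites = c.realWrites := by
  simp [Cmd.forReps, Cmd.forVerts, Cmd.realWrites]

/-- The n tests, of 31 steps each, are absorbed into one extra B by the assumption n ≤ B, which
accounts for k + 1 in the bound. -/
theorem Run.forReps {a : ℕ} {c : Cmd} {σ : State} {rep : ℕ → ℕ} (ha : a ∉ c.natWrites)
    (har : a ≠ repArr) (hcr : repArr ∉ c.natWrites) (hrep : ∀ x, σ.nat repArr x 0 0 = rep x)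
    (hmap : I.IsRepMap rep) (Inv : ℕ → State → Prop) {B : ℕ} (hB : I.n ≤ B) (h0 : Inv 0 σ)
    (hset : ∀ m τ x, Inv m τ → Inv m (τ.setNat a 0 0 0 x))
    (hskip : ∀ m, m < I.n → ¬ I.IsRep rep m → ∀ τ, (Cmd.forReps a c).Frame σ τ → Inv m τ →
      Inv (m + 1) τ)
    (hstep : ∀ m, m < I.n → I.IsRep rep m → ∀ τ, (Cmd.forReps a c).Frame σ τ →
      τ.nat a 0 0 0 = m → Inv m τ → Run I c τ B (Inv (m + 1))) :
    Run I (.forReps a c) σ (100 * ((I.k + 1) * B)) (Inv I.n) := by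
  classical
  refine (Run.forVerts (by simpa [Cmd.natWrites] using ha) Inv
    (fun m => 31 + (1 + if I.IsRep rep m then B else 0)) h0 hset ?_).bound ?_
  · intro m hm τ hτ hτm hI
    have hr : τ.nat repArr = σ.nat repArr := hτ.nat _ (by
      simpa [Cmd.forVerts, Cmd.natWrites, har.symm] using hcr)
    have hcond : BExp.Holds I τ
        (.and (.isTerm (.var a)) (.eqNat (.cell repArr (.var a)) (.var a))) ↔ I.IsRep rep m := by
      simp only [BExp.Holds, NExp.val, hτm, hr, hrep, PriorityNWST.IsRep, ← le_antisymm_iff]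
    refine Run.ite (fun h => ?_) fun h => ?_
    · rw [hcond] at h
      rw [if_pos h]
      exact (hstep m hm h τ hτ hτm hI).bound (by omega)
    · rw [hcond] at h
      exact (Run.loopFree (c := .skip) trivial (hskip m hm h τ hτ hI)).bound
        (Nat.le_add_right 1 _)
  · have hn := I.n_pos
    have h1 := hmap.card_le
    have h2 : ∑ m ∈ Finset.range I.n, (31 + (1 + if I.IsRep rep m then B else 0) + 17) =
        49 * I.n + ((Finset.range I.n).filter (I.IsRep rep)).card * B := by
      simp only [Finset.sum_add_distrib, ← Finset.sum_filter, Finset.sum_const,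
        Finset.card_range, smul_eq_mul]
      ring
    rw [h2]
    have h3 : ((Finset.range I.n).filter (I.IsRep rep)).card * B ≤ I.k * B :=
      Nat.mul_le_mul_right _ h1
    nlinarith

/-! ### Preparations -/

/-- Computes the representatives of the priorities. -/
def setupReps : Cmd :=
  .forVerts xVar (.forVerts uVar
    (.ite (.and (.isTerm (.var uVar)) (.and (.leReal (.prio (.var uVar)) (.prio (.var xVar)))
        (.leReal (.prio (.var xVar)) (.prio (.var uVar)))))
      (.setCell repArr (.var xVar) (.var uVar)) .skip))

/-- Terminals are scanned in increasing order and later ones overwrite earlier ones, so the largest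
number of the same priority survives. -/
theorem setupReps_run (σ : State) : Run I setupReps σ (100000 * (I.n * I.n))
    fun τ => I.IsRepMap fun x => τ.nat repArr x 0 0 := by
  have hn := I.n_pos
  refine (Run.forVerts_const (by simp [Cmd.forVerts, Cmd.natWrites])
    (fun m τ => ∀ x : Fin I.n, x < m → ∀ u ∈ I.T, I.P u = I.P x → ∃ ρ ∈ I.T,
      τ.nat repArr x 0 0 = (ρ : ℕ) ∧ I.P ρ = I.P x ∧ u ≤ ρ) (B := 30 * (I.n * 100))
      (by nlinarith) (by simp) (by intro m τ x h; simpa using h) ?_).mono (by nlinarith)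
      fun τ _ h x => h x x.2
  intro m hm τ hτ hτm hI
  refine (Run.forVerts_const (by simp [Cmd.natWrites])
    (fun l τ => ∀ x : Fin I.n, (x < m → ∀ u ∈ I.T, I.P u = I.P x → ∃ ρ ∈ I.T,
      τ.nat repArr x 0 0 = (ρ : ℕ) ∧ I.P ρ = I.P x ∧ u ≤ ρ) ∧
      (x = m → ∀ u ∈ I.T, (u : ℕ) < l → I.P u = I.P x → ∃ ρ ∈ I.T,
      τ.nat repArr x 0 0 = (ρ : ℕ) ∧ I.P ρ = I.P x ∧ u ≤ ρ))
      (by omega) (fun x => ⟨hI x, by simp⟩) (by intro m τ x h; simpa using h) ?_).mono le_rfl ?_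
  · intro l hl ρ hρ hρl hI'
    refine (Run.loopFree (by simp [Cmd.LoopFree]) ?_).bound
      (by simp [Cmd.cost, NExp.cost, BExp.cost, RExp.cost])
    have h10 : ρ.nat xVar 0 0 0 = m := by
      rw [hρ.nat _ (by simp [Cmd.forVerts, Cmd.natWrites]), hτm]
    have hcond : BExp.Holds I ρ (.and (.isTerm (.var uVar))
        (.and (.leReal (.prio (.var uVar)) (.prio (.var xVar)))
        (.leReal (.prio (.var xVar)) (.prio (.var uVar))))) ↔
        (⟨l, hl⟩ : Fin I.n) ∈ I.T ∧ I.P ⟨l, hl⟩ = I.P ⟨m, hm⟩ := by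
      simp only [BExp.Holds, NExp.val, RExp.val, hρl, h10, hl, hm, dite_true, ← le_antisymm_iff,
        exists_true_left, NNReal.coe_inj]
    by_cases hc : (⟨l, hl⟩ : Fin I.n) ∈ I.T ∧ I.P ⟨l, hl⟩ = I.P ⟨m, hm⟩
    · rw [Cmd.result_ite_pos (hcond.2 hc)]
      refine fun x => ⟨fun hx => ?_, ?_⟩
      · simpa [Cmd.result, NExp.val, h10, hx.ne] using (hI' x).1 hx
      · rintro hx u hu hul hux
        obtain rfl : x = ⟨m, hm⟩ := Fin.ext hx
        exact ⟨⟨l, hl⟩, hc.1, by simp [Cmd.result, NExp.val, h10, hρl], hc.2,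
          Nat.lt_succ_iff.1 hul⟩
    · rw [Cmd.result_ite_neg (hcond.not.2 hc)]
      refine fun x => ⟨(hI' x).1, ?_⟩
      rintro hx u hu hul hux
      rcases Nat.lt_succ_iff_lt_or_eq.1 hul with hul | hul
      · exact (hI' x).2 hx u hu hul hux
      · obtain rfl : x = ⟨m, hm⟩ := Fin.ext hx
        obtain rfl : u = ⟨l, hl⟩ := Fin.ext hul
        exact absurd ⟨hu, hux⟩ hc
  · intro ρ _ h x hx
    rcases Nat.lt_succ_iff_lt_or_eq.1 hx with hx | hx
    · exact (h x).1 hx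
    · exact fun u hu => (h x).2 hx u hu u.2

/-- Sets the roots and the rates to their initial values. -/
def setupRoots : Cmd :=
  .seq (.forVerts xVar (.seq
      (.ite (.isTerm (.var xVar)) (.setCell aliveArr (.var xVar) (.lit 1))
        (.setCell aliveArr (.var xVar) (.lit 0)))
      (.setReal rateArr (.var xVar) (.lit 0) (.lit 0) (.prio (.var xVar)))))
    (.setCell aliveArr .source (.lit 1))

/-- The memory holds the set `M` of roots and the rates `R`. -/
def HoldsRoots (M : Finset (Fin I.n)) (R : Fin I.n → ℝ≥0) (τ : State) : Prop :=
  (∀ x : Fin I.n, 1 ≤ τ.nat aliveArr x 0 0 ↔ x ∈ M) ∧ ∀ x : Fin I.n, τ.real rateArr x 0 0 = R x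

theorem setupRoots_run (σ : State) :
    Run I setupRoots σ (10000 * I.n) (HoldsRoots (insert I.s I.T) I.P) := by
  have hn := I.n_pos
  refine (Run.seq (B := 30 * (I.n * 100)) (B' := 100) ((Run.forVerts_const
    (by simp [Cmd.natWrites])
    (fun m τ => ∀ x : Fin I.n, x < m → (1 ≤ τ.nat aliveArr x 0 0 ↔ x ∈ I.T) ∧
      τ.real rateArr x 0 0 = I.P x) (by omega) (by simp)
      (by intro m τ x h; simpa using h) ?_).mono le_rfl fun τ _ h => ?_)).bound (by omega)
  · intro m hm τ hτ hτm hI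
    refine (Run.loopFree (by simp [Cmd.LoopFree]) ?_).bound
      (by simp [Cmd.cost, NExp.cost, BExp.cost, RExp.cost])
    rw [Cmd.result_seq]
    have hcond : BExp.Holds I τ (.isTerm (.var xVar)) ↔ (⟨m, hm⟩ : Fin I.n) ∈ I.T := by
      simp only [BExp.Holds, NExp.val, hτm, hm, exists_true_left]
    by_cases hc : (⟨m, hm⟩ : Fin I.n) ∈ I.T
    · rw [Cmd.result_ite_pos (hcond.2 hc)]
      intro x hx
      rcases Nat.lt_succ_iff_lt_or_eq.1 hx with hx | hx
      · simpa [Cmd.result, NExp.val, RExp.val, hτm, hx.ne] using hI x hx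
      · obtain rfl : x = ⟨m, hm⟩ := Fin.ext hx
        simp [Cmd.result, NExp.val, RExp.val, hτm, hc, hm]
    · rw [Cmd.result_ite_neg (hcond.not.2 hc)]
      intro x hx
      rcases Nat.lt_succ_iff_lt_or_eq.1 hx with hx | hx
      · simpa [Cmd.result, NExp.val, RExp.val, hτm, hx.ne] using hI x hx
      · obtain rfl : x = ⟨m, hm⟩ := Fin.ext hx
        simp [Cmd.result, NExp.val, RExp.val, hτm, hc, hm]
  · refine (Run.loopFree (by simp [Cmd.LoopFree]) ?_).bound (by simp [Cmd.cost, NExp.cost])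
    refine ⟨fun x => ?_, fun x => ?_⟩
    · by_cases hx : x = I.s
      · simp [hx, Cmd.result, NExp.val]
      · simpa [hx, Cmd.result, NExp.val, Fin.val_inj] using (h x x.2).1
    · simpa [Cmd.result] using (h x x.2).2

/-- Computes minimum weight paths from all vertices at the rates of all priorities. -/
def setupTrees : Cmd :=
  .forReps slotVar (.forVerts srcVar (.seq
    (.setReal distArr (.var slotVar) (.var srcVar) (.var srcVar) (.ofNat (.lit 0)))
    (grow (.add (.get distArr (.var slotVar) (.var srcVar) (.var uVar))
      (.weight (.var uVar) (.prio (.var slotVar)))) (.ofNat (.lit 0)))))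

/-- The memory holds trees of minimum weight paths from all vertices at the rates of all
priorities. -/
def HoldsTrees (I : PriorityNWST) (rep : ℕ → ℕ) (τ : State) : Prop :=
  ∀ j : Fin I.n, I.IsRep rep j → ∀ src : Fin I.n, I.PartialTree (I.sigmaStep (I.P j)) src 0
    Finset.univ (τ.real distArr j src) (τ.nat parArr j src)

/-- At most k priorities times n sources, with a cubic search for each pair. Sources with positive
weight at the rate in question are not excluded; their tables are valid trees but need not represent
σ, and they are not consulted later. -/
theorem setupTrees_run {σ : State} {rep : ℕ → ℕ} (hrep : ∀ x, σ.nat repArr x 0 0 = rep x)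
    (hmap : I.IsRepMap rep) :
    Run I setupTrees σ (10 ^ 12 * ((I.k + 1) * (I.n * (I.n * (I.n * I.n)))))
      (HoldsTrees I rep) := by
  have hn := I.n_pos
  obtain ⟨N, hN⟩ : ∃ N, N = I.n * (I.n * I.n) := ⟨_, rfl⟩
  have hN1 : 1 ≤ N := hN ▸ Nat.mul_pos hn (Nat.mul_pos hn hn)
  refine (Run.forReps (B := 30 * (I.n * (20000000 * N)))
    (by simp [grow, growInit, growRound, growSearch, growScan, growExtend, Cmd.forVerts,
        Cmd.natWrites]) (by omega)
    (by simp [grow, growInit, growRound, growSearch, growScan, growExtend, Cmd.forVerts,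
        Cmd.natWrites]) hrep hmap
    (fun m τ => ∀ j : Fin I.n, j < m → I.IsRep rep j → ∀ src : Fin I.n, I.PartialTree
      (I.sigmaStep (I.P j)) src 0 Finset.univ (τ.real distArr j src) (τ.nat parArr j src))
    ?_ (by simp) (by intro m τ x h; simpa using h) ?_ ?_).mono ?_ fun τ _ h j => h j j.2
  · nlinarith
  · intro m hm hmr τ _ hI j hj hjr
    rcases Nat.lt_succ_iff_lt_or_eq.1 hj with hj | hj
    · exact hI j hj hjr
    · exact absurd (hj ▸ hjr) hmr
  · intro m hm hmr τ hτ hτm hI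
    refine (Run.forVerts_const
      (by simp [grow, growInit, growRound, growSearch, growScan, growExtend, Cmd.forVerts,
        Cmd.natWrites])
      (fun l τ => (∀ j : Fin I.n, j < m → I.IsRep rep j → ∀ src : Fin I.n, I.PartialTree
        (I.sigmaStep (I.P j)) src 0 Finset.univ (τ.real distArr j src) (τ.nat parArr j src)) ∧
        ∀ src : Fin I.n, src < l → I.PartialTree (I.sigmaStep (I.P ⟨m, hm⟩)) src 0 Finset.univ
          (τ.real distArr m src) (τ.nat parArr m src))
      (by omega) ⟨hI, by simp⟩ (by intro m τ x h; simpa using h) ?_).mono le_rfl ?_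
    · intro l hl ρ hρ hρl hI'
      have h6 : ρ.nat slotVar 0 0 0 = m := by
        rw [hρ.nat _ (by simp [grow, growInit, growRound, growSearch, growScan, growExtend,
          Cmd.forVerts, Cmd.natWrites]), hτm]
      refine (Run.seq (B := 100) ((Run.loopFree (c := .setReal distArr (.var slotVar)
        (.var srcVar) (.var srcVar) (.ofNat (.lit 0))) trivial ?_).bound
        (by simp [Cmd.cost, NExp.cost, RExp.cost]))).bound
        (B := 100 + 40000 * (I.n * (I.n * (I.n * 300)))) ?_
      · have hr : Cmd.result I (.setReal distArr (.var slotVar)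
          (.var srcVar) (.var srcVar) (.ofNat (.lit 0))) ρ = ρ.setReal distArr m l l 0 := by
            simp [Cmd.result, NExp.val, RExp.val, h6, hρl]
        rw [hr]
        refine (grow_run (σ := ρ.setReal distArr m l l 0) (f := I.sigmaStep (I.P ⟨m, hm⟩))
          (j := m) (src := ⟨l, hl⟩)
          (fun e u x => ?_) h6 hρl ⟨?_, ?_⟩).mono ?_ ?_
        · refine le_max_of_le_left (le_add_of_nonneg_right ?_)
          split_ifs
          · exact NNReal.coe_nonneg _
          · exact le_rfl
        · intro τ' h1 h2 h3
          have h1' : τ'.nat slotVar 0 0 0 = m := by rw [h1]; exact h6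
          have h2' : τ'.nat srcVar 0 0 0 = l := by rw [h2]; exact hρl
          simp only [RExp.val, NExp.val, h1', h2', hm, dite_true, Real.toNNReal_coe,
            PriorityNWST.sigmaStep, Nat.cast_zero]
        · intro τ' y
          simp [RExp.val, NExp.val]
        · simp only [NExp.cost, RExp.cost]
          gcongr
          omega
        · rintro τ' _ ⟨hT, hd, hp⟩
          have hd0 : (ρ.setReal distArr m l l 0).real distArr m l l = 0 := by simp
          rw [hd0] at hT
          have hkeep : ∀ j src : Fin I.n, ((j : ℕ) ≠ m ∨ (src : ℕ) ≠ l) →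
              τ'.real distArr j src = ρ.real distArr j src ∧
              τ'.nat parArr j src = ρ.nat parArr j src := by
            intro j src hjs
            rw [hd j src hjs, hp j src hjs]
            refine ⟨?_, rfl⟩
            funext y
            have : ¬ ((j : ℕ) = m ∧ (src : ℕ) = l ∧ y = l) := by tauto
            rw [State.setReal_real_self, if_neg this]
          refine ⟨fun j hj hjr src => ?_, fun src hsrc => ?_⟩
          · obtain ⟨h1, h2⟩ := hkeep j src (Or.inl hj.ne)
            rw [h1, h2]
            exact hI'.1 j hj hjr src
          · rcases Nat.lt_succ_iff_lt_or_eq.1 hsrc with hsrc | hsrc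
            · obtain ⟨h1, h2⟩ := hkeep ⟨m, hm⟩ src (Or.inr hsrc.ne)
              dsimp only at h1 h2
              rw [h1, h2]
              exact hI'.2 src hsrc
            · obtain rfl : src = ⟨l, hl⟩ := Fin.ext hsrc
              exact hT
      · have h3 : I.n * (I.n * (I.n * 300)) = 300 * N := by rw [hN]; ring
        rw [h3]
        omega
    · rintro ρ _ ⟨h1, h2⟩ j hj hjr src
      rcases Nat.lt_succ_iff_lt_or_eq.1 hj with hj | hj
      · exact h1 j hj hjr src
      · obtain rfl : j = ⟨m, hm⟩ := Fin.ext hj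
        exact h2 src src.2
  · rw [← hN]
    have : 100 * ((I.k + 1) * (30 * (I.n * (20000000 * N)))) =
      60000000000 * ((I.k + 1) * (I.n * N)) := by ring
    rw [this]
    gcongr
    norm_num

end RealRAM

namespace PriorityNWST

variable {I : PriorityNWST}

/-! ### Choices of minimum ratio -/

/-- Among the sets that minimize the average of their elements and `a`, there is one that consists
of the smallest elements of `C`. -/
theorem exists_initial_segment_le {ι : Type*} [LinearOrder ι] (key : ι → ℝ) (a : ℝ)
    {S C : Finset ι} (hSC : S ⊆ C) (hS : S.Nonempty) :
    ∃ x ∈ C, (a + ∑ y ∈ C with toLex (key y, y) ≤ toLex (key x, x), key y) /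
        ((C.filter fun y => toLex (key y, y) ≤ toLex (key x, x)).card + 1) ≤
      (a + ∑ y ∈ S, key y) / (S.card + 1) := by
  set γ := (a + ∑ y ∈ S, key y) / (S.card + 1) with hγ
  have hS1 : γ * (S.card + 1) = a + ∑ y ∈ S, key y := div_mul_cancel₀ _ (by positivity)
  -- The average of a set is at most γ exactly if a plus the sum of key - γ is at most γ. This
  -- additive form lets elements be judged one by one.
  have hS2 : a + ∑ y ∈ S, (key y - γ) = γ := by
    rw [Finset.sum_sub_distrib, Finset.sum_const, nsmul_eq_mul]
    linarith
  have key_le : ∀ {y x : ι}, toLex (key y, y) ≤ toLex (key x, x) → key y ≤ key x := by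
    intro y x h
    rcases Prod.Lex.toLex_le_toLex.1 h with h | h
    · exact h.le
    · exact h.1.le
  suffices H : ∃ x ∈ C, a + ∑ y ∈ C with toLex (key y, y) ≤ toLex (key x, x), (key y - γ) ≤ γ by
    obtain ⟨x, hx, h⟩ := H
    refine ⟨x, hx, ?_⟩
    rw [Finset.sum_sub_distrib, Finset.sum_const, nsmul_eq_mul] at h
    rw [div_le_iff₀ (by positivity)]
    linarith
  by_cases hlow : ∃ y ∈ S, key y ≤ γ
  -- All elements with key at most γ together minimize the sum of key - γ, and they form a nonempty
  -- initial segment.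
  · obtain ⟨y₀, hy₀, hy₀γ⟩ := hlow
    obtain ⟨x, hx, hmax⟩ := (C.filter fun y => key y ≤ γ).exists_max_image
      (fun y => toLex (key y, y)) ⟨y₀, Finset.mem_filter.2 ⟨hSC hy₀, hy₀γ⟩⟩
    rw [Finset.mem_filter] at hx
    refine ⟨x, hx.1, le_trans ?_ hS2.le⟩
    have hU : (C.filter fun y => toLex (key y, y) ≤ toLex (key x, x)) =
        C.filter fun y => key y ≤ γ := by
      refine Finset.filter_congr fun y hy => ⟨fun h => (key_le h).trans hx.2, fun h => ?_⟩
      exact hmax y (Finset.mem_filter.2 ⟨hy, h⟩)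
    rw [hU]
    refine add_le_add le_rfl ?_
    calc ∑ y ∈ C with key y ≤ γ, (key y - γ) ≤ ∑ y ∈ S with key y ≤ γ, (key y - γ) := by
          rw [← neg_le_neg_iff, ← Finset.sum_neg_distrib, ← Finset.sum_neg_distrib]
          refine Finset.sum_le_sum_of_subset_of_nonneg (Finset.filter_subset_filter _ hSC)
            fun y hy _ => ?_
          have := (Finset.mem_filter.1 hy).2
          linarith
      _ ≤ ∑ y ∈ S, (key y - γ) := by
          refine Finset.sum_le_sum_of_subset_of_nonneg (Finset.filter_subset _ _) fun y hy hy' => ?_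
          have : ¬ key y ≤ γ := fun h => hy' (Finset.mem_filter.2 ⟨hy, h⟩)
          linarith
  -- Every element of S exceeds γ, so the smallest element of C alone does at least as well as the
  -- sum of these positive terms.
  · push Not at hlow
    obtain ⟨x, hx, hmin⟩ := C.exists_min_image (fun y => toLex (key y, y)) (hS.mono hSC)
    refine ⟨x, hx, ?_⟩
    have hU : (C.filter fun y => toLex (key y, y) ≤ toLex (key x, x)) = {x} := by
      ext y
      rw [Finset.mem_filter, Finset.mem_singleton]
      refine ⟨fun h => ?_, by rintro rfl; exact ⟨hx, le_rfl⟩⟩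
      exact congrArg (fun p => (ofLex p).2) (le_antisymm h.2 (hmin y h.1))
    rw [hU, Finset.sum_singleton]
    obtain ⟨y, hy⟩ := hS
    refine le_trans ?_ hS2.le
    have h1 : key x ≤ key y := key_le (hmin y (hSC hy))
    have h2 : key y - γ ≤ ∑ y ∈ S, (key y - γ) :=
      Finset.single_le_sum (f := fun y => key y - γ) (fun z hz => by linarith [hlow z hz]) hy
    linarith

theorem sigma_mono {b b' : ℝ≥0} (h : b ≤ b') (u v : Fin I.n) : I.sigma b u v ≤ I.sigma b' u v := by
  obtain ⟨p⟩ := I.connected.preconnected u v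
  have : Nonempty (I.G.Path u v) := ⟨p.toPath⟩
  refine le_ciInf fun q => (ciInf_le (OrderBot.bddBelow _) q).trans ?_
  exact Finset.sum_le_sum fun z _ => I.weight_mono z h

/-- The cost of connecting the root `y` to the center `v`. -/
noncomputable def legCost (I : PriorityNWST) (v y : Fin I.n) : ℝ := I.sigma (I.P y) v y

/-- The order in which the roots are added to a group with center `v`. -/
def LegLE (I : PriorityNWST) (v y x : Fin I.n) : Prop :=
  toLex (I.legCost v y, y) ≤ toLex (I.legCost v x, x)

theorem legLE_iff (v y x : Fin I.n) : I.LegLE v y x ↔ I.legCost v y ≤ I.legCost v x ∧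
    ¬ (I.legCost v x ≤ I.legCost v y ∧ ¬ (y : ℕ) ≤ x) := by
  rw [LegLE, Prod.Lex.toLex_le_toLex, Fin.le_def]
  constructor
  · rintro (h | ⟨h, h'⟩)
    · exact ⟨h.le, fun h' => absurd h'.1 (not_le.2 h)⟩
    · exact ⟨h.le, fun h'' => h''.2 h'⟩
  · rintro ⟨h, h'⟩
    rcases h.lt_or_eq with h1 | h1
    · exact Or.inl h1
    · exact Or.inr ⟨h1, by by_contra h2; exact h' ⟨h1.ge, h2⟩⟩

open Classical in
/-- The roots of priority at most `b` up to `x`, in the order of the costs of connecting them to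
`v`. -/
noncomputable def segment (M : Finset (Fin I.n)) (v : Fin I.n) (b : ℝ≥0) (x : Fin I.n) :
    Finset (Fin I.n) := M.filter fun y => I.P y ≤ b ∧ I.LegLE v y x

theorem mem_segment {M : Finset (Fin I.n)} {v : Fin I.n} {b : ℝ≥0} {x y : Fin I.n} :
    y ∈ segment M v b x ↔ y ∈ M ∧ I.P y ≤ b ∧ I.LegLE v y x := by
  classical
  exact Finset.mem_filter

/-- The choices that the program considers are described by the center `v`, a terminal `j` whose
priority is the rate, the last element `x` of the group, and the root `r`. -/
abbrev Item (I : PriorityNWST) : Type := Fin I.n × Fin I.n × Fin I.n × Fin I.n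

/-- The segment is formed without regard to the root and may contain it, hence the `erase`. This
makes the segment sums independent of the root. -/
noncomputable def Item.toChoice (M : Finset (Fin I.n)) (e : I.Item) : I.Choice :=
  ⟨e.2.2.2, e.1, I.P e.2.1, (segment M e.1 (I.P e.2.1) e.2.2.1).erase e.2.2.2⟩

/-- The last condition keeps the final element x in the group after the root is erased, so the group
is nonempty. -/
def Item.Valid (rep : ℕ → ℕ) (M : Finset (Fin I.n)) (e : I.Item) : Prop :=
  I.IsRep rep e.2.1 ∧ (e.2.2.1 ∈ M ∧ I.P e.2.2.1 ≤ I.P e.2.1) ∧ e.2.2.2 ∈ M ∧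
    I.P e.2.1 ≤ I.P e.2.2.2 ∧ e.2.2.2 ≠ e.2.2.1

theorem Item.Valid.toChoice {rep : ℕ → ℕ} {M : Finset (Fin I.n)} {e : I.Item}
    (h : e.Valid rep M) : (e.toChoice M).Valid M := by
  obtain ⟨_, ⟨hx, hxj⟩, hr, hjr, hrx⟩ := h
  refine ⟨hr, ?_, ⟨e.2.2.1, ?_⟩, Finset.notMem_erase _ _, hjr, ?_⟩
  · exact fun y hy => (mem_segment.1 (Finset.mem_of_mem_erase hy)).1
  · exact Finset.mem_erase.2 ⟨hrx.symm, mem_segment.2 ⟨hx, hxj, le_rfl⟩⟩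
  · exact fun y hy => (mem_segment.1 (Finset.mem_of_mem_erase hy)).2.1

/-- Lower the rate to the largest priority in S, given by a representative j. By monotonicity the
path and the center do not become more expensive. Then replace S by an initial segment of the other
roots of priority at most P(j). -/
theorem Choice.Valid.exists_item {rep : ℕ → ℕ} (hmap : I.IsRepMap rep) {M : Finset (Fin I.n)}
    (hM : M ⊆ insert I.s I.T) (hT : I.T.Nonempty) {c : I.Choice} (hc : c.Valid M) :
    ∃ e : I.Item, e.Valid rep M ∧ (e.toChoice M).ratio ≤ c.ratio := by
  classical
  obtain ⟨hr, hSM, hS, hrS, hb, hPS⟩ := hc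
  obtain ⟨y₀, hy₀, hmax⟩ := c.S.exists_max_image I.P hS
  obtain ⟨j, _, hj, hjrep⟩ := hmap.rep_spec (hM (hSM hy₀)) hT
  have hjb : I.P j ≤ c.b := hj.le.trans (hPS y₀ hy₀)
  obtain ⟨x, hx, hle⟩ := exists_initial_segment_le (I.legCost c.v)
    (I.sigma (I.P j) c.r c.v + I.w c.v (I.P j)) (S := c.S)
    (C := M.filter fun y => y ≠ c.r ∧ I.P y ≤ I.P j)
    (fun y hy => Finset.mem_filter.2 ⟨hSM hy, fun h => hrS (h ▸ hy), (hmax y hy).trans hj.ge⟩) hS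
  rw [Finset.mem_filter] at hx
  refine ⟨(c.v, j, x, c.r), ⟨hjrep, ⟨hx.1, hx.2.2⟩, hr, hjb.trans hb, hx.2.1.symm⟩, ?_⟩
  have hseg : ((M.filter fun y => y ≠ c.r ∧ I.P y ≤ I.P j).filter fun y =>
      toLex (I.legCost c.v y, y) ≤ toLex (I.legCost c.v x, x)) =
      (segment M c.v (I.P j) x).erase c.r := by
    ext y
    simp only [Finset.mem_filter, Finset.mem_erase, mem_segment, LegLE]
    tauto
  rw [hseg] at hle
  rw [← NNReal.coe_le_coe]
  unfold Choice.ratio Item.toChoice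
  push_cast
  refine hle.trans ?_
  have h1 : (I.sigma (I.P j) c.r c.v : ℝ) ≤ I.sigma c.b c.r c.v := by
    exact_mod_cast sigma_mono hjb _ _
  have h2 : (I.w c.v (I.P j) : ℝ) ≤ I.w c.v c.b := by exact_mod_cast I.weight_mono _ hjb
  unfold legCost
  gcongr

end PriorityNWST

namespace RealRAM

variable {I : PriorityNWST}

/-! ### The search for a choice of minimum ratio -/

notation "vVar" => (14 : ℕ)
notation "lastVar" => (15 : ℕ)
notation "yVar" => (16 : ℕ)
notation "rootVar" => (17 : ℕ)
notation "countVar" => (18 : ℕ)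
notation "countVar'" => (19 : ℕ)
notation "bestV" => (20 : ℕ)
notation "bestJ" => (21 : ℕ)
notation "bestLast" => (22 : ℕ)
notation "bestRoot" => (23 : ℕ)
notation "sumReal" => (4 : ℕ)
notation "sumReal'" => (5 : ℕ)

/-- The cost of connecting the root `y` to the center `v`. -/
abbrev legExp (v y : ℕ) : RExp := .get distArr (.cell repArr (.var y)) (.var y) (.var v)

/-- The root `y` has priority at most that of `j`, and comes before `x` or is `x`. -/
abbrev inSegment (v j x y : ℕ) : BExp :=
  .and (.leReal (.prio (.var y)) (.prio (.var j)))
    (.and (.leReal (legExp v y) (legExp v x))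
      (.not (.and (.leReal (legExp v x) (legExp v y)) (.not (.leNat (.var y) (.var x))))))

/-- Computes the size and the total cost of the segment up to `lastVar`. -/
def searchSum : Cmd :=
  .seq (.assign countVar (.lit 0)) (.seq (.assignReal sumReal (.ofNat (.lit 0)))
    (.forVerts yVar (.ite (.and (.leNat (.lit 1) (.cell aliveArr (.var yVar)))
        (inSegment vVar slotVar lastVar yVar))
      (.seq (.assign countVar (.add (.var countVar) (.lit 1)))
        (.assignReal sumReal (.add (.var sumReal) (legExp vVar yVar)))) .skip)))

/-- Computes the size and the total cost of the segment without the current root. -/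
def searchAdjust : Cmd :=
  .ite (inSegment vVar slotVar lastVar rootVar)
    (.seq (.assign countVar' (.sub (.var countVar) (.lit 1)))
      (.assignReal sumReal' (.sub (.var sumReal) (legExp vVar rootVar))))
    (.seq (.assign countVar' (.var countVar)) (.assignReal sumReal' (.var sumReal)))

/-- Computes the ratio of the current choice. -/
def searchRatio : Cmd :=
  .assignReal keyReal (.div (.add (.add (.get distArr (.var slotVar) (.var rootVar) (.var vVar))
    (.weight (.var vVar) (.prio (.var slotVar)))) (.var sumReal'))
    (.add (.ofNat (.var countVar')) (.ofNat (.lit 1))))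

/-- Compares the current choice to the best one. -/
def searchCompare : Cmd :=
  .ite (.and (.leNat (.lit 1) (.var foundVar)) (.leReal (.var bestReal) (.var keyReal))) .skip
    (.seq (.assign foundVar (.lit 1)) (.seq (.assignReal bestReal (.var keyReal))
      (.seq (.assign bestV (.var vVar)) (.seq (.assign bestJ (.var slotVar))
        (.seq (.assign bestLast (.var lastVar)) (.assign bestRoot (.var rootVar)))))))

/-- Considers the current root if it gives rise to a choice. -/
def searchRoot : Cmd :=
  .ite (.and (.leNat (.lit 1) (.cell aliveArr (.var rootVar)))
      (.and (.leReal (.prio (.var slotVar)) (.prio (.var rootVar)))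
        (.not (.eqNat (.var rootVar) (.var lastVar)))))
    (.seq searchAdjust (.seq searchRatio searchCompare)) .skip

def searchLast : Cmd :=
  .ite (.and (.leNat (.lit 1) (.cell aliveArr (.var lastVar)))
      (.leReal (.prio (.var lastVar)) (.prio (.var slotVar))))
    (.seq searchSum (.forVerts rootVar searchRoot)) .skip

def search : Cmd :=
  .seq (.assign foundVar (.lit 0))
    (.forVerts vVar (.forReps slotVar (.forVerts lastVar searchLast)))

theorem natWrites_search : search.natWrites =
    [11, 14, 6, 15, 18, 16, 18, 16, 17, 19, 19, 11, 20, 21, 22, 23, 17, 15, 6, 14] := by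
  simp [search, searchLast, searchSum, searchRoot, searchAdjust, searchRatio, searchCompare,
    Cmd.forReps, Cmd.forVerts, Cmd.natWrites]

theorem realWrites_search : search.realWrites = [4, 4, 5, 5, 2, 3] := by
  simp [search, searchLast, searchSum, searchRoot, searchAdjust, searchRatio, searchCompare,
    Cmd.forReps, Cmd.forVerts, Cmd.realWrites]

/-- The memory holds the representatives of the priorities and the trees of minimum weight paths. -/
structure TreeData (I : PriorityNWST) (rep : ℕ → ℕ) (τ : State) : Prop where
  rep_eq : ∀ x, τ.nat repArr x 0 0 = rep x
  isRepMap : I.IsRepMap rep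
  trees : HoldsTrees I rep τ

namespace TreeData

variable {rep : ℕ → ℕ} {σ τ : State}

theorem congr (h : TreeData I rep σ) (h1 : τ.nat repArr = σ.nat repArr)
    (h2 : τ.nat parArr = σ.nat parArr) (h3 : τ.real distArr = σ.real distArr) :
    TreeData I rep τ :=
  ⟨fun x => by rw [h1, h.rep_eq], h.isRepMap, fun j hj src => by
    rw [h2, h3]; exact h.trees j hj src⟩

/-- The table is exact where the start of the path has weight zero at the given rate; this covers
every lookup of the search. -/
theorem dist_eq (h : TreeData I rep τ) {j r : Fin I.n} (hj : I.IsRep rep j)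
    (hjr : I.P j ≤ I.P r) (v : Fin I.n) : τ.real distArr j r v = I.sigma (I.P j) r v :=
  ((h.trees j hj r).sigma_spec (I.weight_zero r _ hjr) v).1

/-- The leg is looked up from the root y, which is free at rate P(y), and not from the center; σ is
symmetric. -/
theorem legExp_val (h : TreeData I rep τ) (hT : I.T.Nonempty) {v y : ℕ} {v' y' : Fin I.n}
    (hv : τ.nat v 0 0 0 = v') (hy : τ.nat y 0 0 0 = y') (hyT : y' ∈ insert I.s I.T) :
    (legExp v y).val I τ = I.legCost v' y' := by
  obtain ⟨ρ, hρ, h1, h2⟩ := h.isRepMap.rep_spec hyT hT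
  simp only [RExp.val, NExp.val, hv, hy, h.rep_eq, hρ]
  rw [h.dist_eq h2 h1.le, h1, PriorityNWST.sigma_comm]
  rfl

theorem inSegment_holds (h : TreeData I rep τ) (hT : I.T.Nonempty) {M : Finset (Fin I.n)}
    (hM : M ⊆ insert I.s I.T) {v j x y : ℕ}
    {v' j' x' y' : Fin I.n} (hv : τ.nat v 0 0 0 = v') (hj : τ.nat j 0 0 0 = j')
    (hx : τ.nat x 0 0 0 = x') (hy : τ.nat y 0 0 0 = y') (hxM : x' ∈ M) (hyM : y' ∈ M) :
    (inSegment v j x y).Holds I τ ↔ y' ∈ PriorityNWST.segment M v' (I.P j') x' := by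
  rw [PriorityNWST.mem_segment, PriorityNWST.legLE_iff]
  simp only [BExp.Holds, h.legExp_val hT hv hx (hM hxM), h.legExp_val hT hv hy (hM hyM)]
  simp only [RExp.val, NExp.val, hj, hx, hy, Fin.is_lt, dite_true, Fin.eta, NNReal.coe_le_coe, hyM,
    true_and]

end TreeData

/-- The data structures that the search uses. -/
structure SearchData (I : PriorityNWST) (rep : ℕ → ℕ) (M : Finset (Fin I.n)) (τ : State) : Prop
    extends TreeData I rep τ where
  subset : M ⊆ insert I.s I.T
  alive : ∀ x : Fin I.n, 1 ≤ τ.nat aliveArr x 0 0 ↔ x ∈ M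

theorem SearchData.congr {rep : ℕ → ℕ} {M : Finset (Fin I.n)} {σ τ : State}
    (h : SearchData I rep M σ) (h2 : τ.nat aliveArr = σ.nat aliveArr)
    (h3 : τ.nat repArr = σ.nat repArr) (h4 : τ.nat parArr = σ.nat parArr)
    (h1 : τ.real distArr = σ.real distArr) : SearchData I rep M τ :=
  ⟨h.toTreeData.congr h3 h4 h1, h.subset, fun x => by rw [h2, h.alive]⟩

theorem filter_val_lt_succ {n m : ℕ} (F : Finset (Fin n)) (hm : m < n) :
    (F.filter fun y : Fin n => (y : ℕ) < m + 1) = if ⟨m, hm⟩ ∈ F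
      then insert ⟨m, hm⟩ (F.filter fun y : Fin n => (y : ℕ) < m)
      else F.filter fun y : Fin n => (y : ℕ) < m := by
  ext y
  rcases eq_or_ne y ⟨m, hm⟩ with rfl | hne
  · split_ifs with h <;> simp [h]
  · have : (y : ℕ) ≠ m := fun h => hne (Fin.ext h)
    have h1 : (y : ℕ) ≤ m ↔ (y : ℕ) < m := by omega
    split_ifs with h <;> simp [h1, hne]

theorem searchSum_run {rep : ℕ → ℕ} {M : Finset (Fin I.n)} {σ : State}
    (h : SearchData I rep M σ) (hT : I.T.Nonempty) {v j x : Fin I.n}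
    (hv : σ.nat vVar 0 0 0 = v) (hj : σ.nat slotVar 0 0 0 = j) (hx : σ.nat lastVar 0 0 0 = x)
    (hxM : x ∈ M) : Run I searchSum σ (10000 * I.n) fun τ =>
      τ.nat countVar 0 0 0 = (PriorityNWST.segment M v (I.P j) x).card ∧
      τ.real sumReal 0 0 0 = ∑ y ∈ PriorityNWST.segment M v (I.P j) x, I.legCost v y := by
  have hn := I.n_pos
  set F := PriorityNWST.segment M v (I.P j) x with hF
  unfold searchSum
  refine (Run.seq (B := 5) (B' := 6 + 30 * (I.n * 200))
    ((Run.loopFree (c := .assign countVar (.lit 0)) trivial ?_).bound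
      (by simp [Cmd.cost, NExp.cost]))).bound (by omega)
  refine Run.seq ((Run.loopFree (c := .assignReal sumReal (.ofNat (.lit 0))) trivial ?_).bound
      (by simp [Cmd.cost, NExp.cost, RExp.cost]))
  set σ' := Cmd.result I (.assignReal sumReal (.ofNat (.lit 0)))
    (Cmd.result I (.assign countVar (.lit 0)) σ) with hσ'
  refine (Run.forVerts_const (by simp [Cmd.natWrites]) (fun l τ =>
      τ.nat countVar 0 0 0 = (F.filter fun y : Fin I.n => (y : ℕ) < l).card ∧
      τ.real sumReal 0 0 0 = ∑ y ∈ F.filter fun y : Fin I.n => (y : ℕ) < l, I.legCost v y)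
      (by omega)
      ?_ (by intro m τ x h; simpa using h) ?_).mono le_rfl ?_
  · simp [hσ', Cmd.result, NExp.val, RExp.val]
  · intro m hm τ hτ hτm hI
    refine (Run.loopFree (by simp [Cmd.LoopFree]) ?_).bound
      (by simp [Cmd.cost, NExp.cost, BExp.cost, RExp.cost])
    have hN : ∀ a, a ≠ yVar → a ≠ countVar → τ.nat a = σ.nat a := fun a h1 h2 => by
      rw [hτ.nat a (by simp [Cmd.forVerts, Cmd.natWrites, h1, h2])]
      simp [hσ', Cmd.result, h2]
    have hR : ∀ a, a ≠ sumReal → τ.real a = σ.real a := fun a h1 => by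
      rw [hτ.real a (by simp [Cmd.forVerts, Cmd.realWrites, h1])]
      simp [hσ', Cmd.result, h1]
    have hdata : SearchData I rep M τ := h.congr (hN _ (by omega) (by omega))
      (hN _ (by omega) (by omega)) (hN _ (by omega) (by omega)) (hR _ (by omega))
    have hτv : τ.nat vVar 0 0 0 = v := by rw [hN _ (by omega) (by omega), hv]
    have hτj : τ.nat slotVar 0 0 0 = j := by rw [hN _ (by omega) (by omega), hj]
    have hτx : τ.nat lastVar 0 0 0 = x := by rw [hN _ (by omega) (by omega), hx]
    have hcond : BExp.Holds I τ (.and (.leNat (.lit 1) (.cell aliveArr (.var yVar)))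
        (inSegment vVar slotVar lastVar yVar)) ↔ (⟨m, hm⟩ : Fin I.n) ∈ F := by
      have h1 : BExp.Holds I τ (.leNat (.lit 1) (.cell aliveArr (.var yVar))) ↔
          (⟨m, hm⟩ : Fin I.n) ∈ M := by
        rw [← hdata.alive]
        simp only [BExp.Holds, NExp.val, hτm]
      rw [BExp.Holds, h1]
      constructor
      · rintro ⟨h2, h3⟩
        exact (hdata.inSegment_holds hT h.subset hτv hτj hτx (y' := ⟨m, hm⟩) hτm hxM h2).1 h3
      · intro h2
        have h3 := (PriorityNWST.mem_segment.1 h2).1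
        exact ⟨h3, (hdata.inSegment_holds hT h.subset hτv hτj hτx (y' := ⟨m, hm⟩) hτm hxM h3).2 h2⟩
    have hnot : (⟨m, hm⟩ : Fin I.n) ∉ F.filter fun y : Fin I.n => (y : ℕ) < m := by simp
    rw [filter_val_lt_succ F hm]
    by_cases hc : (⟨m, hm⟩ : Fin I.n) ∈ F
    · rw [Cmd.result_ite_pos (hcond.2 hc), if_pos hc, Finset.card_insert_of_notMem hnot,
        Finset.sum_insert hnot]
      have hcM := (PriorityNWST.mem_segment.1 hc).1
      rw [Cmd.result_seq]
      have hdata' : SearchData I rep M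
          (Cmd.result I (.assign countVar (.add (.var countVar) (.lit 1))) τ) :=
        hdata.congr (by simp [Cmd.result]) (by simp [Cmd.result]) (by simp [Cmd.result])
          (by simp [Cmd.result])
      have hleg := hdata'.legExp_val hT (v := vVar) (y := yVar) (v' := v) (y' := ⟨m, hm⟩)
        (by simpa [Cmd.result] using hτv) (by simpa [Cmd.result] using hτm) (h.subset hcM)
      rw [← hI.1, ← hI.2, ← hleg]
      constructor
      · simp [Cmd.result, NExp.val]
      · simp [Cmd.result, NExp.val, RExp.val, add_comm]
    · rw [Cmd.result_ite_neg (hcond.not.2 hc), if_neg hc]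
      exact hI
  · rintro τ _ hI
    have : (F.filter fun y : Fin I.n => (y : ℕ) < I.n) = F := by simp
    rwa [this] at hI

/-- Erasing the root from the shared count and sum takes constant time, which saves a factor n over
summing anew for every root. -/
theorem searchAdjust_run {rep : ℕ → ℕ} {M : Finset (Fin I.n)} {σ : State}
    (h : SearchData I rep M σ) (hT : I.T.Nonempty) {v j x r : Fin I.n}
    (hv : σ.nat vVar 0 0 0 = v) (hj : σ.nat slotVar 0 0 0 = j) (hx : σ.nat lastVar 0 0 0 = x)
    (hr : σ.nat rootVar 0 0 0 = r) (hxM : x ∈ M) (hrM : r ∈ M)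
    (hc : σ.nat countVar 0 0 0 = (PriorityNWST.segment M v (I.P j) x).card)
    (hs : σ.real sumReal 0 0 0 = ∑ y ∈ PriorityNWST.segment M v (I.P j) x, I.legCost v y) :
    Run I searchAdjust σ 1000 fun τ =>
      τ.nat countVar' 0 0 0 = ((PriorityNWST.segment M v (I.P j) x).erase r).card ∧
      τ.real sumReal' 0 0 0 =
        ∑ y ∈ (PriorityNWST.segment M v (I.P j) x).erase r, I.legCost v y := by
  set F := PriorityNWST.segment M v (I.P j) x with hF
  refine (Run.loopFree (by simp [searchAdjust, Cmd.LoopFree]) ?_).bound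
    (by simp [searchAdjust, Cmd.cost, NExp.cost, BExp.cost, RExp.cost])
  have hcond := h.inSegment_holds hT h.subset hv hj hx hr hxM hrM
  unfold searchAdjust
  by_cases hrF : r ∈ F
  · rw [Cmd.result_ite_pos (hcond.2 hrF), Cmd.result_seq]
    have hdata : SearchData I rep M
        (Cmd.result I (.assign countVar' (.sub (.var countVar) (.lit 1))) σ) :=
      h.congr (by simp [Cmd.result]) (by simp [Cmd.result]) (by simp [Cmd.result])
        (by simp [Cmd.result])
    have hleg := hdata.legExp_val hT (v := vVar) (y := rootVar) (v' := v) (y' := r)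
      (by simpa [Cmd.result] using hv) (by simpa [Cmd.result] using hr) (h.subset hrM)
    constructor
    · simp [Cmd.result, NExp.val, hc, Finset.card_erase_of_mem hrF]
    · rw [Finset.sum_erase_eq_sub hrF, ← hs, ← hleg]
      simp [Cmd.result, NExp.val, RExp.val]
  · rw [Cmd.result_ite_neg (hcond.not.2 hrF), Finset.erase_eq_of_notMem hrF]
    simp [Cmd.result, NExp.val, RExp.val, hc, hs]

/-- The memory holds a best item of `Y`. -/
def SearchBest (rep : ℕ → ℕ) (M : Finset (Fin I.n)) (Y : Set I.Item) (τ : State) : Prop :=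
  ∃ e : I.Item, ArgMin (PriorityNWST.Item.Valid rep M) (fun e => ((e.toChoice M).ratio : ℝ)) Y
    (τ.nat foundVar 0 0 0) (τ.real bestReal 0 0 0) e ∧
    (τ.nat foundVar 0 0 0 = 1 → τ.nat bestV 0 0 0 = e.1 ∧ τ.nat bestJ 0 0 0 = e.2.1 ∧
      τ.nat bestLast 0 0 0 = e.2.2.1 ∧ τ.nat bestRoot 0 0 0 = e.2.2.2)

namespace SearchBest

variable {rep : ℕ → ℕ} {M : Finset (Fin I.n)} {Y Z : Set I.Item} {σ τ : State}

theorem congr (h : SearchBest rep M Y σ) (h1 : τ.nat foundVar = σ.nat foundVar)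
    (h2 : τ.real bestReal = σ.real bestReal) (h3 : τ.nat bestV = σ.nat bestV)
    (h4 : τ.nat bestJ = σ.nat bestJ) (h5 : τ.nat bestLast = σ.nat bestLast)
    (h6 : τ.nat bestRoot = σ.nat bestRoot) : SearchBest rep M Y τ := by
  obtain ⟨e, he⟩ := h
  refine ⟨e, ?_⟩
  rw [h1, h2, h3, h4, h5, h6]
  exact he

theorem setNat (h : SearchBest rep M Y σ) {a : ℕ} (ha : a < 11 ∨ 11 < a ∧ a < 20) (x : ℕ) :
    SearchBest rep M Y (σ.setNat a 0 0 0 x) :=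
  h.congr (State.setNat_nat_of_ne _ _ _ _ _ (by omega)) rfl
    (State.setNat_nat_of_ne _ _ _ _ _ (by omega)) (State.setNat_nat_of_ne _ _ _ _ _ (by omega))
    (State.setNat_nat_of_ne _ _ _ _ _ (by omega)) (State.setNat_nat_of_ne _ _ _ _ _ (by omega))

theorem union_of_not_valid (h : SearchBest rep M Y σ)
    (hZ : ∀ e ∈ Z, ¬ PriorityNWST.Item.Valid rep M e) : SearchBest rep M (Y ∪ Z) σ := by
  obtain ⟨e, he, he'⟩ := h
  exact ⟨e, he.union_of_not_valid hZ, he'⟩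

end SearchBest

theorem searchCompare_run {rep : ℕ → ℕ} {M : Finset (Fin I.n)} {σ : State} {v j x r : Fin I.n}
    (hv : σ.nat vVar 0 0 0 = v) (hj : σ.nat slotVar 0 0 0 = j) (hx : σ.nat lastVar 0 0 0 = x)
    (hr : σ.nat rootVar 0 0 0 = r) {Y : Set I.Item} (h : SearchBest rep M Y σ)
    (hvalid : PriorityNWST.Item.Valid rep M (v, j, x, r))
    (hkey : σ.real keyReal 0 0 0 = (PriorityNWST.Item.toChoice M (v, j, x, r)).ratio) :
    Run I searchCompare σ 1000 (SearchBest rep M (Y ∪ {(v, j, x, r)})) := by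
  obtain ⟨e, he, he'⟩ := h
  refine (Run.loopFree (by simp [searchCompare, Cmd.LoopFree]) ?_).bound
    (by simp [searchCompare, Cmd.cost, NExp.cost, BExp.cost, RExp.cost])
  unfold searchCompare
  have hcond : BExp.Holds I σ
      (.and (.leNat (.lit 1) (.var foundVar)) (.leReal (.var bestReal) (.var keyReal))) ↔
      1 ≤ σ.nat foundVar 0 0 0 ∧
        σ.real bestReal 0 0 0 ≤ (PriorityNWST.Item.toChoice M (v, j, x, r)).ratio := by
    simp only [BExp.Holds, NExp.val, RExp.val, hkey]
  by_cases hc : BExp.Holds I σ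
      (.and (.leNat (.lit 1) (.var foundVar)) (.leReal (.var bestReal) (.var keyReal)))
  · rw [Cmd.result_ite_pos hc]
    exact ⟨e, he.union_of_le (hcond.1 hc).1 (hcond.1 hc).2, he'⟩
  · rw [Cmd.result_ite_neg hc]
    refine ⟨(v, j, x, r), ?_, ?_⟩
    · have := he.union_of_lt hvalid (hcond.not.1 hc)
      simpa [Cmd.result, NExp.val, RExp.val, hkey] using this
    · simp [Cmd.result, NExp.val, hv, hj, hx, hr]

theorem searchRoot_run {rep : ℕ → ℕ} {M : Finset (Fin I.n)} {σ : State}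
    (h : SearchData I rep M σ) (hT : I.T.Nonempty) {v j x r : Fin I.n}
    (hv : σ.nat vVar 0 0 0 = v) (hj : σ.nat slotVar 0 0 0 = j) (hx : σ.nat lastVar 0 0 0 = x)
    (hr : σ.nat rootVar 0 0 0 = r) (hjrep : I.IsRep rep j) (hxM : x ∈ M) (hxj : I.P x ≤ I.P j)
    (hc : σ.nat countVar 0 0 0 = (PriorityNWST.segment M v (I.P j) x).card)
    (hs : σ.real sumReal 0 0 0 = ∑ y ∈ PriorityNWST.segment M v (I.P j) x, I.legCost v y)
    {Y : Set I.Item} (hY : SearchBest rep M Y σ) :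
    Run I searchRoot σ 3000 (SearchBest rep M (Y ∪ {(v, j, x, r)})) := by
  have hcond : BExp.Holds I σ (.and (.leNat (.lit 1) (.cell aliveArr (.var rootVar)))
      (.and (.leReal (.prio (.var slotVar)) (.prio (.var rootVar)))
        (.not (.eqNat (.var rootVar) (.var lastVar))))) ↔
      r ∈ M ∧ I.P j ≤ I.P r ∧ r ≠ x := by
    rw [← h.alive]
    simp only [BExp.Holds, NExp.val, RExp.val, hr, hj, hx, Fin.is_lt, dite_true, Fin.eta,
      NNReal.coe_le_coe, ← le_antisymm_iff, Fin.val_inj, ne_eq]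
  unfold searchRoot
  refine (Run.ite (B := 2500) (fun hb => ?_) fun hb => ?_).bound
    (by simp [NExp.cost, BExp.cost, RExp.cost])
  · obtain ⟨hrM, hjr, hrx⟩ := hcond.1 hb
    refine (Run.seq (B := 1000) (B' := 1400)
      ((searchAdjust_run h hT hv hj hx hr hxM hrM hc hs).mono le_rfl ?_)).bound (by omega)
    rintro τ hτ ⟨hc', hs'⟩
    have hN : ∀ a, a ≠ countVar' → τ.nat a = σ.nat a := fun a h1 =>
      hτ.nat a (by simp [searchAdjust, Cmd.natWrites, h1])
    have hR : ∀ a, a ≠ sumReal' → τ.real a = σ.real a := fun a h1 =>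
      hτ.real a (by simp [searchAdjust, Cmd.realWrites, h1])
    have hdata : SearchData I rep M τ := h.congr (hN _ (by omega)) (hN _ (by omega))
      (hN _ (by omega)) (hR _ (by omega))
    have hv' : τ.nat vVar 0 0 0 = v := by rw [hN _ (by omega), hv]
    have hj' : τ.nat slotVar 0 0 0 = j := by rw [hN _ (by omega), hj]
    have hx' : τ.nat lastVar 0 0 0 = x := by rw [hN _ (by omega), hx]
    have hr' : τ.nat rootVar 0 0 0 = r := by rw [hN _ (by omega), hr]
    refine (Run.seq (B := 200) (B' := 1000)
      ((Run.loopFree (c := searchRatio) trivial ?_).bound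
        (by simp [searchRatio, Cmd.cost, NExp.cost, RExp.cost]))).bound (by omega)
    refine searchCompare_run (v := v) (j := j) (x := x) (r := r) ?_ ?_ ?_ ?_
      (hY.congr ?_ ?_ ?_ ?_ ?_ ?_) ⟨hjrep, ⟨hxM, hxj⟩, hrM, hjr, hrx⟩ ?_
    · simpa [searchRatio, Cmd.result] using hv'
    · simpa [searchRatio, Cmd.result] using hj'
    · simpa [searchRatio, Cmd.result] using hx'
    · simpa [searchRatio, Cmd.result] using hr'
    · simpa [searchRatio, Cmd.result] using hN _ (by omega)
    · simpa [searchRatio, Cmd.result] using hR _ (by omega)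
    · simpa [searchRatio, Cmd.result] using hN _ (by omega)
    · simpa [searchRatio, Cmd.result] using hN _ (by omega)
    · simpa [searchRatio, Cmd.result] using hN _ (by omega)
    · simpa [searchRatio, Cmd.result] using hN _ (by omega)
    · simp [searchRatio, Cmd.result, NExp.val, RExp.val, hv', hj', hr', hc', hs',
        hdata.dist_eq hjrep hjr, PriorityNWST.Item.toChoice, PriorityNWST.Choice.ratio,
        PriorityNWST.legCost]
  · refine (Run.loopFree (c := .skip) trivial (hY.union_of_not_valid ?_)).bound (by simp [Cmd.cost])
    rintro e rfl ⟨_, _, h1, h2, h3⟩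
    exact hb (hcond.2 ⟨h1, h2, h3⟩)

end RealRAM

namespace RealRAM

variable {I : PriorityNWST}

namespace SearchBest

variable {rep : ℕ → ℕ} {M : Finset (Fin I.n)} {Y : Set I.Item} {τ : State}
  {p : I.Item → Prop} {f : I.Item → Fin I.n}

/-- This lemma and the next two describe the start, a round and the end of a loop over one
coordinate f of the items; the nested loops of the search enlarge the set of examined items through
them. -/
theorem union_lt_zero (h : SearchBest rep M Y τ) :
    SearchBest rep M (Y ∪ {e | p e ∧ (f e : ℕ) < 0}) τ := by
  simpa using h

theorem union_lt_succ {m : ℕ}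
    (h : SearchBest rep M (Y ∪ {e | p e ∧ (f e : ℕ) < m} ∪ {e | p e ∧ (f e : ℕ) = m}) τ) :
    SearchBest rep M (Y ∪ {e | p e ∧ (f e : ℕ) < m + 1}) τ := by
  have : {e | p e ∧ (f e : ℕ) < m + 1} =
      {e | p e ∧ (f e : ℕ) < m} ∪ {e | p e ∧ (f e : ℕ) = m} := by
    ext e
    simp only [Set.mem_ofPred_eq, Set.mem_union, Nat.lt_succ_iff_lt_or_eq]
    tauto
  rwa [this, ← Set.union_assoc]

theorem union_of_lt (h : SearchBest rep M (Y ∪ {e | p e ∧ (f e : ℕ) < I.n}) τ) :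
    SearchBest rep M (Y ∪ {e | p e}) τ := by
  simpa using h

end SearchBest

/-- One linear pass computes the segment sum and a second one tries all roots. If the test fails, no
item with this prefix is valid. -/
theorem searchLast_run {rep : ℕ → ℕ} {M : Finset (Fin I.n)} {σ : State}
    (h : SearchData I rep M σ) (hT : I.T.Nonempty) {v j x : Fin I.n}
    (hv : σ.nat vVar 0 0 0 = v) (hj : σ.nat slotVar 0 0 0 = j) (hx : σ.nat lastVar 0 0 0 = x)
    (hjrep : I.IsRep rep j) {Y : Set I.Item} (hY : SearchBest rep M Y σ) :
    Run I searchLast σ (200000 * I.n)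
      (SearchBest rep M (Y ∪ {e | e.1 = v ∧ e.2.1 = j ∧ e.2.2.1 = x})) := by
  have hn := I.n_pos
  have hcond : BExp.Holds I σ (.and (.leNat (.lit 1) (.cell aliveArr (.var lastVar)))
      (.leReal (.prio (.var lastVar)) (.prio (.var slotVar)))) ↔ x ∈ M ∧ I.P x ≤ I.P j := by
    rw [← h.alive]
    simp only [BExp.Holds, NExp.val, RExp.val, hj, hx, Fin.is_lt, dite_true, Fin.eta,
      NNReal.coe_le_coe]
  unfold searchLast
  refine (Run.ite (B := 100000 * I.n) (fun hb => ?_) fun hb => ?_).bound (by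
    simp only [NExp.cost, BExp.cost, RExp.cost]; omega)
  · obtain ⟨hxM, hxj⟩ := hcond.1 hb
    refine (Run.seq (B' := 30 * (I.n * 3000))
      ((searchSum_run h hT hv hj hx hxM).mono le_rfl ?_)).bound (by omega)
    rintro τ hτ ⟨hc, hs⟩
    have hN : ∀ a, a ≠ yVar → a ≠ countVar → τ.nat a = σ.nat a := fun a h1 h2 =>
      hτ.nat a (by simp [searchSum, Cmd.forVerts, Cmd.natWrites, h1, h2])
    have hR : ∀ a, a ≠ sumReal → τ.real a = σ.real a := fun a h1 =>
      hτ.real a (by simp [searchSum, Cmd.forVerts, Cmd.realWrites, h1])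
    have hY' : SearchBest rep M Y τ := hY.congr (hN _ (by omega) (by omega)) (hR _ (by omega))
      (hN _ (by omega) (by omega)) (hN _ (by omega) (by omega)) (hN _ (by omega) (by omega))
      (hN _ (by omega) (by omega))
    refine (Run.forVerts_const
      (by simp [searchRoot, searchAdjust, searchRatio, searchCompare, Cmd.natWrites])
      (fun m => SearchBest rep M (Y ∪ {e | (e.1 = v ∧ e.2.1 = j ∧ e.2.2.1 = x) ∧
        (e.2.2.2 : ℕ) < m})) (by omega) (SearchBest.union_lt_zero hY')
      (fun m ρ x h => h.setNat (by omega) x) ?_).mono le_rfl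
      fun ρ _ h => SearchBest.union_of_lt h
    intro m hm ρ hρ hρm hI
    have hN' : ∀ a, a < 11 ∨ 11 < a ∧ a < 16 ∨ a = countVar → ρ.nat a = τ.nat a := fun a h1 => by
      refine hρ.nat a ?_
      simp [searchRoot, searchAdjust, searchRatio, searchCompare, Cmd.forVerts, Cmd.natWrites]
      omega
    have hR' : ∀ a, a ≠ sumReal' → a ≠ keyReal → a ≠ bestReal → ρ.real a = τ.real a :=
      fun a h1 h2 h3 => hρ.real a (by
        simp [searchRoot, searchAdjust, searchRatio, searchCompare, Cmd.forVerts, Cmd.realWrites,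
          h1, h2, h3])
    have hNσ : ∀ a, a < 11 ∨ 11 < a ∧ a < 16 → ρ.nat a = σ.nat a := fun a h1 => by
      rw [hN' a (by omega), hN a (by omega) (by omega)]
    have := searchRoot_run (σ := ρ) (v := v) (j := j) (x := x) (r := ⟨m, hm⟩)
      (h.congr (hNσ _ (by omega)) (hNσ _ (by omega)) (hNσ _ (by omega))
        (by rw [hR' _ (by omega) (by omega) (by omega), hR _ (by omega)])) hT
      (by rw [hNσ _ (by omega), hv]) (by rw [hNσ _ (by omega), hj])
      (by rw [hNσ _ (by omega), hx]) hρm hjrep hxM hxj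
      (by rw [hN' _ (by omega), hc]) (by rw [hR' _ (by omega) (by omega) (by omega), hs]) hI
    refine this.mono le_rfl fun ρ' _ h => SearchBest.union_lt_succ ?_
    convert h using 2
    ext ⟨v', j', x', r'⟩
    simp [Fin.ext_iff, and_assoc]
  · refine (Run.loopFree (c := .skip) trivial (hY.union_of_not_valid ?_)).bound
      (by simp only [Cmd.cost]; omega)
    rintro ⟨v', j', x', r'⟩ ⟨rfl, rfl, rfl⟩ ⟨_, h1, _⟩
    exact hb (hcond.2 h1)

theorem search_run {rep : ℕ → ℕ} {M : Finset (Fin I.n)} {σ : State}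
    (h : SearchData I rep M σ) :
    Run I search σ (20000000000 * ((I.k + 1) * (I.n * (I.n * I.n))))
      (SearchBest rep M Set.univ) := by
  have hn := I.n_pos
  have key : ∀ {c : Cmd} {τ ρ : State}, c.natWrites ⊆ search.natWrites →
      c.realWrites ⊆ search.realWrites → c.Frame τ ρ → SearchData I rep M τ →
      SearchData I rep M ρ := by
    intro c τ ρ h1 h2 h3 h4
    have h5 := h3.mono h1 h2
    exact h4.congr (h5.nat _ (by simp [natWrites_search])) (h5.nat _ (by simp [natWrites_search]))
      (h5.nat _ (by simp [natWrites_search])) (h5.real _ (by simp [realWrites_search]))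
  have hlast : searchLast.natWrites = [18, 16, 18, 16, 17, 19, 19, 11, 20, 21, 22, 23, 17] := by
    simp [searchLast, searchSum, searchRoot, searchAdjust, searchRatio, searchCompare,
      Cmd.forVerts, Cmd.natWrites]
  have hlast' : searchLast.realWrites = [4, 4, 5, 5, 2, 3] := by
    simp [searchLast, searchSum, searchRoot, searchAdjust, searchRatio, searchCompare,
      Cmd.forVerts, Cmd.realWrites]
  obtain ⟨N, hN⟩ : ∃ N, N = I.n * I.n := ⟨_, rfl⟩
  have hN1 : I.n ≤ N := hN ▸ Nat.le_mul_of_pos_left _ hn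
  unfold search
  refine (Run.seq (B := 5) (B' := 30 * (I.n * (100 * ((I.k + 1) * (6000000 * N)))))
    ((Run.loopFree (c := .assign foundVar (.lit 0)) trivial ?_).bound
      (by simp [Cmd.cost, NExp.cost]))).bound ?_
  · set σ' := Cmd.result I (.assign foundVar (.lit 0)) σ with hσ'
    have h' : SearchData I rep M σ' := h.congr (by simp [hσ', Cmd.result])
      (by simp [hσ', Cmd.result]) (by simp [hσ', Cmd.result]) (by simp [hσ', Cmd.result])
    refine (Run.forVerts_const (by
        simp [Cmd.natWrites_forReps, Cmd.forVerts, Cmd.natWrites, hlast])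
      (fun m => SearchBest rep M (∅ ∪ {e | True ∧ (e.1 : ℕ) < m})) (by nlinarith)
      -- A dummy item: nothing has been found yet, so its value is irrelevant.
      (SearchBest.union_lt_zero ⟨(I.s, I.s, I.s, I.s), Or.inl ⟨?_, by simp⟩, ?_⟩)
      (fun m ρ x h => h.setNat (by omega) x) ?_).mono le_rfl ?_
    · simp [hσ', Cmd.result, NExp.val]
    · simp [hσ', Cmd.result, NExp.val]
    · intro m hm τ hτ hτm hI
      have hdata : SearchData I rep M τ := key (by
        simp [natWrites_search, Cmd.natWrites_forReps, Cmd.forVerts, Cmd.natWrites, hlast]) (by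
        simp [realWrites_search, Cmd.realWrites_forReps, Cmd.forVerts, Cmd.realWrites, hlast'])
        hτ h'
      set Y : Set I.Item := ∅ ∪ {e | True ∧ (e.1 : ℕ) < m} with hY
      refine (Run.forReps (by simp [Cmd.forVerts, Cmd.natWrites, hlast]) (by omega)
        (by simp [Cmd.forVerts, Cmd.natWrites, hlast]) hdata.rep_eq hdata.isRepMap
        (fun l => SearchBest rep M (Y ∪ {e | e.1 = ⟨m, hm⟩ ∧ (e.2.1 : ℕ) < l})) (by omega)
        (SearchBest.union_lt_zero hI) (fun m ρ x h => h.setNat (by omega) x) ?_ ?_).mono le_rfl ?_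
      · intro l hl hlr ρ _ hI'
        refine SearchBest.union_lt_succ (hI'.union_of_not_valid ?_)
        rintro e ⟨_, rfl⟩ ⟨h1, _⟩
        exact hlr h1
      · intro l hl hlr ρ hρ hρl hI'
        -- A representative is a terminal, so the search needs no assumption that terminals exist.
        have hT : I.T.Nonempty := ⟨_, hlr.1.choose_spec⟩
        have hdata' : SearchData I rep M ρ := key (by
          simp [natWrites_search, Cmd.natWrites_forReps, Cmd.forVerts, Cmd.natWrites, hlast]) (by
          simp [realWrites_search, Cmd.realWrites_forReps, Cmd.forVerts, Cmd.realWrites, hlast'])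
          hρ hdata
        have hρm : ρ.nat vVar 0 0 0 = m := by
          rw [hρ.nat _ (by simp [Cmd.natWrites_forReps, Cmd.forVerts, Cmd.natWrites, hlast]), hτm]
        refine (Run.forVerts_const (by simp [hlast])
          (fun i => SearchBest rep M ((Y ∪ {e | e.1 = ⟨m, hm⟩ ∧ (e.2.1 : ℕ) < l}) ∪
            {e | (e.1 = ⟨m, hm⟩ ∧ (e.2.1 : ℕ) = l) ∧ (e.2.2.1 : ℕ) < i}))
          (B := 200000 * I.n) (by omega) (SearchBest.union_lt_zero hI')
          (fun m ρ x h => h.setNat (by omega) x) ?_).mono ?_ ?_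
        · intro i hi π hπ hπi hI''
          have := searchLast_run (σ := π) (v := ⟨m, hm⟩) (j := ⟨l, hl⟩) (x := ⟨i, hi⟩)
            (key (by simp [natWrites_search, Cmd.forVerts, Cmd.natWrites, hlast]) (by
              simp [realWrites_search, Cmd.forVerts, Cmd.realWrites, hlast']) hπ hdata') hT
            (by rw [hπ.nat _ (by simp [Cmd.forVerts, Cmd.natWrites, hlast]), hρm])
            (by rw [hπ.nat _ (by simp [Cmd.forVerts, Cmd.natWrites, hlast]), hρl]) hπi hlr hI''
          refine this.mono le_rfl fun ρ' _ h => SearchBest.union_lt_succ ?_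
          convert h using 2
          ext ⟨v', j', x', r'⟩
          simp [Fin.ext_iff, and_assoc]
        · rw [hN]
          nlinarith
        · intro π _ h
          exact SearchBest.union_lt_succ (SearchBest.union_of_lt h)
      · intro ρ _ h
        refine SearchBest.union_lt_succ ?_
        convert SearchBest.union_of_lt h using 2
        ext e
        simp [Fin.ext_iff]
    · intro τ _ h
      simpa using h
  · rw [← hN]
    nlinarith [Nat.zero_le (I.k * (I.n * N)), Nat.mul_le_mul hn (hn.trans hN1)]

end RealRAM

/-! ### Outcome of the search -/

namespace PriorityNWST

variable {I : PriorityNWST}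

/-- A root of largest priority can absorb any other root, so the greedy algorithm never gets stuck.
-/
theorem exists_valid_choice {M : Finset (Fin I.n)} (hM : 1 < M.card) :
    ∃ c : I.Choice, c.Valid M := by
  obtain ⟨r, hr, hmax⟩ := M.exists_max_image I.P (Finset.card_pos.1 (by omega))
  obtain ⟨y, hy, hyr⟩ := Finset.exists_mem_ne hM r
  refine ⟨⟨r, r, I.P r, {y}⟩, hr, by simpa using hy, by simp, ?_, le_rfl, ?_⟩
  · simpa using hyr.symm
  · simpa using hmax y hy

end PriorityNWST

namespace RealRAM

variable {I : PriorityNWST} {rep : ℕ → ℕ} {M : Finset (Fin I.n)} {σ : State}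

/-- The best item is optimal among all choices, because every choice is matched by an item of no
larger ratio. -/
theorem SearchBest.exists_choice (h : SearchBest rep M Set.univ σ) (hmap : I.IsRepMap rep)
    (hM : M ⊆ insert I.s I.T) (hf : 1 ≤ σ.nat foundVar 0 0 0) :
    ∃ e : I.Item, e.Valid rep M ∧
      (∀ c : I.Choice, c.Valid M → (e.toChoice M).ratio ≤ c.ratio) ∧
      σ.nat bestV 0 0 0 = e.1 ∧ σ.nat bestJ 0 0 0 = e.2.1 ∧
      σ.nat bestLast 0 0 0 = e.2.2.1 ∧ σ.nat bestRoot 0 0 0 = e.2.2.2 := by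
  obtain ⟨e, ⟨h1, _⟩ | ⟨h1, h2, h3, h4⟩, h5⟩ := h
  · omega
  · refine ⟨e, h2, fun c hc => ?_, h5 h1⟩
    obtain ⟨e', he', hle⟩ := hc.exists_item hmap hM ⟨_, h2.1.1.choose_spec⟩
    refine le_trans ?_ hle
    have := h4 e' (Set.mem_univ _) he'
    rw [← h3] at this
    exact_mod_cast this

/-- Two roots would yield a valid choice and hence a valid item. They also imply that there is a
terminal, as the source is the only other possible root. -/
theorem SearchBest.card_le (h : SearchBest rep M Set.univ σ) (hmap : I.IsRepMap rep)
    (hM : M ⊆ insert I.s I.T) (hf : ¬ 1 ≤ σ.nat foundVar 0 0 0) : M.card ≤ 1 := by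
  by_contra hcard
  obtain ⟨c, hc⟩ := PriorityNWST.exists_valid_choice (not_le.1 hcard)
  have hT : I.T.Nonempty := by
    by_contra hT
    rw [Finset.not_nonempty_iff_eq_empty] at hT
    have := Finset.card_le_card hM
    rw [hT] at this
    simp at this
    omega
  obtain ⟨e, he, _⟩ := hc.exists_item hmap hM hT
  obtain ⟨_, ⟨_, h2⟩ | ⟨h1, _⟩, _⟩ := h
  · exact h2 e (Set.mem_univ _) he
  · omega

/-! ### Merging trees -/

notation "zVar" => (24 : ℕ)
notation "pathVar" => (25 : ℕ)

def traceStep : Cmd :=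
  .seq (.ite (.leReal (.prio (.var slotVar)) (.get rateArr (.var zVar) (.lit 0) (.lit 0))) .skip
      (.setReal rateArr (.var zVar) (.lit 0) (.lit 0) (.prio (.var slotVar))))
    (.assign zVar (.get parArr (.var slotVar) (.var srcVar) (.var zVar)))

/-- Raises the rates on the path from `srcVar` to `bestV` to at least the priority of `slotVar`. -/
def trace : Cmd := .seq (.assign zVar (.var bestV)) (.forVerts pathVar traceStep)

theorem natWrites_trace : trace.natWrites = [24, 25, 24, 25] := by
  simp [trace, traceStep, Cmd.forVerts, Cmd.natWrites]

theorem realWrites_trace : trace.realWrites = [0] := by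
  simp [trace, traceStep, Cmd.forVerts, Cmd.realWrites]

/-- Parents are followed for n rounds regardless of the length of the path; the hypothesis `hp` says
that this visits exactly the vertices of p. The order of visits does not matter since rates only
increase to a maximum. -/
theorem trace_run {R : Fin I.n → ℝ≥0} (hR : ∀ u : Fin I.n, σ.real rateArr u 0 0 = R u)
    {j v a b : Fin I.n} {src : ℕ} (hj : σ.nat slotVar 0 0 0 = j) (hsrc : σ.nat srcVar 0 0 0 = src)
    (hv : σ.nat bestV 0 0 0 = v) (p : I.G.Path a b)
    (hp : ∀ y : Fin I.n, y ∈ p.1.support ↔ ∃ i < I.n, (σ.nat parArr j src)^[i] v = y) :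
    Run I trace σ (10000 * I.n) fun τ => ∀ u : Fin I.n,
      τ.real rateArr u 0 0 = (max (R u) (if u ∈ p.1.support then I.P j else 0) : ℝ≥0) := by
  classical
  have hn := I.n_pos
  set pa := σ.nat parArr j src with hpa
  unfold trace
  refine (Run.seq (B := 10) (B' := 30 * (I.n * 200))
    ((Run.loopFree (c := .assign zVar (.var bestV)) trivial ?_).bound
      (by simp [Cmd.cost, NExp.cost]))).bound (by omega)
  refine (Run.forVerts_const (by simp [traceStep, Cmd.natWrites])
    (fun m τ => τ.nat zVar 0 0 0 = pa^[m] v ∧ ∀ u : Fin I.n, τ.real rateArr u 0 0 =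
      (max (R u) (if ∃ i < m, pa^[i] v = u then I.P j else 0) : ℝ≥0)) (by omega)
    ⟨by simp [Cmd.result, NExp.val, hv], fun u => by simp [Cmd.result, hR]⟩
    (by intro m τ x h; simpa using h) ?_).mono le_rfl ?_
  · rintro m hm τ hτ hτm ⟨hz, hI⟩
    refine (Run.loopFree (by simp [traceStep, Cmd.LoopFree]) ?_).bound
      (by simp [traceStep, Cmd.cost, NExp.cost, BExp.cost, RExp.cost])
    have hN : ∀ a, a < 24 → τ.nat a = σ.nat a := fun a ha => by
      rw [hτ.nat a (by simp [traceStep, Cmd.forVerts, Cmd.natWrites]; omega)]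
      simp [Cmd.result, ha.ne]
    have hj' : τ.nat slotVar 0 0 0 = j := by rw [hN _ (by omega), hj]
    have hsrc' : τ.nat srcVar 0 0 0 = src := by rw [hN _ (by omega), hsrc]
    have hpar : τ.nat parArr j src = pa := by rw [hN _ (by omega)]
    set τ' := Cmd.result I (.ite (.leReal (.prio (.var slotVar))
      (.get rateArr (.var zVar) (.lit 0) (.lit 0))) .skip
      (.setReal rateArr (.var zVar) (.lit 0) (.lit 0) (.prio (.var slotVar)))) τ with hτ'
    have hnat : τ'.nat = τ.nat := by
      rw [hτ', Cmd.result]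
      split_ifs <;> simp [Cmd.result]
    have hrate : ∀ u : Fin I.n, τ'.real rateArr u 0 0 =
        (max (R u) (if ∃ i < m + 1, pa^[i] v = u then I.P j else 0) : ℝ≥0) := by
      intro u
      have hsplit : (∃ i < m + 1, pa^[i] v = u) ↔ (∃ i < m, pa^[i] v = u) ∨ pa^[m] v = u := by
        constructor
        · rintro ⟨i, hi, h⟩
          rcases Nat.lt_succ_iff_lt_or_eq.1 hi with hi | rfl
          · exact Or.inl ⟨i, hi, h⟩
          · exact Or.inr h
        · rintro (⟨i, hi, h⟩ | h)
          · exact ⟨i, hi.trans (Nat.lt_succ_self m), h⟩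
          · exact ⟨m, Nat.lt_succ_self m, h⟩
      by_cases hu : pa^[m] v = u
      · rw [if_pos (hsplit.2 (Or.inr hu))]
        have hle : τ.real rateArr u 0 0 ≤ (max (R u) (I.P j) : ℝ≥0) := by
          rw [hI u, NNReal.coe_le_coe]
          refine max_le_max le_rfl ?_
          split_ifs
          · exact le_rfl
          · exact zero_le
        have hge : (R u : ℝ) ≤ τ.real rateArr u 0 0 := by
          rw [hI u, NNReal.coe_le_coe]
          exact le_max_left _ _
        by_cases hc : BExp.Holds I τ (.leReal (.prio (.var slotVar))
            (.get rateArr (.var zVar) (.lit 0) (.lit 0)))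
        · rw [hτ', Cmd.result_ite_pos hc, NNReal.coe_max]
          simp only [BExp.Holds, RExp.val, NExp.val, hj', hz, hu, Fin.is_lt, dite_true,
            Fin.eta] at hc
          exact le_antisymm hle (max_le hge hc)
        · rw [hτ', Cmd.result_ite_neg hc, NNReal.coe_max]
          simp only [BExp.Holds, RExp.val, NExp.val, hj', hz, hu, Fin.is_lt, dite_true,
            Fin.eta, not_le] at hc
          rw [max_eq_right (hge.trans hc.le)]
          simp [Cmd.result, NExp.val, RExp.val, hz, hu, hj']
      · have h1 : (∃ i < m + 1, pa^[i] v = u) ↔ ∃ i < m, pa^[i] v = u := by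
          rw [hsplit, or_iff_left hu]
        simp only [h1]
        rw [← hI u, hτ', Cmd.result]
        split_ifs
        · rfl
        · simp [Cmd.result, NExp.val, hz, Ne.symm hu]
    rw [traceStep, Cmd.result_seq, ← hτ']
    refine ⟨?_, fun u => ?_⟩
    · simp [Cmd.result, NExp.val, hnat, hj', hsrc', hz, hpar, Function.iterate_succ_apply']
    · rw [← hrate u]
      simp [Cmd.result]
  · rintro τ _ ⟨_, h⟩ u
    rw [h u]
    simp only [hp]

end RealRAM

namespace RealRAM

variable {I : PriorityNWST} {rep : ℕ → ℕ} {M : Finset (Fin I.n)} {σ : State}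

theorem TreeData.exists_path (h : TreeData I rep σ) {j r : Fin I.n} (hj : I.IsRep rep j)
    (hjr : I.P j ≤ I.P r) (v : Fin I.n) : ∃ p : I.G.Path r v,
      I.pathWeight (I.P j) p = I.sigma (I.P j) r v ∧
      ∀ y : Fin I.n, y ∈ p.1.support ↔ ∃ i < I.n, (σ.nat parArr j r)^[i] v = y :=
  ((h.trees j hj r).sigma_spec (I.weight_zero r _ hjr) v).2

def mergeLegTest : BExp :=
  .and (.leNat (.lit 1) (.cell aliveArr (.var yVar))) (.and (.not (.eqNat (.var yVar)
    (.var bestRoot))) (inSegment bestV bestJ bestLast yVar))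

/-- Merges the tree with root `yVar` if it belongs to the best choice. -/
def mergeLeg : Cmd :=
  .ite mergeLegTest (.seq (.assign slotVar (.cell repArr (.var yVar)))
    (.seq (.assign srcVar (.var yVar)) (.seq trace (.setCell aliveArr (.var yVar) (.lit 0))))) .skip

/-- Merges the trees of the best choice. -/
def merge : Cmd :=
  .seq (.assign slotVar (.var bestJ)) (.seq (.assign srcVar (.var bestRoot))
    (.seq trace (.forVerts yVar mergeLeg)))

theorem natWrites_merge : merge.natWrites =
    [6, 7, 24, 25, 24, 25, 16, 6, 7, 24, 25, 24, 25, 2, 16] := by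
  simp [merge, mergeLeg, natWrites_trace, Cmd.forVerts, Cmd.natWrites]

theorem realWrites_merge : merge.realWrites = [0, 0] := by
  simp [merge, mergeLeg, realWrites_trace, Cmd.forVerts, Cmd.realWrites]

theorem mergeLeg_run (h : TreeData I rep σ) (hM : M ⊆ insert I.s I.T) {v j x r y : Fin I.n}
    (he : PriorityNWST.Item.Valid rep M (v, j, x, r))
    (hv : σ.nat bestV 0 0 0 = v) (hj : σ.nat bestJ 0 0 0 = j) (hx : σ.nat bestLast 0 0 0 = x)
    (hr : σ.nat bestRoot 0 0 0 = r) (hy : σ.nat yVar 0 0 0 = y)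
    (halive : 1 ≤ σ.nat aliveArr y 0 0 ↔ y ∈ M) {R : Fin I.n → ℝ≥0}
    (hR : ∀ u : Fin I.n, σ.real rateArr u 0 0 = R u) (q : I.G.Path v y)
    (hq : y ∈ M → ∀ z : Fin I.n, z ∈ q.1.support ↔
      ∃ i < I.n, (σ.nat parArr (rep y) y)^[i] v = z) :
    Run I mergeLeg σ (20000 * I.n) fun τ =>
      (∀ z : Fin I.n, τ.nat aliveArr z 0 0 =
        if z = y ∧ y ∈ (PriorityNWST.segment M v (I.P j) x).erase r then 0
        else σ.nat aliveArr z 0 0) ∧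
      ∀ u : Fin I.n, τ.real rateArr u 0 0 = (max (R u)
        (if y ∈ (PriorityNWST.segment M v (I.P j) x).erase r then
          if u ∈ q.1.support then I.P y else 0 else 0) : ℝ≥0) := by
  have hn := I.n_pos
  have hT : I.T.Nonempty := ⟨_, he.1.1.choose_spec⟩
  have hcond : mergeLegTest.Holds I σ ↔
      y ∈ (PriorityNWST.segment M v (I.P j) x).erase r := by
    have h1 : BExp.Holds I σ (.leNat (.lit 1) (.cell aliveArr (.var yVar))) ↔ y ∈ M := by
      rw [← halive]
      simp only [BExp.Holds, NExp.val, hy]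
    have h2 : BExp.Holds I σ (.not (.eqNat (.var yVar) (.var bestRoot))) ↔ y ≠ r := by
      simp only [BExp.Holds, NExp.val, hy, hr, ← le_antisymm_iff, Fin.val_inj, ne_eq]
    have h3 : mergeLegTest.Holds I σ ↔
        BExp.Holds I σ (.leNat (.lit 1) (.cell aliveArr (.var yVar))) ∧
        BExp.Holds I σ (.not (.eqNat (.var yVar) (.var bestRoot))) ∧
        BExp.Holds I σ (inSegment bestV bestJ bestLast yVar) := Iff.rfl
    rw [h3, h1, h2, Finset.mem_erase]
    constructor
    · rintro ⟨h3, h4, h5⟩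
      exact ⟨h4, (h.inSegment_holds hT hM hv hj hx hy he.2.1.1 h3).1 h5⟩
    · rintro ⟨h4, h5⟩
      have h3 := (PriorityNWST.mem_segment.1 h5).1
      exact ⟨h3, h4, (h.inSegment_holds hT hM hv hj hx hy he.2.1.1 h3).2 h5⟩
  unfold mergeLeg
  refine (Run.ite (B := 100 + 10000 * I.n) (fun hb => ?_) fun hb => ?_).bound (by
    simp only [mergeLegTest, NExp.cost, BExp.cost, RExp.cost]; omega)
  · have hyS := hcond.1 hb
    have hyM := (PriorityNWST.mem_segment.1 (Finset.mem_of_mem_erase hyS)).1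
    obtain ⟨ρ, hρ, hPρ, hρrep⟩ := h.isRepMap.rep_spec (hM hyM) hT
    refine (Run.seq (B := 20) (B' := 20 + (10000 * I.n + 20)) ((Run.loopFree (c := .assign slotVar
      (.cell repArr (.var yVar))) trivial ?_).bound (by simp [Cmd.cost, NExp.cost]))).bound
      (by omega)
    refine Run.seq ((Run.loopFree (c := .assign srcVar (.var yVar)) trivial ?_).bound
      (by simp [Cmd.cost, NExp.cost]))
    set σ' := Cmd.result I (.assign srcVar (.var yVar)) (Cmd.result I (.assign slotVar
      (.cell repArr (.var yVar))) σ) with hσ'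
    have hN : ∀ a, a ≠ 6 → a ≠ 7 → σ'.nat a = σ.nat a := fun a h1 h2 => by
      simp [hσ', Cmd.result, h1, h2]
    have hreal : σ'.real = σ.real := rfl
    have h6 : σ'.nat slotVar 0 0 0 = ρ := by
      simp [hσ', Cmd.result, NExp.val, hy, h.rep_eq, hρ]
    have h7 : σ'.nat srcVar 0 0 0 = y := by simp [hσ', Cmd.result, NExp.val, hy]
    refine Run.seq ((trace_run (σ := σ') (R := R) (fun u => by rw [hreal, hR]) h6 h7
      (by rw [hN _ (by omega) (by omega), hv]) q ?_).mono le_rfl fun τ hτ hτR => ?_)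
    · intro z
      rw [hq hyM, hN _ (by omega) (by omega), hρ]
    · refine (Run.loopFree (c := .setCell aliveArr (.var yVar) (.lit 0)) trivial ?_).bound
        (by simp [Cmd.cost, NExp.cost])
      have hτN : ∀ a, a ≠ 6 → a ≠ 7 → a ≠ 24 → a ≠ 25 → τ.nat a = σ.nat a :=
        fun a h1 h2 h3 h4 => by
          rw [hτ.nat a (by simp [natWrites_trace, h3, h4]), hN a h1 h2]
      have hτy : τ.nat yVar 0 0 0 = y := by
        rw [hτN _ (by omega) (by omega) (by omega) (by omega), hy]
      constructor
      · intro z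
        simp [Cmd.result, NExp.val, hτy, hyS, Fin.val_inj, -Finset.mem_erase,
          hτN 2 (by omega) (by omega) (by omega) (by omega)]
      · intro u
        rw [if_pos hyS, ← hPρ, ← hτR u]
        rfl
  · refine (Run.loopFree (c := .skip) trivial ?_).bound (by simp only [Cmd.cost]; omega)
    have hyS := hcond.not.1 hb
    simp [Cmd.result, hyS, hR, -Finset.mem_erase]

/-- The legs are fixed in advance from the initial tables, which `merge` does not write to. The loop
invariant is the upgraded rate with the supremum restricted to the part of S already processed. -/
theorem merge_run (h : TreeData I rep σ) (hM : M ⊆ insert I.s I.T) {e : I.Item}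
    (he : e.Valid rep M) (hv : σ.nat bestV 0 0 0 = e.1) (hj : σ.nat bestJ 0 0 0 = e.2.1)
    (hx : σ.nat bestLast 0 0 0 = e.2.2.1) (hr : σ.nat bestRoot 0 0 0 = e.2.2.2)
    {R : Fin I.n → ℝ≥0} (hroots : HoldsRoots M R σ) :
    Run I merge σ (1000000 * (I.n * I.n)) fun τ =>
      ∃ (p : I.G.Path (e.toChoice M).r (e.toChoice M).v) (q : ∀ r', I.G.Path (e.toChoice M).v r'),
        I.pathWeight (e.toChoice M).b p =
          I.sigma (e.toChoice M).b (e.toChoice M).r (e.toChoice M).v ∧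
        (∀ r' ∈ (e.toChoice M).S,
          I.pathWeight (I.P r') (q r') = I.sigma (I.P r') (e.toChoice M).v r') ∧
        HoldsRoots (insert (e.toChoice M).r (M \ insert (e.toChoice M).r (e.toChoice M).S))
          ((e.toChoice M).upgrade p q R) τ := by
  have hn := I.n_pos
  have hT : I.T.Nonempty := ⟨_, he.1.1.choose_spec⟩
  obtain ⟨v, j, x, r⟩ := e
  obtain ⟨p, hp, hpsupp⟩ := h.exists_path he.1 he.2.2.2.1 v
  have hq : ∀ y : Fin I.n, ∃ q : I.G.Path v y, y ∈ M →
      I.pathWeight (I.P y) q = I.sigma (I.P y) v y ∧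
      ∀ z : Fin I.n, z ∈ q.1.support ↔ ∃ i < I.n, (σ.nat parArr (rep y) y)^[i] v = z := by
    intro y
    by_cases hy : y ∈ M
    · obtain ⟨ρ, hρ, hPρ, hρrep⟩ := h.isRepMap.rep_spec (hM hy) hT
      obtain ⟨q, hq, hqsupp⟩ := h.exists_path hρrep hPρ.le v
      refine ⟨q.reverse, fun _ => ⟨?_, fun z => ?_⟩⟩
      · rw [PriorityNWST.pathWeight_reverse, ← hPρ, hq, PriorityNWST.sigma_comm]
      · rw [hρ, ← hqsupp]
        simp
    · obtain ⟨q⟩ := I.connected.preconnected v y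
      exact ⟨q.toPath, fun h => absurd h hy⟩
  choose q hq using hq
  set S := (PriorityNWST.segment M v (I.P j) x).erase r with hS
  have hSM : S ⊆ M := fun y hy => (PriorityNWST.mem_segment.1 (Finset.mem_of_mem_erase hy)).1
  unfold merge
  refine (Run.seq (B := 20) (B' := 20 + (10000 * I.n + 30 * (I.n * (20000 * I.n))))
    ((Run.loopFree (c := .assign slotVar (.var bestJ)) trivial ?_).bound
      (by simp [Cmd.cost, NExp.cost]))).bound (by nlinarith)
  refine Run.seq ((Run.loopFree (c := .assign srcVar (.var bestRoot)) trivial ?_).bound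
      (by simp [Cmd.cost, NExp.cost]))
  set σ' := Cmd.result I (.assign srcVar (.var bestRoot)) (Cmd.result I (.assign slotVar
    (.var bestJ)) σ) with hσ'
  have hN : ∀ a, a ≠ 6 → a ≠ 7 → σ'.nat a = σ.nat a := fun a h1 h2 => by
    simp [hσ', Cmd.result, h1, h2]
  have hreal : σ'.real = σ.real := rfl
  refine Run.seq ((trace_run (σ := σ') (R := R) (j := j) (src := r) (v := v)
    (fun u => by rw [hreal, hroots.2]) ?_ ?_ (by rw [hN _ (by omega) (by omega), hv]) p
    ?_).mono le_rfl fun τ hτ hτR => ?_)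
  · simp [hσ', Cmd.result, NExp.val, hj]
  · simp [hσ', Cmd.result, NExp.val, hr]
  · intro z
    rw [hpsupp, hN _ (by omega) (by omega)]
  have hτN : ∀ a, a ≠ 6 → a ≠ 7 → a ≠ 24 → a ≠ 25 → τ.nat a = σ.nat a :=
    fun a h1 h2 h3 h4 => by rw [hτ.nat a (by simp [natWrites_trace, h3, h4]), hN a h1 h2]
  have hτr : ∀ a, a ≠ 0 → τ.real a = σ.real a := fun a h1 => by
    rw [hτ.real a (by simp [realWrites_trace, h1]), hreal]
  refine (Run.forVerts_const (by simp [mergeLeg, natWrites_trace, Cmd.natWrites])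
    (fun m ρ => (∀ y : Fin I.n, 1 ≤ ρ.nat aliveArr y 0 0 ↔ y ∈ M ∧ ¬ (y ∈ S ∧ (y : ℕ) < m)) ∧
      ∀ u : Fin I.n, ρ.real rateArr u 0 0 = (max (max (R u) (if u ∈ p.1.support then I.P j else 0))
        ((S.filter fun y : Fin I.n => (y : ℕ) < m).sup fun y =>
          if u ∈ (q y).1.support then I.P y else 0) : ℝ≥0)) (by omega) ⟨fun y => ?_, fun u => ?_⟩
    (by intro m ρ x h; simpa using h) ?_).mono le_rfl ?_
  · rw [hτN _ (by omega) (by omega) (by omega) (by omega), hroots.1]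
    simp
  · simp [hτR u]
  · rintro m hm ρ hρ hρm ⟨hI1, hI2⟩
    have hρN : ∀ a, a ≠ 2 → a ≠ 6 → a ≠ 7 → a ≠ 16 → a ≠ 24 → a ≠ 25 → ρ.nat a = σ.nat a :=
      fun a h1 h2 h3 h4 h5 h6 => by
        rw [hρ.nat a (by simp [mergeLeg, natWrites_trace, Cmd.forVerts, Cmd.natWrites, *]),
          hτN a h2 h3 h5 h6]
    have hρr : ∀ a, a ≠ 0 → ρ.real a = σ.real a := fun a h1 => by
      rw [hρ.real a (by simp [mergeLeg, realWrites_trace, Cmd.forVerts, Cmd.realWrites, *]),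
        hτr a h1]
    have hpar : ρ.nat parArr = σ.nat parArr :=
      hρN _ (by omega) (by omega) (by omega) (by omega) (by omega) (by omega)
    have hdata : TreeData I rep ρ := h.congr
      (hρN _ (by omega) (by omega) (by omega) (by omega) (by omega) (by omega)) hpar
      (hρr _ (by omega))
    refine (mergeLeg_run (σ := ρ) (y := ⟨m, hm⟩) hdata hM he
      (by rw [hρN _ (by omega) (by omega) (by omega) (by omega) (by omega) (by omega), hv])
      (by rw [hρN _ (by omega) (by omega) (by omega) (by omega) (by omega) (by omega), hj])
      (by rw [hρN _ (by omega) (by omega) (by omega) (by omega) (by omega) (by omega), hx])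
      (by rw [hρN _ (by omega) (by omega) (by omega) (by omega) (by omega) (by omega), hr])
      hρm (by rw [hI1]; simp) hI2 (q ⟨m, hm⟩)
      -- Clearing marks during the loop is harmless: the test for y reads only the mark of y, which
      -- has not been touched before its own round.
      (fun hy z => by rw [hpar]; exact (hq _ hy).2 z)).mono le_rfl ?_
    rintro π _ ⟨h1, h2⟩
    rw [← hS] at h1 h2
    constructor
    · intro y
      rw [h1 y]
      split_ifs with hy
      · obtain ⟨rfl, hyS⟩ := hy
        simp [hyS]
      · rw [hI1 y, Nat.lt_succ_iff_lt_or_eq]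
        constructor
        · rintro ⟨h3, h4⟩
          refine ⟨h3, fun h5 => h5.2.elim (fun h6 => h4 ⟨h5.1, h6⟩) fun h6 => hy ?_⟩
          obtain rfl : y = ⟨m, hm⟩ := Fin.ext h6
          exact ⟨rfl, h5.1⟩
        · exact fun h3 => ⟨h3.1, fun h5 => h3.2 ⟨h5.1, Or.inl h5.2⟩⟩
    · intro u
      rw [h2 u, filter_val_lt_succ S hm]
      by_cases hmS : (⟨m, hm⟩ : Fin I.n) ∈ S
      · rw [if_pos hmS, if_pos hmS, Finset.sup_insert]
        exact congrArg _ ((max_assoc _ _ _).trans (congrArg _ (max_comm _ _)))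
      · simp only [if_neg hmS, zero_le, sup_of_le_left]
  · rintro ρ _ ⟨h1, h2⟩
    refine ⟨p, q, hp, fun y hy => (hq y (hSM hy)).1, fun y => ?_, fun u => ?_⟩
    · rw [h1 y]
      have hrS : r ∉ S := Finset.notMem_erase _ _
      have hrM : r ∈ M := he.2.2.1
      simp only [PriorityNWST.Item.toChoice, ← hS, Finset.mem_insert, Finset.mem_sdiff, not_or,
        y.2, and_true]
      rcases eq_or_ne y r with rfl | hne
      · simp [hrS, hrM]
      · simp [hne]
    · have h3 : (S.filter fun y : Fin I.n => (y : ℕ) < I.n) = S := by simp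
      rw [h2 u, h3]
      rfl

end RealRAM

namespace RealRAM

variable {I : PriorityNWST} {rep : ℕ → ℕ} {σ : State}

/-! ### The greedy algorithm -/

notation "iterVar" => (26 : ℕ)

/-- One iteration of the greedy algorithm. -/
def iteration : Cmd := .seq search (.ite (.leNat (.lit 1) (.var foundVar)) merge .skip)

/-- The greedy algorithm. -/
def greedy : Cmd := .forVerts iterVar iteration

/-- The memory holds a state that the greedy algorithm reaches with at least `i` iterations, unless
it has already stopped. -/
def HoldsGreedy (I : PriorityNWST) (i : ℕ) (τ : State) : Prop :=
  ∃ (M : Finset (Fin I.n)) (R : Fin I.n → ℝ≥0),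
    Relation.ReflTransGen I.GreedyStep (insert I.s I.T, I.P) (M, R) ∧ HoldsRoots M R τ ∧
    1 ≤ M.card ∧ (M.card ≤ 1 ∨ M.card + i ≤ I.n)

theorem natWrites_iteration : iteration.natWrites = search.natWrites ++ merge.natWrites := by
  simp [iteration, Cmd.natWrites]

theorem realWrites_iteration : iteration.realWrites = search.realWrites ++ merge.realWrites := by
  simp [iteration, Cmd.realWrites]

/-- Each merge removes at least one root. If the search finds nothing, only one root is left and the
state is kept. -/
theorem iteration_run (h : TreeData I rep σ) {i : ℕ} (hi : HoldsGreedy I i σ) :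
    Run I iteration σ (30000000000 * ((I.k + 1) * (I.n * (I.n * I.n))))
      (HoldsGreedy I (i + 1)) := by
  have hn := I.n_pos
  obtain ⟨M, R, hMR, hroots, hM1, hM2⟩ := hi
  have hM : M ⊆ insert I.s I.T := (PriorityNWST.GreedyInv.of_reachable hMR).subset
  have hbound : 20000000000 * ((I.k + 1) * (I.n * (I.n * I.n))) + (100 + 1000000 * (I.n * I.n)) ≤
      30000000000 * ((I.k + 1) * (I.n * (I.n * I.n))) := by
    have h1 : 1 ≤ I.n * I.n := Nat.mul_pos hn hn
    have h2 : I.n * I.n ≤ I.n * (I.n * I.n) := Nat.le_mul_of_pos_left _ hn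
    have h3 : I.n * (I.n * I.n) ≤ (I.k + 1) * (I.n * (I.n * I.n)) :=
      Nat.le_mul_of_pos_left _ (Nat.succ_pos _)
    omega
  refine (Run.seq (B' := 100 + 1000000 * (I.n * I.n))
    ((search_run ⟨h, hM, hroots.1⟩).mono le_rfl ?_)).bound hbound
  intro τ hτ hbest
  have hN : ∀ a, a < 6 → τ.nat a = σ.nat a := fun a ha => hτ.nat a (by
    simp [natWrites_search]; omega)
  have hR : ∀ a, a < 2 → τ.real a = σ.real a := fun a ha => hτ.real a (by
    simp [realWrites_search]; omega)
  have hroots' : HoldsRoots M R τ :=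
    ⟨fun x => by rw [hN _ (by omega), hroots.1], fun x => by rw [hR _ (by omega), hroots.2]⟩
  have hdata : TreeData I rep τ := h.congr (hN _ (by omega)) (hN _ (by omega)) (hR _ (by omega))
  refine (Run.ite (B := 1 + 1000000 * (I.n * I.n)) (fun hb => ?_) fun hb => ?_).bound (by
    simp only [BExp.cost, NExp.cost]; omega)
  · obtain ⟨e, he, hmin, hv, hj, hx, hr⟩ := hbest.exists_choice h.isRepMap hM hb
    refine (merge_run hdata hM he hv hj hx hr hroots').mono (by omega) ?_
    rintro ρ _ ⟨p, q, hp, hq, hρ⟩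
    have hvalid := he.toChoice
    have hcard := hvalid.card_merge
    have hS := hvalid.2.2.1.card_pos
    have hpos : 1 ≤ (insert (e.toChoice M).r
        (M \ insert (e.toChoice M).r (e.toChoice M).S)).card :=
      (Finset.insert_nonempty _ _).card_pos
    exact ⟨insert (e.toChoice M).r (M \ insert (e.toChoice M).r (e.toChoice M).S), _,
      hMR.tail ⟨by dsimp only; omega, _, hvalid, hmin, p, q, hp, hq, rfl, rfl⟩,
      hρ, hpos, by omega⟩
  · refine (Run.loopFree (c := .skip) trivial ?_).bound (by simp only [Cmd.cost]; omega)
    exact ⟨M, R, hMR, hroots', hM1, Or.inl (hbest.card_le h.isRepMap hM hb)⟩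

/-- After n rounds the alternative |M| + n ≤ n is impossible, since M is nonempty, so a single root
is left. -/
theorem greedy_run (h : TreeData I rep σ) (hσ : HoldsRoots (insert I.s I.T) I.P σ) :
    Run I greedy σ (30 * (I.n * (30000000000 * ((I.k + 1) * (I.n * (I.n * I.n))))))
      fun τ => ∃ R, I.GreedyOutput R ∧ ∀ v : Fin I.n, τ.real rateArr v 0 0 = R v := by
  have hn := I.n_pos
  refine (Run.forVerts_const (by simp [natWrites_iteration, natWrites_search, natWrites_merge])
    (fun i => HoldsGreedy I i) (Nat.mul_pos (by norm_num) (Nat.mul_pos (Nat.succ_pos _)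
      (Nat.mul_pos hn (Nat.mul_pos hn hn)))) ?_ ?_ ?_).mono le_rfl ?_
  · refine ⟨_, _, .refl, hσ, (Finset.insert_nonempty _ _).card_pos, Or.inr ?_⟩
    simpa using (insert I.s I.T).card_le_univ
  · rintro m τ x ⟨M, R, h1, h2, h3⟩
    exact ⟨M, R, h1, ⟨fun y => by simpa using h2.1 y, h2.2⟩, h3⟩
  · intro m _ τ hτ _ hI
    refine iteration_run (h.congr ?_ ?_ ?_) hI
    · exact hτ.nat _ (by
        simp [Cmd.forVerts, Cmd.natWrites, natWrites_iteration, natWrites_search, natWrites_merge])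
    · exact hτ.nat _ (by
        simp [Cmd.forVerts, Cmd.natWrites, natWrites_iteration, natWrites_search, natWrites_merge])
    · exact hτ.real _ (by
        simp [Cmd.forVerts, Cmd.realWrites, realWrites_iteration, realWrites_search,
          realWrites_merge])
  · rintro τ _ ⟨M, R, h1, h2, h3, h4⟩
    exact ⟨R, ⟨M, h1, by omega⟩, h2.2⟩

/-- The greedy algorithm, followed by the computation of a tree. -/
def greedyProgram : Cmd :=
  .seq setupRoots (.seq setupReps (.seq setupTrees (.seq greedy finish)))

theorem greedyProgram_run (σ : State) :
    Run I greedyProgram σ (10 ^ 13 * ((I.k + 1) * (I.n * (I.n * (I.n * I.n))))) fun τ =>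
      ∃ (R : Fin I.n → ℝ≥0) (H : I.G.Subgraph),
        I.GreedyOutput R ∧ τ.Holds H R ∧ I.IsPNWST H R := by
  have hn := I.n_pos
  have hbound : 10000 * I.n + (100000 * (I.n * I.n) +
      (10 ^ 12 * ((I.k + 1) * (I.n * (I.n * (I.n * I.n)))) +
      (30 * (I.n * (30000000000 * ((I.k + 1) * (I.n * (I.n * I.n))))) +
      10000000 * (I.n * (I.n * I.n))))) ≤
      10 ^ 13 * ((I.k + 1) * (I.n * (I.n * (I.n * I.n)))) := by
    have h1 : I.n ≤ I.n * I.n := Nat.le_mul_of_pos_left _ hn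
    have h2 : I.n * I.n ≤ I.n * (I.n * I.n) := Nat.le_mul_of_pos_left _ hn
    have h3 : I.n * (I.n * I.n) ≤ I.n * (I.n * (I.n * I.n)) := Nat.le_mul_of_pos_left _ hn
    have h4 : I.n * (I.n * (I.n * I.n)) ≤ (I.k + 1) * (I.n * (I.n * (I.n * I.n))) :=
      Nat.le_mul_of_pos_left _ (Nat.succ_pos _)
    have h5 : I.n * (30000000000 * ((I.k + 1) * (I.n * (I.n * I.n)))) =
      30000000000 * ((I.k + 1) * (I.n * (I.n * (I.n * I.n)))) := by ring
    rw [h5]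
    omega
  unfold greedyProgram
  refine (Run.seq ((setupRoots_run σ).mono le_rfl fun τ₁ _ h1 => ?_)).bound hbound
  refine Run.seq ((setupReps_run τ₁).mono le_rfl fun τ₂ hτ₂ h2 => ?_)
  refine Run.seq ((setupTrees_run (fun _ => rfl) h2).mono le_rfl fun τ₃ hτ₃ h3 => ?_)
  have hroots : HoldsRoots (insert I.s I.T) I.P τ₃ := by
    have ha : τ₃.nat aliveArr = τ₁.nat aliveArr := by
      rw [hτ₃.nat _ (by simp [setupTrees, Cmd.forReps, grow, growInit, growRound, growSearch,
        growScan, growExtend, Cmd.forVerts, Cmd.natWrites]),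
        hτ₂.nat _ (by simp [setupReps, Cmd.forVerts, Cmd.natWrites])]
    have hr : τ₃.real rateArr = τ₁.real rateArr := by
      rw [hτ₃.real _ (by simp [setupTrees, Cmd.forReps, grow, growInit, growRound, growSearch,
        growScan, growExtend, Cmd.forVerts, Cmd.realWrites]),
        hτ₂.real _ (by simp [setupReps, Cmd.forVerts, Cmd.realWrites])]
    exact ⟨fun x => by rw [ha, h1.1], fun x => by rw [hr, h1.2]⟩
  have hrep : ∀ x, τ₃.nat repArr x 0 0 = τ₂.nat repArr x 0 0 := fun x => by
    rw [hτ₃.nat _ (by simp [setupTrees, Cmd.forReps, grow, growInit, growRound, growSearch,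
      growScan, growExtend, Cmd.forVerts, Cmd.natWrites])]
  refine Run.seq ((greedy_run ⟨hrep, h2, h3⟩ hroots).mono le_rfl ?_)
  rintro τ₄ _ ⟨R, hR, h4⟩
  refine (finish_run h4 hR.feasible).mono le_rfl ?_
  rintro τ₅ _ ⟨H, h5, h6⟩
  exact ⟨R, H, hR, h5, h6⟩

end RealRAM

/-! ### The theorem -/

theorem mainTheorem1 :
    (∀ (I : PriorityNWST) (R : Fin I.n → ℝ≥0), I.GreedyOutput R →
      (∃ H : I.G.Subgraph, I.IsPNWST H R) ∧
      ∀ H : I.G.Subgraph, I.IsPNWST H R →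
        (I.weight H R : ℝ) ≤ 2 * Real.log (I.T.card + 1) * I.opt) ∧
    ∃ (prog : RealRAM.Cmd) (C : ℝ), ∀ I : PriorityNWST,
      ∃ (t : ℕ) (σ : RealRAM.State) (H : I.G.Subgraph) (R : Fin I.n → ℝ≥0),
        RealRAM.Exec I prog RealRAM.State.zero t σ ∧ σ.Holds H R ∧
        I.GreedyOutput R ∧ I.IsPNWST H R ∧
        (I.weight H R : ℝ) ≤ 2 * Real.log (I.T.card + 1) * I.opt ∧
        (I.T.Nonempty → (t : ℝ) ≤ C * ((I.n : ℝ) ^ 4 * I.k * Real.log I.n)) := by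
  refine ⟨fun I R hR => ⟨hR.feasible.exists_isPNWST, fun H hH => hR.weight_le hH⟩,
    -- The constant is 10 ^ 13 times 2 from k + 1 ≤ 2k and 2 from 1 ≤ 2 ln n.
    RealRAM.greedyProgram, 4 * 10 ^ 13, fun I => ?_⟩
  obtain ⟨t, σ, hexec, ht, R, H, hR, hσ, hH⟩ :=
    RealRAM.greedyProgram_run (I := I) RealRAM.State.zero
  refine ⟨t, σ, H, R, hexec, hσ, hR, hH, hR.weight_le hH, fun hT => ?_⟩
  have hk : (1 : ℝ) ≤ I.k := by exact_mod_cast (hT.image I.P).card_pos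
  -- The source and a terminal are two distinct vertices, so ln n ≥ ln 2 > 1/2.
  have hn : (2 : ℝ) ≤ I.n := by
    have h1 := (insert I.s I.T).card_le_univ
    rw [Finset.card_insert_of_notMem I.source_notMem, Fintype.card_fin] at h1
    have h2 := hT.card_pos
    exact_mod_cast (by omega : 2 ≤ I.n)
  have hlog : 1 ≤ 2 * Real.log I.n := by
    have h1 := Real.log_two_gt_d9
    have h2 := Real.log_le_log (by norm_num) hn
    linarith
  have ht' : (t : ℝ) ≤ 10 ^ 13 * ((I.k + 1) * (I.n * (I.n * (I.n * I.n)))) := by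
    exact_mod_cast ht
  calc (t : ℝ) ≤ 10 ^ 13 * ((I.k + 1) * (I.n : ℝ) ^ 4) := ht'.trans_eq (by ring)
    _ ≤ 10 ^ 13 * (2 * I.k * (I.n : ℝ) ^ 4) := by gcongr; linarith
    _ = 2 * 10 ^ 13 * ((I.n : ℝ) ^ 4 * I.k) * 1 := by ring
    _ ≤ 2 * 10 ^ 13 * ((I.n : ℝ) ^ 4 * I.k) * (2 * Real.log I.n) := by gcongr
    _ = 4 * 10 ^ 13 * ((I.n : ℝ) ^ 4 * I.k * Real.log I.n) := by ring
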